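/- **Setting.** Let $p$ be a prime, $\omega=e^{2\pi i/p}$, $X|j\rangle=|j+1\rangle$, $Z|j\rangle=\omega^j|j\rangle$ on $\mathbb C^p$ with basis $|j\rangle$, $j\in\mathbb Z_p$, and $D_{x,z}=\omega^{2^{-1}xz}X^xZ^z$ with $2^{-1}$ the inverse in $\mathbb Z_p$ (for $p=2$: $D_{x,z}=i^{xz}X^xZ^z$, the Pauli operators). The $n$-qudit Clifford group is the normalizer, in the unitary group, of the group generated by the $n$-fold tensor products of the $D_{x,z}$; stabilizer states are the images of the computational basis states under it, and a stabilizer projector is the rank-one projector onto a stabilizer state. For $j=1,\dots,p+1$ and $q\in\mathbb Z_p$ let $\Pi_j^q$ be the projector onto the eigenvector with eigenvalue $\omega^q$ of the $j$-th operator of the list $D_{0,1},D_{1,0},D_{1,1},\dots,D_{1,p-1}$, and for $\vec r\in\mathbb Z_p^{p+1}$ let $A^{\vec r}=-\mathbb I+\sum_{j}\Pi_j^{r_j}$. Facet labels are all $\vec r\in\mathbb Z_2^3$ if $p=2$, and the vectors $\vec r=x\vec a+z\vec b$ ($x,z\in\mathbb Z_p$), $\vec a=[1,0,1,\dots,p-1]$,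 $\vec b=-[0,1,1,\dots,1]$, if $p>2$. The polytope $\mathcal P_{\rm SIM}$ consists of the Hermitian $\rho$ with $\mathrm{Tr}\,\rho=1$ and $\mathrm{Tr}(\rho A^{\vec r})\ge 0$ for all facet labels $\vec r$. For a facet label $\vec r$ let $\{\Pi\}^{\vec r}$ be the set of all projectors $\Pi_j^{s}\otimes|k\rangle\langle k|$ with $1\le j\le p+1$, $s\ne r_j$, $k\in\mathbb Z_p$, together with the projectors onto all entangled two-qudit stabilizer states, and let $\Sigma^{\vec r}$ be the sum of its elements. The exclusivity graph of a finite set of projectors has the projectors as vertices, two being adjacent if they are distinct and orthogonal; let $\Gamma^{\vec r}$ be that of $\{\Pi\}^{\vec r}$. A noncontextual value assignment gives each projector $0$ or $1$, and never $1$ to two distinct orthogonal ones; a noncontextual (NCHV) model is a probability distribution over value assignments; a noncontextuality inequality $\sum_P c_P\langle P\rangle\le\beta$ is one that holds for all value assignments. A one-qudit state $\rho$ exhibits contextuality (with respect to stabilizer measurements) if, for some ancilla $\sigma$ that is a mixture of stabilizer states of some number $n\ge 0$ of qudits, $\rho\otimes\sigma$ violates a noncontextuality inequality for a finite set of $(n+1)$-qudit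 stabilizer projectors. For $\lambda=(x_i,z_i)_{i\le n}$ put $A_\lambda=\bigotimes_i A^{x_i\vec a+z_i\vec b}$; the discrete Wigner function of an $n$-qudit state $\tau$ is $W_\tau(\lambda)=p^{-n}\,\mathrm{Tr}(\tau A_\lambda)$. **Theorem.** Let $p$ be a prime. 1. For every facet label $\vec r$: the independence number is $\alpha(\Gamma^{\vec r})=p^3$; the largest value of $\Sigma^{\vec r}$ in NCHV models is $p^3$, so that $\mathrm{Tr}[\Sigma^{\vec r}(\rho\otimes\sigma)]\le p^3$ is a noncontextuality inequality; and for all one-qudit states $\rho,\sigma$, $\mathrm{Tr}[\Sigma^{\vec r}(\rho\otimes\sigma)]>p^3$ if and only if $\mathrm{Tr}(A^{\vec r}\rho)<0$. Hence for all one-qudit states $\rho,\sigma$, some inequality $\mathrm{Tr}[\Sigma^{\vec r}(\rho\otimes\sigma)]\le p^3$ is violated if and only if $\rho\notin\mathcal P_{\rm SIM}$. 2. If $p>2$, then for every facet label $\vec r$ $$\max_{\tau}\mathrm{Tr}(\Sigma^{\vec r}\tau)=\vartheta(\Gamma^{\vec r})=\alpha^*(\Gamma^{\vec r})=p^3+1,$$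 where $\tau$ runs over the two-qudit states, $\vartheta$ is the Lovász number and $\alpha^*$ the fractional packing number; and there is a one-qudit state $\rho$ such that $\rho\otimes\sigma$ attains the maximum for every one-qudit state $\sigma$. 3. If $p>2$, a one-qudit state $\rho$ exhibits contextuality if and only if $\rho\notin\mathcal P_{\rm SIM}$, equivalently (for any one-qudit state $\sigma$) if and only if it violates one of the inequalities $\mathrm{Tr}[\Sigma^{\vec r}(\rho\otimes\sigma)]\le p^3$. 4. Let $p>2$ and $n\ge0$. All mixtures of $n$-qudit stabilizer states have nonnegative $W$, and if $\rho\in\mathcal P_{\rm SIM}$ is a state and $\sigma$ is an $n$-qudit state with $W_\sigma\ge0$, then $W_{\rho\otimes\sigma}\ge0$. For every $n$-qudit state $\tau$ with $W_\tau\ge0$, the discrete Wigner function is an NCHV model of all stabilizer measurements: $W_\tau$ is a probability distribution on $(\mathbb Z_p^2)^n$; for each $\lambda$, $P\mapsto\mathrm{Tr}(PA_\lambda)$ is a noncontextual value assignment to all stabilizer projectors which gives $1$ to exactly one element of every orthonormal basis of stabilizer states; and $\mathrm{Tr}(P\tau)=\sum_\lambda W_\tau(\lambda)\,\mathrm{Tr}(PA_\lambda)$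 for all stabilizer projectors $P$. Consequently $\tau$ violates no noncontextuality inequality for a finite set $S$ of stabilizer projectors; in particular $\mathrm{Tr}\big(\sum_{P\in S}P\,\tau\big)\le\alpha(\Gamma_S)$, with $\Gamma_S$ the exclusivity graph of $S$. -/

import Mathlib

open scoped BigOperators Matrix ComplexOrder

noncomputable section

namespace QuditContextuality

/-! ## Operators, states, tensor products -/

/-- Operators on one `p`-dimensional system, in the computational basis `|j⟩`, `j ∈ ℤ_p`. -/
abbrev Op1 (p : ℕ) := Matrix (ZMod p) (ZMod p) ℂ

/-- Operators on `n` systems of dimension `p`; the basis is indexed by `ℤ_p ^ n`. -/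
abbrev Op (p n : ℕ) := Matrix (Fin n → ZMod p) (Fin n → ZMod p) ℂ

/-- Density operators. -/
def IsState {ι : Type*} [Fintype ι] (ρ : Matrix ι ι ℂ) : Prop :=
  ρ.PosSemidef ∧ ρ.trace = 1

/-- The expectation value `Tr (A ρ)`. It is real for all Hermitian `A` and `ρ`. -/
def expval {ι : Type*} [Fintype ι] (A ρ : Matrix ι ι ℂ) : ℝ :=
  (A * ρ).trace.re

/-- The tensor product `M 0 ⊗ ⋯ ⊗ M (n - 1)` of one-qudit operators. -/
def tensor {p n : ℕ} (M : Fin n → Op1 p) : Op p n :=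
  Matrix.of fun k l => ∏ i, M i (k i) (l i)

/-- The tensor product `ρ ⊗ σ` of a one-qudit operator with an operator on `n` further qudits. -/
def adjoinAncilla {p n : ℕ} (ρ : Op1 p) (σ : Op p n) : Op p (n + 1) :=
  Matrix.of fun k l => ρ (k 0) (l 0) * σ (Fin.tail k) (Fin.tail l)

/-! ## Weyl-Heisenberg operators, the Clifford group and stabilizer states -/

/-- `ω = exp (2 π i / p)`. -/
def omega (p : ℕ) : ℂ := Complex.exp (2 * Real.pi * Complex.I / p)

/-- `ω ^ (2⁻¹)`, where `2⁻¹` is the inverse of `2` in `ℤ_p`; for `p = 2` it is replaced by `i`. -/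
def tau (p : ℕ) : ℂ :=
  if p = 2 then Complex.I else omega p ^ ((2 : ZMod p)⁻¹).val

/-- `X |j⟩ = |j + 1⟩`. -/
def shiftX (p : ℕ) : Op1 p := Matrix.of fun k j => if k = j + 1 then 1 else 0

/-- `Z |j⟩ = ω ^ j |j⟩`. -/
def clockZ (p : ℕ) : Op1 p := Matrix.diagonal fun j => omega p ^ j.val

/-- The displacement operators `D_{x,z} = ω ^ (2⁻¹ x z) X ^ x Z ^ z`
(for `p = 2`: the Pauli operators `1, X, Z, Y`). -/
def displacement (p : ℕ) [NeZero p] (x z : ZMod p) : Op1 p :=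
  tau p ^ (x.val * z.val) • (shiftX p ^ x.val * clockZ p ^ z.val)

/-- The group generated by the `n`-fold tensor products of displacement operators. -/
def weylGroup (p n : ℕ) [NeZero p] : Subgroup (Matrix.unitaryGroup (Fin n → ZMod p) ℂ) :=
  Subgroup.closure
    {g | ∃ x z : Fin n → ZMod p, (g : Op p n) = tensor fun i => displacement p (x i) (z i)}

/-- The Clifford group: the normalizer in the unitary group of the group generated by the
tensor products of displacement operators. -/
def cliffordGroup (p n : ℕ) [NeZero p] : Subgroup (Matrix.unitaryGroup (Fin n → ZMod p) ℂ) :=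
  Subgroup.normalizer (weylGroup p n : Set (Matrix.unitaryGroup (Fin n → ZMod p) ℂ))

/-- The rank-one projectors `U |k⟩⟨k| U†` onto the `n`-qudit stabilizer states, that is, onto the
images of computational basis states under the Clifford group. -/
def stabilizerProjectors (p n : ℕ) [NeZero p] : Set (Op p n) :=
  {P | ∃ U ∈ cliffordGroup p n, ∃ k : Fin n → ZMod p,
    P = (U : Op p n) * Matrix.single k k 1 * (U : Op p n)ᴴ}

/-! ## Phase-point type operators and the simulable polytope -/

/-- The `p + 1` operators `D_{0,1}, D_{1,0}, D_{1,1}, …, D_{1,p-1}`, labelled by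
`none, some 0, some 1, …, some (p - 1)`. -/
def mubOperator (p : ℕ) [NeZero p] : Option (ZMod p) → Op1 p
  | none => displacement p 0 1
  | some k => displacement p 1 k

/-- The projector `Π_j ^ q` onto the eigenvector with eigenvalue `ω ^ q` of the `j`-th operator `W`
of the list. As `W ^ p = 1`, this spectral projector is `p⁻¹ ∑ m, ω ^ (- q m) W ^ m`. -/
def mubProjector (p : ℕ) [NeZero p] (j : Option (ZMod p)) (q : ZMod p) : Op1 p :=
  (p : ℂ)⁻¹ • ∑ m ∈ Finset.range p, ((omega p ^ (q.val * m))⁻¹ • mubOperator p j ^ m)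

/-- `A ^ r = - 1 + ∑ j, Π_j ^ (r_j)`. -/
def facetOperator (p : ℕ) [NeZero p] (r : Option (ZMod p) → ZMod p) : Op1 p :=
  -1 + ∑ j, mubProjector p j (r j)

/-- The vector `x a + z b`, where `a = [1, 0, 1, …, p - 1]` and `b = - [0, 1, 1, …, 1]`. -/
def phaseVector {p : ℕ} (x z : ZMod p) : Option (ZMod p) → ZMod p
  | none => x
  | some k => x * k - z

/-- The labels `r` of the facets of the simulable polytope: all `r ∈ ℤ_2 ^ 3` if `p = 2`, and the
vectors `x a + z b` with `x, z ∈ ℤ_p` if `p > 2`. -/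
def facets (p : ℕ) : Set (Option (ZMod p) → ZMod p) :=
  {r | p ≠ 2 → ∃ x z : ZMod p, r = phaseVector x z}

/-- The simulable polytope, in the space of Hermitian operators of trace one. -/
def simPolytope (p : ℕ) [NeZero p] : Set (Op1 p) :=
  {ρ | ρ.IsHermitian ∧ ρ.trace = 1 ∧ ∀ r ∈ facets p, 0 ≤ expval (facetOperator p r) ρ}

/-! ## Tests, exclusivity graphs, noncontextual hidden variables -/

/-- The exclusivity graph of a finite set of projectors: distinct projectors are adjacent if they
are orthogonal. -/
def exclusivityGraph {p n : ℕ} [NeZero p] (S : Finset (Op p n)) : SimpleGraph S where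
  Adj P Q := P ≠ Q ∧ (P : Op p n) * Q = 0 ∧ (Q : Op p n) * P = 0
  symm := ⟨fun _ _ h => ⟨h.1.symm, h.2.2, h.2.1⟩⟩
  loopless := ⟨fun _ h => h.1 rfl⟩

/-- A noncontextual value assignment to the projectors in `T`: each of them gets the value `0` or
`1`, and of two distinct orthogonal ones (which can be measured together) at most one gets `1`. -/
def IsValueAssignment {p n : ℕ} [NeZero p] (T : Set (Op p n)) (v : Op p n → ℝ) : Prop :=
  (∀ P ∈ T, v P = 0 ∨ v P = 1) ∧
    ∀ P ∈ T, ∀ Q ∈ T, P ≠ Q → P * Q = 0 → ¬ (v P = 1 ∧ v Q = 1)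

/-- The values of `Σ = ∑ P ∈ S, P` in noncontextual hidden variable models: the averages, over
probability distributions, of the values in noncontextual value assignments. -/
def nchvValues {p n : ℕ} [NeZero p] (S : Finset (Op p n)) : Set ℝ :=
  convexHull ℝ {x | ∃ v, IsValueAssignment (S : Set (Op p n)) v ∧ x = ∑ P ∈ S, v P}

/-- `∑ P ∈ S, c P ⟨P⟩ ≤ β` is a noncontextuality inequality: it holds for all noncontextual value
assignments, hence for all noncontextual hidden variable models. -/
def IsNoncontextualityInequality {p n : ℕ} [NeZero p] (S : Finset (Op p n)) (c : Op p n → ℝ)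
    (β : ℝ) : Prop :=
  ∀ v, IsValueAssignment (S : Set (Op p n)) v → ∑ P ∈ S, c P * v P ≤ β

/-- The one-qudit state `ρ` exhibits contextuality with respect to stabilizer measurements: with an
ancilla of some number of qudits in a mixture of stabilizer states, it violates a noncontextuality
inequality constructed from stabilizer projectors. -/
def ExhibitsContextuality (p : ℕ) [NeZero p] (ρ : Op1 p) : Prop :=
  ∃ n : ℕ, ∃ σ ∈ convexHull ℝ (stabilizerProjectors p n), ∃ S : Finset (Op p (n + 1)),
    (S : Set (Op p (n + 1))) ⊆ stabilizerProjectors p (n + 1) ∧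
      ∃ (c : Op p (n + 1) → ℝ) (β : ℝ), IsNoncontextualityInequality S c β ∧
        β < ∑ P ∈ S, c P * expval P (adjoinAncilla ρ σ)

/-- A noncontextual hidden variable model, for the state `τ`, of all stabilizer measurements on `n`
qudits: a probability distribution `μ` on a finite set `Λ` and, for each `l ∈ Λ`, a noncontextual
value assignment to all stabilizer projectors which gives the value `1` to exactly one outcome of
each stabilizer measurement, such that the average values are the quantum probabilities. -/
def IsNCHVModel {p n : ℕ} [NeZero p] (τ : Op p n) {Λ : Type*} [Fintype Λ]
    (μ : Λ → ℝ) (v : Λ → Op p n → ℝ) : Prop :=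
  (∀ l, 0 ≤ μ l) ∧ ∑ l, μ l = 1 ∧
    (∀ l, IsValueAssignment (stabilizerProjectors p n) (v l)) ∧
    (∀ l, ∀ B : Finset (Op p n), (B : Set (Op p n)) ⊆ stabilizerProjectors p n →
      (∀ P ∈ B, ∀ Q ∈ B, P ≠ Q → P * Q = 0) → ∑ P ∈ B, P = 1 → ∃! P, P ∈ B ∧ v l P = 1) ∧
    ∀ P ∈ stabilizerProjectors p n, expval P τ = ∑ l, μ l * v l P

/-- The phase-point operator `A_l = ⨂ i, A ^ (x_i a + z_i b)`, for `l = (x_i, z_i)_i`. -/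
def phasePointOperator (p n : ℕ) [NeZero p] (l : Fin n → ZMod p × ZMod p) : Op p n :=
  tensor fun i => facetOperator p (phaseVector (l i).1 (l i).2)

/-- The discrete Wigner function `p ^ (-n) Tr (τ A_l)` of an `n`-qudit operator `τ`. -/
def wigner {p n : ℕ} [NeZero p] (τ : Op p n) (l : Fin n → ZMod p × ZMod p) : ℝ :=
  expval (phasePointOperator p n l) τ / (p : ℝ) ^ n

/-- The `n`-qudit states with nonnegative discrete Wigner function. -/
def wignerPositive (p n : ℕ) [NeZero p] : Set (Op p n) :=
  {τ | IsState τ ∧ ∀ l, 0 ≤ wigner τ l}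

/-! ## Graph parameters -/

/-- The Lovász number, as the optimal value of its semidefinite program. -/
def lovaszTheta {V : Type*} [Fintype V] (G : SimpleGraph V) : ℝ :=
  sSup {t | ∃ B : Matrix V V ℝ, B.PosSemidef ∧ B.trace = 1 ∧ (∀ i j, G.Adj i j → B i j = 0) ∧
    t = ∑ i, ∑ j, B i j}

/-- The fractional packing number: the largest total weight of nonnegative vertex weights such that
each clique has weight at most one. -/
def fractionalPackingNumber {V : Type*} [Fintype V] (G : SimpleGraph V) : ℝ :=
  sSup {t | ∃ w : V → ℝ, (∀ i, 0 ≤ w i) ∧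
    (∀ C : Finset V, G.IsClique (C : Set V) → ∑ i ∈ C, w i ≤ 1) ∧ t = ∑ i, w i}

/-! ## There are finitely many stabilizer projectors -/

/-- Generalized permutation matrices whose nonzero entries are `N`-th roots of unity. -/
def IsMonomial {ι : Type*} [DecidableEq ι] (N : ℕ) (M : Matrix ι ι ℂ) : Prop :=
  ∃ (s : Equiv.Perm ι) (c : ι → ℂ), (∀ l, c l ^ N = 1) ∧
    M = Matrix.of fun k l => if k = s l then c l else 0

theorem finite_isMonomial {ι : Type*} [DecidableEq ι] [Finite ι] {N : ℕ} (hN : 0 < N) :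
    {M : Matrix ι ι ℂ | IsMonomial N M}.Finite := by
  have h1 : {x : ℂ | x ^ N = 1}.Finite := by
    refine (Polynomial.nthRootsFinset N (1 : ℂ)).finite_toSet.subset ?_
    intro x hx
    simpa [Polynomial.mem_nthRootsFinset hN] using hx
  have h2 : {c : ι → ℂ | ∀ l, c l ^ N = 1}.Finite := by
    have := Set.Finite.pi (t := fun _ : ι => {x : ℂ | x ^ N = 1}) (fun _ => h1)
    refine this.subset ?_
    intro c hc l _
    exact hc l
  refine ((Set.finite_univ (α := Equiv.Perm ι)).prod h2 |>.image
    (fun q => (Matrix.of fun k l => if k = q.1 l then q.2 l else 0 : Matrix ι ι ℂ))).subset ?_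
  rintro M ⟨s, c, hc, rfl⟩
  exact ⟨(s, c), ⟨trivial, hc⟩, rfl⟩

theorem IsMonomial.one {ι : Type*} [DecidableEq ι] (N : ℕ) :
    IsMonomial N (1 : Matrix ι ι ℂ) :=
  ⟨1, fun _ => 1, fun _ => one_pow _, by ext k l; simp [Matrix.one_apply]; rfl⟩

theorem IsMonomial.mul {ι : Type*} [DecidableEq ι] [Fintype ι] {N : ℕ} {A B : Matrix ι ι ℂ}
    (hA : IsMonomial N A) (hB : IsMonomial N B) : IsMonomial N (A * B) := by
  obtain ⟨s, c, hc, rfl⟩ := hA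
  obtain ⟨t, d, hd, rfl⟩ := hB
  refine ⟨s * t, fun l => c (t l) * d l, fun l => by rw [mul_pow, hc, hd, one_mul], ?_⟩
  ext k l
  simp [Matrix.mul_apply]
  rfl

theorem IsMonomial.pow {ι : Type*} [DecidableEq ι] [Fintype ι] {N : ℕ} {A : Matrix ι ι ℂ}
    (hA : IsMonomial N A) (m : ℕ) : IsMonomial N (A ^ m) := by
  induction m with
  | zero => simpa using IsMonomial.one N
  | succ m ih => rw [pow_succ]; exact ih.mul hA

theorem IsMonomial.smul {ι : Type*} [DecidableEq ι] {N : ℕ} {A : Matrix ι ι ℂ}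
    (hA : IsMonomial N A) {a : ℂ} (ha : a ^ N = 1) : IsMonomial N (a • A) := by
  obtain ⟨s, c, hc, rfl⟩ := hA
  refine ⟨s, fun l => a * c l, fun l => by rw [mul_pow, hc, ha, one_mul], ?_⟩
  ext k l
  simp

theorem IsMonomial.conjTranspose {ι : Type*} [DecidableEq ι] {N : ℕ} {A : Matrix ι ι ℂ}
    (hA : IsMonomial N A) : IsMonomial N Aᴴ := by
  obtain ⟨s, c, hc, rfl⟩ := hA
  refine ⟨s⁻¹, fun l => star (c (s⁻¹ l)), fun l => by rw [← star_pow, hc, star_one], ?_⟩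
  ext k l
  by_cases h : l = s k
  · subst h; simp
  · have h' : k ≠ s⁻¹ l := fun e => h (by simp [e])
    simp only [Matrix.conjTranspose_apply, Matrix.of_apply, if_neg h, if_neg h', star_zero]

theorem IsMonomial.mem_unitaryGroup {ι : Type*} [DecidableEq ι] [Fintype ι] {N : ℕ} (hN : 0 < N)
    {A : Matrix ι ι ℂ} (hA : IsMonomial N A) : A ∈ Matrix.unitaryGroup ι ℂ := by
  obtain ⟨s, c, hc, rfl⟩ := hA
  rw [Matrix.mem_unitaryGroup_iff']
  ext k l
  have hn : ∀ l, star (c l) * c l = 1 := by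
    intro l
    have h1 : ‖c l‖ = 1 := Complex.norm_eq_one_of_pow_eq_one (hc l) hN.ne'
    have := Complex.normSq_eq_conj_mul_self (z := c l)
    rw [Complex.normSq_eq_norm_sq, h1] at this
    simpa using this.symm
  simp only [Matrix.mul_apply, Matrix.star_apply, Matrix.of_apply, Matrix.one_apply]
  by_cases h : k = l
  · subst h; simpa using hn k
  · simp [h, Ne.symm h]

theorem IsMonomial.tensor {p n N : ℕ} {M : Fin n → Op1 p} (h : ∀ i, IsMonomial N (M i)) :
    IsMonomial N (tensor M) := by
  choose s c hc hM using h
  refine ⟨Equiv.piCongrRight s, fun l => ∏ i, c i (l i), fun l => ?_, ?_⟩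
  · rw [← Finset.prod_pow]
    exact Finset.prod_eq_one fun i _ => hc i _
  · ext k l
    have hk : k = Equiv.piCongrRight s l ↔ ∀ i, k i = s i (l i) := by
      rw [funext_iff]; rfl
    simp only [QuditContextuality.tensor, Matrix.of_apply]
    by_cases h : ∀ i, k i = s i (l i)
    · rw [if_pos (hk.2 h)]
      refine Finset.prod_congr rfl fun i _ => ?_
      rw [hM i]; simp [h i]
    · rw [if_neg (fun e => h (hk.1 e))]
      push Not at h
      obtain ⟨i, hi⟩ := h
      refine Finset.prod_eq_zero (Finset.mem_univ i) ?_
      rw [hM i]; simp [hi]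

theorem omega_pow (p : ℕ) [NeZero p] : omega p ^ p = 1 :=
  (Complex.isPrimitiveRoot_exp p (NeZero.ne p)).pow_eq_one

theorem tau_pow (p : ℕ) [NeZero p] : tau p ^ (4 * p) = 1 := by
  unfold tau
  split_ifs with h
  · subst h
    rw [pow_mul, Complex.I_pow_four, one_pow]
  · rw [← pow_mul, mul_comm, mul_comm 4 p, mul_assoc, pow_mul, omega_pow, one_pow]

theorem isMonomial_displacement (p : ℕ) [NeZero p] (x z : ZMod p) :
    IsMonomial (4 * p) (displacement p x z) := by
  have hX : IsMonomial (4 * p) (shiftX p) :=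
    ⟨Equiv.addRight 1, fun _ => 1, fun _ => one_pow _, by ext k l; simp [shiftX]; rfl⟩
  have hZ : IsMonomial (4 * p) (clockZ p) := by
    refine ⟨1, fun j => omega p ^ j.val, fun j => ?_, ?_⟩
    · rw [← pow_mul, mul_comm, mul_comm 4 p, mul_assoc, pow_mul, omega_pow, one_pow]
    · ext k l
      by_cases h : k = l
      · subst h; simp [clockZ]
      · simp [clockZ, h]
  refine ((hX.pow _).mul (hZ.pow _)).smul ?_
  rw [← pow_mul, mul_comm, pow_mul, tau_pow, one_pow]

theorem isMonomial_weylGroup (p n : ℕ) [NeZero p] (g : Matrix.unitaryGroup (Fin n → ZMod p) ℂ)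
    (hg : g ∈ weylGroup p n) : IsMonomial (4 * p) (g : Op p n) := by
  unfold weylGroup at hg
  induction hg using Subgroup.closure_induction with
  | mem g h =>
    obtain ⟨x, z, h⟩ := h
    rw [h]
    exact IsMonomial.tensor fun i => isMonomial_displacement p _ _
  | one => exact IsMonomial.one _
  | mul a b _ _ ha hb => exact ha.mul hb
  | inv a _ ha => exact ha.conjTranspose

theorem finite_weylGroup (p n : ℕ) [NeZero p] : Finite (weylGroup p n) := by
  have hp : 0 < 4 * p := Nat.mul_pos (by norm_num) (Nat.pos_of_ne_zero (NeZero.ne p))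
  have := (finite_isMonomial (ι := Fin n → ZMod p) hp).to_subtype
  refine Finite.of_injective
    (fun g : weylGroup p n => (⟨(g : Matrix.unitaryGroup (Fin n → ZMod p) ℂ),
      isMonomial_weylGroup p n g g.2⟩ : {M : Op p n | IsMonomial (4 * p) M})) ?_
  intro g h e
  exact Subtype.ext (Subtype.ext (Subtype.mk.inj e))

theorem tensor_displacement_zero (p n : ℕ) [NeZero p] (z : Fin n → ZMod p) :
    (tensor fun i => displacement p 0 (z i)) =
      Matrix.diagonal fun l : Fin n → ZMod p => ∏ i, (omega p ^ (l i).val) ^ (z i).val := by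
  ext k l
  by_cases h : k = l
  · subst h
    simp [tensor, displacement, clockZ, Matrix.diagonal_pow]
  · rw [Matrix.diagonal_apply_ne _ h]
    obtain ⟨i, hi⟩ := Function.ne_iff.1 h
    refine Finset.prod_eq_zero (Finset.mem_univ i) ?_
    simp [displacement, clockZ, Matrix.diagonal_pow, Matrix.diagonal_apply_ne _ hi]

theorem finite_stabilizerProjectors (p n : ℕ) [Fact p.Prime] :
    (stabilizerProjectors p n).Finite := by
  have hp : 0 < 4 * p := Nat.mul_pos (by norm_num) (Nat.pos_of_ne_zero (NeZero.ne p))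
  have hp1 : Fact (1 < p) := ⟨(Fact.out : p.Prime).one_lt⟩
  have := finite_weylGroup p n
  set G := Matrix.unitaryGroup (Fin n → ZMod p) ℂ
  let z : Fin n → G := fun i =>
    ⟨tensor fun j => displacement p 0 ((Pi.single i 1 : Fin n → ZMod p) j),
      (IsMonomial.tensor fun j => isMonomial_displacement p _ _).mem_unitaryGroup hp⟩
  have hz : ∀ i, z i ∈ weylGroup p n := fun i =>
    Subgroup.subset_closure ⟨0, Pi.single i 1, rfl⟩
  have hcl : ∀ U : cliffordGroup p n, ∀ i, (U : G) * z i * (U : G)⁻¹ ∈ weylGroup p n :=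
    fun U i => (U.2 (z i)).1 (hz i)
  let F : cliffordGroup p n × (Fin n → ZMod p) → (Fin n → weylGroup p n) × (Fin n → ZMod p) :=
    fun q => (fun i => ⟨(q.1 : G) * z i * (q.1 : G)⁻¹, hcl q.1 i⟩, q.2)
  let f : cliffordGroup p n × (Fin n → ZMod p) → Op p n :=
    fun q => ((q.1 : G) : Op p n) * Matrix.single q.2 q.2 1 * ((q.1 : G) : Op p n)ᴴ
  -- a unitary commuting with all the clock operators is diagonal
  have key : Function.FactorsThrough f F := by
    rintro ⟨U, k⟩ ⟨V, k'⟩ e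
    obtain rfl : k = k' := congrArg Prod.snd e
    set W : G := (V : G)⁻¹ * (U : G) with hW
    have hcomm : ∀ i, W * z i = z i * W := by
      intro i
      have h1 : (U : G) * z i * (U : G)⁻¹ = (V : G) * z i * (V : G)⁻¹ :=
        congrArg (fun t => ((t.1 i : weylGroup p n) : G)) e
      have h2 : (U : G) * z i = (V : G) * z i * (V : G)⁻¹ * U := by
        rw [← h1]; group
      rw [hW, mul_assoc, h2]; group
    have hdiag : ∀ a b, a ≠ b → (W : Op p n) a b = 0 := by
      intro a b hab
      obtain ⟨i, hi⟩ := Function.ne_iff.1 hab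
      have h0 : (W : Op p n) * (z i : Op p n) = (z i : Op p n) * (W : Op p n) :=
        congrArg Subtype.val (hcomm i)
      have hzi : (z i : Op p n) =
          Matrix.diagonal fun l : Fin n → ZMod p => omega p ^ (l i).val := by
        change (tensor fun j => displacement p 0 ((Pi.single i 1 : Fin n → ZMod p) j)) = _
        rw [tensor_displacement_zero]
        congr 1
        ext l
        rw [Finset.prod_eq_single i]
        · simp [ZMod.val_one]
        · intro j _ hj; simp [hj]
        · simp
      rw [hzi] at h0
      have h1 := congrFun (congrFun h0 a) b
      rw [Matrix.mul_diagonal, Matrix.diagonal_mul] at h1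
      have hne : omega p ^ (b i).val ≠ omega p ^ (a i).val := by
        intro h
        have h3 := (Complex.isPrimitiveRoot_exp p (NeZero.ne p)).pow_inj
          (ZMod.val_lt _) (ZMod.val_lt _) h
        exact hi (ZMod.val_injective p h3).symm
      have h4 : (W : Op p n) a b * (omega p ^ (b i).val - omega p ^ (a i).val) = 0 := by
        rw [mul_sub, h1]; ring
      exact (mul_eq_zero.1 h4).resolve_right (sub_ne_zero.2 hne)
    have hWd : (W : Op p n) = Matrix.diagonal fun a => (W : Op p n) a a := by
      ext a b
      by_cases h : a = b
      · subst h; simp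
      · rw [Matrix.diagonal_apply_ne _ h, hdiag a b h]
    have hWs : (W : Op p n) * Matrix.single k k 1 * (W : Op p n)ᴴ = Matrix.single k k 1 := by
      have hu : (W : Op p n) * (W : Op p n)ᴴ = 1 := (Matrix.mem_unitaryGroup_iff).1 W.2
      have hc : (W : Op p n) * Matrix.single k k 1 = Matrix.single k k 1 * (W : Op p n) := by
        rw [hWd, ← Matrix.diagonal_single, Matrix.diagonal_mul_diagonal,
          Matrix.diagonal_mul_diagonal]
        congr 1
        ext a
        exact mul_comm _ _
      rw [hc, mul_assoc, hu, mul_one]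
    have hU : ((U : G) : Op p n) = ((V : G) : Op p n) * (W : Op p n) := by
      rw [← Matrix.UnitaryGroup.mul_val, hW]; simp
    change ((U : G) : Op p n) * Matrix.single k k 1 * ((U : G) : Op p n)ᴴ =
      ((V : G) : Op p n) * Matrix.single k k 1 * ((V : G) : Op p n)ᴴ
    rw [hU, Matrix.conjTranspose_mul]
    calc _ = ((V : G) : Op p n) * ((W : Op p n) * Matrix.single k k 1 * (W : Op p n)ᴴ) *
          ((V : G) : Op p n)ᴴ := by simp only [mul_assoc]
      _ = _ := by rw [hWs]
  have hf : f = Function.extend F f (fun _ => 0) ∘ F := by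
    funext q
    exact (key.extend_apply _ q).symm
  have hr : (Set.range f).Finite := by
    rw [hf]
    exact (Set.finite_range (Function.extend F f fun _ => 0)).subset
      (Set.range_comp_subset_range _ _)
  refine hr.subset ?_
  rintro P ⟨U, hU, k, rfl⟩
  exact ⟨(⟨U, hU⟩, k), rfl⟩

/-! ## The construction -/

/-- The projectors onto the entangled two-qudit stabilizer states. (A projector of rank one projects
onto a product state if and only if it is a tensor product of two operators.) -/
def entangledProjectors (p : ℕ) [NeZero p] : Set (Op p 2) :=
  {P ∈ stabilizerProjectors p 2 | ¬ ∃ M N : Op1 p, P = tensor ![M, N]}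

/-- The separable projectors `Π_j ^ s ⊗ |k⟩⟨k|` with `s ≠ r_j`. -/
def separableProjectors (p : ℕ) [NeZero p] (r : Option (ZMod p) → ZMod p) : Set (Op p 2) :=
  {P | ∃ (j : Option (ZMod p)) (s k : ZMod p), s ≠ r j ∧
    P = tensor ![mubProjector p j s, Matrix.single k k 1]}

theorem finite_separable_union_entangled (p : ℕ) [Fact p.Prime] (r : Option (ZMod p) → ZMod p) :
    (separableProjectors p r ∪ entangledProjectors p).Finite := by
  refine Set.Finite.union ?_ ((finite_stabilizerProjectors p 2).subset fun P h => h.1)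
  refine (Set.finite_range (fun q : Option (ZMod p) × ZMod p × ZMod p =>
    (tensor ![mubProjector p q.1 q.2.1, Matrix.single q.2.2 q.2.2 1] : Op p 2))).subset ?_
  rintro P ⟨j, s, k, _, rfl⟩
  exact ⟨(j, s, k), rfl⟩

/-- The set of two-qudit stabilizer projectors of the construction for the facet `A ^ r`. -/
def testSet (p : ℕ) [Fact p.Prime] (r : Option (ZMod p) → ZMod p) : Finset (Op p 2) :=
  (finite_separable_union_entangled p r).toFinset

/-- The witness operator `Σ ^ r`, the sum of these projectors. -/
def witness (p : ℕ) [Fact p.Prime] (r : Option (ZMod p) → ZMod p) : Op p 2 :=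
  ∑ P ∈ testSet p r, P

end QuditContextuality

end

open QuditContextuality

/-!
Multiplication of displacement operators `D_u` adds the phase space labels `u`, up to scalars, and
`D_u`, `D_v` commute up to the phase `ω ^ [u, v]` given by the symplectic form. A stabilizer
projector is the average of an abelian group of multiples of such operators
(`exists_char_of_mem_stabilizerProjectors`), and a joint eigenprojector of commuting displacement
operators whose labels extend to a symplectic basis is a stabilizer projector, as a Clifford unitary
carries the computational basis to the joint eigenbasis (`projOf_mem_stabilizerProjectors`). For two
qudits this makes the entangled stabilizer states explicit: their stabilizer groups consist of
multiples of the operators `D_u ⊗ D_{F u}`, where `F` is one of the `p ^ 3 - p` linear maps of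
`ℤ_p ^ 2` with determinant `-1` (`entangledProjectors_eq`, `card_entLabel`).

Hence the vertices of `Γ^r` form `p ^ 3 - p` bases of entangled states and `p + 1` bases
`Π_j ^ s ⊗ |k⟩⟨k|` from which the elements with `s = r_j` are removed. Adding them up gives
`Σ^r = (p ^ 3 - A^r) ⊗ 1` (`witness_eq`), so that `Tr [Σ^r (ρ ⊗ σ)] = p ^ 3 - Tr (A^r ρ)` and the
value `p ^ 3` is exceeded exactly if `ρ` is beyond the facet `r` of the polytope.

*Independence number.* These bases are a cover of `Γ^r` by `p ^ 3 + 1` cliques, so every parameter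
in question is at most `p ^ 3 + 1`. An independent set attaining this bound would choose an element
of each basis, no two of them orthogonal; then the phases chosen for the same operator in different
bases agree. For `p = 2` this contradicts Mermin's square (`not_forall_mul_ne_zero_two`). For odd `p`
it makes the phases of the operators on the first qudit linear in phase space
(`phase_linear_of_odd`); as `r` is linear too, the two agree in some component `j`, but the elements
with `s = r_j` are removed. Conversely, stabilizer states are not orthogonal if some linear
functional is constantly one on their stabilizer groups (`trace_projOf_mul_projOf_ne_zero`). This
gives an independent set of size `p ^ 3`: for odd `p` from the functional
`Tr (· (A^q ⊗ A^0))`, where `q` is a facet label that agrees with `r` in one component only, and for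
`p = 2` from explicit signs of the Pauli operators which are multiplicative on eight of the nine
bases.

*Maximal violation.* For odd `p`, `A^r` is a displaced parity operator
(`facetOperator_phaseVector_apply`). Thus `(A^r)² = 1`, and the value of `Σ^r` is at most
`p ^ 3 + 1`, attained by all `ρ ⊗ σ` with `A^r ρ = -ρ`. The probabilities in such a state are a
feasible point of the linear program for `α^*`, and the Gram matrix of the operators `P τ ^ (1/2)` is
one of the semidefinite program for `ϑ`; the clique cover bounds both from above.

*Noncontextual model.* For odd `p`, `W ↦ Tr (W A_λ)` is a character of every stabilizer group, since
the phases `ω ^ ([u, v] / 2)` in `D_u D_v = ω ^ ([u, v] / 2) D_{u + v}` vanish for commuting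
operators. Its average `Tr (P A_λ)` is therefore `0` or `1`, and two projectors for which it is `1`
are not orthogonal. As the operators `A_λ` are an orthogonal basis, a nonnegative `W_τ` is a
noncontextual model (`isNCHVModel_wigner`). The Wigner function is multiplicative, and
`p W_ρ` has the values `Tr (ρ A^r)` at the facets `r`. So a state of the polytope, with any mixture of
stabilizer states as ancilla, satisfies all noncontextuality inequalities, while a state outside it
violates one of those above with the ancilla `|0⟩⟨0|` (`exhibitsContextuality_iff`).
-/

noncomputable section

namespace QuditContextuality

/-! ### The additive character of `ℤ_p` -/

section Character

variable {p : ℕ} [NeZero p]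

/-- The additive character `k ↦ ω ^ k` of `ℤ_p`. -/
abbrev chi (p : ℕ) [NeZero p] : AddChar (ZMod p) ℂ := ZMod.stdAddChar

theorem omega_pow_eq_chi (m : ℕ) : omega p ^ m = chi p (m : ZMod p) := by
  have h := ZMod.stdAddChar_coe (N := p) (m : ℤ)
  rw [Int.cast_natCast] at h
  rw [h, omega, ← Complex.exp_nat_mul]
  congr 1
  push_cast
  ring

theorem omega_pow_val (a : ZMod p) : omega p ^ a.val = chi p a := by
  rw [omega_pow_eq_chi, ZMod.natCast_zmod_val]

theorem chi_ne_zero (a : ZMod p) : chi p a ≠ 0 := ((chi p).val_isUnit a).ne_zero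

theorem chi_eq_one_iff (a : ZMod p) : chi p a = 1 ↔ a = 0 := by
  rw [← AddChar.map_zero_eq_one (chi p)]
  exact ZMod.injective_stdAddChar.eq_iff

theorem star_chi (a : ZMod p) : star (chi p a) = chi p (-a) :=
  (AddChar.map_neg_eq_conj (chi p) a).symm

theorem chi_pow (a : ZMod p) (m : ℕ) : chi p a ^ m = chi p (m * a) := by
  rw [← AddChar.map_nsmul_eq_pow, nsmul_eq_mul]

theorem chi_pow_val (a b : ZMod p) : chi p a ^ b.val = chi p (b * a) := by
  rw [chi_pow, ZMod.natCast_zmod_val]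

theorem chi_pow_p (a : ZMod p) : chi p a ^ p = 1 := by
  rw [chi_pow, CharP.cast_eq_zero, zero_mul, AddChar.map_zero_eq_one]

theorem exists_chi_of_pow_eq_one {c : ℂ} (hc : c ^ p = 1) : ∃ a : ZMod p, c = chi p a := by
  obtain ⟨i, _, rfl⟩ := (Complex.isPrimitiveRoot_exp p (NeZero.ne p)).eq_pow_of_pow_eq_one hc
  exact ⟨i, omega_pow_eq_chi i⟩

theorem sum_chi_mul (a : ZMod p) : ∑ b, chi p (a * b) = if a = 0 then (p : ℂ) else 0 := by
  have h := AddChar.sum_mulShift a (ZMod.isPrimitive_stdAddChar p)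
  simp_rw [mul_comm a]
  rw [h, ZMod.card]
  split_ifs <;> simp

theorem chi_sum {ι : Type*} (s : Finset ι) (f : ι → ZMod p) :
    chi p (∑ i ∈ s, f i) = ∏ i ∈ s, chi p (f i) := by
  classical
  induction s using Finset.induction_on with
  | empty => simp
  | insert i s hi ih =>
    rw [Finset.sum_insert hi, Finset.prod_insert hi, AddChar.map_add_eq_mul, ih]

theorem chi_dotProduct {n : ℕ} (x y : Fin n → ZMod p) :
    chi p (x ⬝ᵥ y) = ∏ i, chi p (x i * y i) := chi_sum _ _

theorem sum_chi_dotProduct {n : ℕ} (x : Fin n → ZMod p) :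
    ∑ y : Fin n → ZMod p, chi p (x ⬝ᵥ y) = if x = 0 then (p : ℂ) ^ n else 0 := by
  simp_rw [chi_dotProduct]
  rw [← Fintype.piFinset_univ, ← Finset.prod_univ_sum (fun _ => Finset.univ)
    (fun i b => chi p (x i * b))]
  simp_rw [sum_chi_mul]
  split_ifs with h
  · simp [h]
  · obtain ⟨i, hi⟩ := Function.ne_iff.1 h
    exact Finset.prod_eq_zero (Finset.mem_univ i) (if_neg hi)

end Character

/-! ### Tensor products -/

section Tensor

variable {p n : ℕ}

theorem tensor_mul [NeZero p] (M N : Fin n → Op1 p) :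
    tensor M * tensor N = tensor fun i => M i * N i := by
  ext k l
  simp only [tensor, Matrix.mul_apply, Matrix.of_apply]
  rw [← Fintype.piFinset_univ, Finset.prod_univ_sum, Fintype.piFinset_univ]
  exact Finset.sum_congr rfl fun x _ => Finset.prod_mul_distrib.symm

theorem tensor_one [NeZero p] : tensor (fun _ : Fin n => (1 : Op1 p)) = 1 := by
  ext k l
  simp only [tensor, Matrix.of_apply, Matrix.one_apply, Finset.prod_ite_zero, funext_iff]
  simp

theorem tensor_smul (c : Fin n → ℂ) (M : Fin n → Op1 p) :
    (tensor fun i => c i • M i) = (∏ i, c i) • tensor M := by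
  ext k l
  simp [tensor, Finset.prod_mul_distrib]

theorem tensor_conjTranspose (M : Fin n → Op1 p) :
    (tensor M)ᴴ = tensor fun i => (M i)ᴴ := by
  ext k l
  simp [tensor]

theorem trace_tensor [NeZero p] (M : Fin n → Op1 p) :
    (tensor M).trace = ∏ i, (M i).trace := by
  simp only [Matrix.trace, Matrix.diag_apply, tensor, Matrix.of_apply]
  rw [Finset.prod_univ_sum, Fintype.piFinset_univ]

theorem tensor_sum [NeZero p] {G : Type*} [Fintype G] [DecidableEq G] (M : Fin n → G → Op1 p) :
    (tensor fun i => ∑ g, M i g) = ∑ g : Fin n → G, tensor fun i => M i (g i) := by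
  ext k l
  simp only [tensor, Matrix.of_apply, Matrix.sum_apply]
  rw [Finset.prod_univ_sum, Fintype.piFinset_univ]

theorem tensor_succ (M : Fin (n + 1) → Op1 p) :
    tensor M = adjoinAncilla (M 0) (tensor (Fin.tail M)) := by
  ext k l
  simp [tensor, adjoinAncilla, Fin.prod_univ_succ, Fin.tail]

theorem adjoinAncilla_mul [NeZero p] (A B : Op1 p) (C D : Op p n) :
    adjoinAncilla A C * adjoinAncilla B D = adjoinAncilla (A * B) (C * D) := by
  ext k l
  simp only [adjoinAncilla, Matrix.mul_apply, Matrix.of_apply]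
  rw [← (Fin.consEquiv fun _ : Fin (n + 1) => ZMod p).sum_comp, Fintype.sum_prod_type,
    Finset.sum_mul_sum]
  refine Finset.sum_congr rfl fun a _ => Finset.sum_congr rfl fun b _ => ?_
  change A (k 0) a * C (Fin.tail k) b * (B a (l 0) * D b (Fin.tail l)) = _
  ring

theorem trace_adjoinAncilla [NeZero p] (A : Op1 p) (C : Op p n) :
    (adjoinAncilla A C).trace = A.trace * C.trace := by
  simp only [adjoinAncilla, Matrix.trace, Matrix.diag_apply, Matrix.of_apply]
  rw [← (Fin.consEquiv fun _ : Fin (n + 1) => ZMod p).sum_comp, Fintype.sum_prod_type,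
    Finset.sum_mul_sum]
  rfl

theorem adjoinAncilla_eq_submatrix (A : Op1 p) (C : Op p n) :
    adjoinAncilla A C = (Matrix.kronecker A C).submatrix (fun k => (k 0, Fin.tail k))
      (fun k => (k 0, Fin.tail k)) := rfl

theorem IsState.adjoinAncilla [NeZero p] {ρ : Op1 p} {σ : Op p n} (hρ : IsState ρ)
    (hσ : IsState σ) : IsState (adjoinAncilla ρ σ) := by
  refine ⟨?_, by rw [trace_adjoinAncilla, hρ.2, hσ.2, one_mul]⟩
  rw [adjoinAncilla_eq_submatrix]
  exact (hρ.1.kronecker hσ.1).submatrix _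

end Tensor

/-- The tensor product of two one-qudit operators. -/
abbrev tensorPair {p : ℕ} (M N : Op1 p) : Op p 2 := tensor ![M, N]

section TensorPair

variable {p : ℕ}

theorem tensorPair_apply (M N : Op1 p) (k l : Fin 2 → ZMod p) :
    tensorPair M N k l = M (k 0) (l 0) * N (k 1) (l 1) := by
  simp [tensorPair, tensor, Fin.prod_univ_two]

theorem tensorPair_mul [NeZero p] (M N M' N' : Op1 p) :
    tensorPair M N * tensorPair M' N' = tensorPair (M * M') (N * N') := by
  rw [tensorPair, tensorPair, tensor_mul]
  congr 1
  ext i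
  fin_cases i <;> rfl

theorem tensorPair_one [NeZero p] : tensorPair (1 : Op1 p) 1 = 1 := by
  rw [← tensor_one, tensorPair]
  congr 1
  ext i
  fin_cases i <;> rfl

theorem tensorPair_pow [NeZero p] (M N : Op1 p) (m : ℕ) :
    tensorPair M N ^ m = tensorPair (M ^ m) (N ^ m) := by
  induction m with
  | zero => simp only [pow_zero]; exact tensorPair_one.symm
  | succ m ih => rw [pow_succ, ih, tensorPair_mul, pow_succ, pow_succ]

theorem tensorPair_smul_left (c : ℂ) (M N : Op1 p) :
    tensorPair (c • M) N = c • tensorPair M N := by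
  ext k l
  simp [tensorPair_apply, mul_assoc]

theorem tensorPair_smul_right (c : ℂ) (M N : Op1 p) :
    tensorPair M (c • N) = c • tensorPair M N := by
  ext k l
  simp [tensorPair_apply, mul_left_comm]

theorem tensorPair_add_left (M M' N : Op1 p) :
    tensorPair (M + M') N = tensorPair M N + tensorPair M' N := by
  ext k l
  simp [tensorPair_apply, add_mul]

theorem tensorPair_sub_left (M M' N : Op1 p) :
    tensorPair (M - M') N = tensorPair M N - tensorPair M' N := by
  ext k l
  simp [tensorPair_apply, sub_mul]

theorem tensorPair_sum_left {ι : Type*} (s : Finset ι) (M : ι → Op1 p) (N : Op1 p) :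
    tensorPair (∑ i ∈ s, M i) N = ∑ i ∈ s, tensorPair (M i) N := by
  ext k l
  simp [tensorPair_apply, Matrix.sum_apply, Finset.sum_mul]

theorem tensorPair_sum_right {ι : Type*} (s : Finset ι) (M : Op1 p) (N : ι → Op1 p) :
    tensorPair M (∑ i ∈ s, N i) = ∑ i ∈ s, tensorPair M (N i) := by
  ext k l
  simp [tensorPair_apply, Matrix.sum_apply, Finset.mul_sum]

theorem tensorPair_conjTranspose (M N : Op1 p) : (tensorPair M N)ᴴ = tensorPair Mᴴ Nᴴ := by
  ext k l
  simp [tensorPair_apply]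

theorem trace_tensorPair [NeZero p] (M N : Op1 p) :
    (tensorPair M N).trace = M.trace * N.trace := by
  rw [tensorPair, trace_tensor, Fin.prod_univ_two]
  rfl

end TensorPair

/-! ### Weyl operators -/

section Weyl

variable {p : ℕ} [NeZero p]

/-- The operator `X ^ x Z ^ z` on one qudit. -/
def weyl1 (x z : ZMod p) : Op1 p :=
  Matrix.of fun k l => if k = l + x then chi p (z * l) else 0

/-- The operator `X ^ x Z ^ z = ⨂ i, X ^ (x i) Z ^ (z i)` on `n` qudits. -/
def weyl {n : ℕ} (x z : Fin n → ZMod p) : Op p n :=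
  Matrix.of fun k l => if k = l + x then chi p (z ⬝ᵥ l) else 0

theorem shiftX_pow (m : ℕ) : shiftX p ^ m = weyl1 (m : ZMod p) 0 := by
  induction m with
  | zero =>
    ext k l
    simp [weyl1, Matrix.one_apply]
  | succ m ih =>
    rw [pow_succ, ih]
    ext k l
    simp [weyl1, shiftX, Matrix.mul_apply, add_comm, add_left_comm]

theorem clockZ_pow (m : ℕ) : clockZ p ^ m = weyl1 0 (m : ZMod p) := by
  rw [clockZ, Matrix.diagonal_pow]
  ext k l
  by_cases h : k = l
  · subst h
    simp [weyl1, omega_pow_val, chi_pow]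
  · simp [weyl1, h]

theorem weyl1_mul (x z x' z' : ZMod p) :
    weyl1 x z * weyl1 x' z' = chi p (z * x') • weyl1 (x + x') (z + z') := by
  ext k l
  simp only [weyl1, Matrix.mul_apply, Matrix.of_apply, Matrix.smul_apply, smul_eq_mul, mul_ite,
    mul_zero, Finset.sum_ite_eq', Finset.mem_univ, if_true, ite_mul, zero_mul]
  have : (k = l + x' + x) ↔ (k = l + (x + x')) := by
    rw [add_assoc, add_comm x']
  simp only [this]
  split_ifs with h
  · rw [← AddChar.map_add_eq_mul, ← AddChar.map_add_eq_mul]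
    congr 1
    ring
  · rfl

theorem weyl1_zero : weyl1 (0 : ZMod p) 0 = 1 := by
  ext k l
  simp [weyl1, Matrix.one_apply]

theorem displacement_eq (x z : ZMod p) :
    displacement p x z = tau p ^ (x.val * z.val) • weyl1 x z := by
  rw [displacement, shiftX_pow, clockZ_pow, weyl1_mul]
  simp

theorem weyl_mul {n : ℕ} (x z x' z' : Fin n → ZMod p) :
    weyl x z * weyl x' z' = chi p (z ⬝ᵥ x') • weyl (x + x') (z + z') := by
  ext k l
  simp only [weyl, Matrix.mul_apply, Matrix.of_apply, Matrix.smul_apply, smul_eq_mul, mul_ite,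
    mul_zero, Finset.sum_ite_eq', Finset.mem_univ, if_true, ite_mul, zero_mul]
  have : (k = l + x' + x) ↔ (k = l + (x + x')) := by
    rw [add_assoc, add_comm x']
  simp only [this]
  split_ifs with h
  · rw [← AddChar.map_add_eq_mul, ← AddChar.map_add_eq_mul]
    congr 1
    rw [dotProduct_add, add_dotProduct]
    ring
  · rfl

theorem weyl_zero {n : ℕ} : weyl (0 : Fin n → ZMod p) 0 = 1 := by
  ext k l
  simp [weyl, Matrix.one_apply]

theorem tensor_weyl1 {n : ℕ} (x z : Fin n → ZMod p) :
    (tensor fun i => weyl1 (x i) (z i)) = weyl x z := by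
  ext k l
  simp only [tensor, weyl1, weyl, Matrix.of_apply, Finset.prod_ite_zero, chi_dotProduct,
    funext_iff, Finset.mem_univ, true_implies, Pi.add_apply]

theorem trace_weyl {n : ℕ} (x z : Fin n → ZMod p) :
    (weyl x z).trace = if x = 0 ∧ z = 0 then (p : ℂ) ^ n else 0 := by
  simp only [Matrix.trace, Matrix.diag_apply, weyl, Matrix.of_apply]
  by_cases hx : x = 0
  · subst hx
    simpa using sum_chi_dotProduct z
  · simp [hx]

theorem weyl_eq_smul_weyl_iff {n : ℕ} {x z x' z' : Fin n → ZMod p} {c : ℂ}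
    (h : weyl x z = c • weyl x' z') : x = x' ∧ z = z' := by
  have hm : weyl x z * weyl (-x) (-z) = chi p (z ⬝ᵥ (-x)) • 1 := by
    rw [weyl_mul, add_neg_cancel, add_neg_cancel, weyl_zero]
  rw [h, smul_mul_assoc, weyl_mul] at hm
  have ht := congrArg Matrix.trace hm
  rw [Matrix.trace_smul, Matrix.trace_smul, Matrix.trace_smul, trace_weyl, Matrix.trace_one] at ht
  by_contra hne
  rw [if_neg] at ht
  · rw [smul_zero, smul_zero, smul_eq_mul] at ht
    exact mul_ne_zero (chi_ne_zero _) (Nat.cast_ne_zero.2 Fintype.card_ne_zero) ht.symm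
  · rintro ⟨h1, h2⟩
    refine hne ⟨?_, ?_⟩
    · rw [← sub_eq_add_neg, sub_eq_zero] at h1; exact h1.symm
    · rw [← sub_eq_add_neg, sub_eq_zero] at h2; exact h2.symm

/-- Nonzero multiples of Weyl operators. -/
def IsWeyl {n : ℕ} (M : Op p n) : Prop :=
  ∃ c : ℂ, c ≠ 0 ∧ ∃ x z : Fin n → ZMod p, M = c • weyl x z

theorem IsWeyl.mul {n : ℕ} {M N : Op p n} (hM : IsWeyl M) (hN : IsWeyl N) : IsWeyl (M * N) := by
  obtain ⟨c, hc, x, z, rfl⟩ := hM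
  obtain ⟨d, hd, x', z', rfl⟩ := hN
  refine ⟨c * (d * chi p (z ⬝ᵥ x')), mul_ne_zero hc (mul_ne_zero hd (chi_ne_zero _)),
    x + x', z + z', ?_⟩
  rw [smul_mul_smul_comm, weyl_mul, smul_smul]
  ring_nf

theorem IsWeyl.one {n : ℕ} : IsWeyl (1 : Op p n) :=
  ⟨1, one_ne_zero, 0, 0, by rw [weyl_zero, one_smul]⟩

theorem IsWeyl.smul {n : ℕ} {M : Op p n} (hM : IsWeyl M) {a : ℂ} (ha : a ≠ 0) :
    IsWeyl (a • M) := by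
  obtain ⟨c, hc, x, z, rfl⟩ := hM
  exact ⟨a * c, mul_ne_zero ha hc, x, z, by rw [smul_smul]⟩

theorem IsWeyl.pow {n : ℕ} {M : Op p n} (hM : IsWeyl M) (m : ℕ) : IsWeyl (M ^ m) := by
  induction m with
  | zero => rw [pow_zero]; exact IsWeyl.one
  | succ m ih => rw [pow_succ]; exact ih.mul hM

theorem IsWeyl.scalar_or_trace_eq_zero {n : ℕ} {M : Op p n} (hM : IsWeyl M) :
    (∃ c : ℂ, M = c • 1) ∨ M.trace = 0 := by
  obtain ⟨c, hc, x, z, rfl⟩ := hM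
  by_cases h : x = 0 ∧ z = 0
  · left
    exact ⟨c, by rw [h.1, h.2, weyl_zero]⟩
  · right
    rw [Matrix.trace_smul, trace_weyl, if_neg h, smul_zero]

theorem tau_ne_zero : tau p ≠ 0 := by
  intro h
  have := tau_pow p
  rw [h, zero_pow (by have := NeZero.ne p; omega)] at this
  exact zero_ne_one this

theorem isWeyl_tensor_displacement {n : ℕ} (x z : Fin n → ZMod p) :
    IsWeyl (tensor fun i => displacement p (x i) (z i)) := by
  simp_rw [displacement_eq]
  rw [tensor_smul, tensor_weyl1]
  exact ⟨_, Finset.prod_ne_zero_iff.2 fun i _ => pow_ne_zero _ tau_ne_zero, x, z, rfl⟩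

theorem isWeyl_of_mem_weylGroup {n : ℕ} {g : Matrix.unitaryGroup (Fin n → ZMod p) ℂ}
    (hg : g ∈ weylGroup p n) : IsWeyl (g : Op p n) := by
  unfold weylGroup at hg
  induction hg using Subgroup.closure_induction with
  | mem g h =>
    obtain ⟨x, z, h⟩ := h
    rw [h]
    exact isWeyl_tensor_displacement x z
  | one => exact IsWeyl.one
  | mul a b _ _ ha hb => exact ha.mul hb
  | inv a _ ha =>
    obtain ⟨c, hc, x, z, h⟩ := ha
    refine ⟨c⁻¹ * chi p (z ⬝ᵥ x), mul_ne_zero (inv_ne_zero hc) (chi_ne_zero _), -x, -z, ?_⟩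
    have h1 : (a : Op p n) * ((c⁻¹ * chi p (z ⬝ᵥ x)) • weyl (-x) (-z)) = 1 := by
      rw [h, smul_mul_smul_comm, weyl_mul, add_neg_cancel, add_neg_cancel, weyl_zero, smul_smul,
        dotProduct_neg, AddChar.map_neg_eq_inv]
      have := chi_ne_zero (z ⬝ᵥ x)
      field_simp
      simp
    have h2 : ((a⁻¹ : Matrix.unitaryGroup (Fin n → ZMod p) ℂ) : Op p n) * (a : Op p n) = 1 := by
      rw [← Matrix.UnitaryGroup.mul_val, inv_mul_cancel]; rfl
    calc ((a⁻¹ : Matrix.unitaryGroup (Fin n → ZMod p) ℂ) : Op p n)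
        = _ * ((a : Op p n) * ((c⁻¹ * chi p (z ⬝ᵥ x)) • weyl (-x) (-z))) := by rw [h1, mul_one]
      _ = _ := by rw [← mul_assoc, h2, one_mul]

end Weyl

/-! ### Displacement operators on one qudit -/

section Displacement

variable {p : ℕ}

/-- The displacement operator labelled by a point of the phase space `ℤ_p × ℤ_p`. -/
abbrev disp [NeZero p] (u : ZMod p × ZMod p) : Op1 p := displacement p u.1 u.2

/-- The symplectic form for which `D_u D_v = ω ^ [u, v] D_v D_u`. -/
def symp (u v : ZMod p × ZMod p) : ZMod p := u.2 * v.1 - v.2 * u.1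

theorem disp_mul_comm [NeZero p] (u v : ZMod p × ZMod p) :
    disp u * disp v = chi p (symp u v) • (disp v * disp u) := by
  simp only [disp, displacement_eq, smul_mul_smul_comm, weyl1_mul, smul_smul]
  rw [add_comm v.1, add_comm v.2]
  congr 1
  rw [symp, AddChar.map_sub_eq_div]
  have := chi_ne_zero (v.2 * u.1)
  field_simp

theorem disp_zero [NeZero p] : disp (0 : ZMod p × ZMod p) = 1 := by
  simp [disp, displacement_eq, weyl1_zero]

theorem conjTranspose_disp_mul [NeZero p] (u : ZMod p × ZMod p) : (disp u)ᴴ * disp u = 1 := by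
  have hp : 0 < 4 * p := Nat.mul_pos (by norm_num) (Nat.pos_of_ne_zero (NeZero.ne p))
  exact Matrix.mem_unitaryGroup_iff'.1
    ((isMonomial_displacement p u.1 u.2).mem_unitaryGroup hp)

theorem weyl1_pow [NeZero p] (x z : ZMod p) (m : ℕ) :
    weyl1 x z ^ m =
      chi p (z * x * (m.choose 2 : ℕ)) • weyl1 ((m : ZMod p) * x) ((m : ZMod p) * z) := by
  induction m with
  | zero => simp [weyl1_zero]
  | succ m ih =>
    rw [pow_succ, ih, smul_mul_assoc, weyl1_mul, smul_smul, ← AddChar.map_add_eq_mul,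
      Nat.choose_succ_succ' m 1, Nat.choose_one_right]
    push_cast
    congr 2 <;> ring

theorem zmod_two_cases : ∀ y : ZMod 2, y = 0 ∨ y = 1 := by decide

theorem tau_two : tau 2 = Complex.I := if_pos rfl

theorem omega_two : omega 2 = -1 := by
  have h : (2 * Real.pi * Complex.I / ((2 : ℕ) : ℂ)) = Real.pi * Complex.I := by
    push_cast; ring
  rw [omega, h, Complex.exp_pi_mul_I]

theorem tau_of_odd [NeZero p] (hp : p ≠ 2) : tau p = chi p (2⁻¹) := by
  rw [tau, if_neg hp, omega_pow_val]

theorem disp_eq_of_odd [NeZero p] (hp : p ≠ 2) (u : ZMod p × ZMod p) :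
    disp u = chi p (2⁻¹ * (u.1 * u.2)) • weyl1 u.1 u.2 := by
  rw [disp, displacement_eq, tau_of_odd hp, chi_pow]
  congr 2
  push_cast
  rw [ZMod.natCast_zmod_val, ZMod.natCast_zmod_val, mul_comm]

theorem two_ne_zero_zmod [hp : Fact p.Prime] (h : p ≠ 2) : (2 : ZMod p) ≠ 0 := by
  intro h0
  have h1 : ((2 : ℕ) : ZMod p) = 0 := by exact_mod_cast h0
  rw [ZMod.natCast_eq_zero_iff] at h1
  exact h ((Nat.prime_dvd_prime_iff_eq hp.out Nat.prime_two).1 h1)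

theorem disp_mul_of_odd [Fact p.Prime] (hp : p ≠ 2) (u v : ZMod p × ZMod p) :
    disp u * disp v = chi p (2⁻¹ * symp u v) • disp (u + v) := by
  rw [disp_eq_of_odd hp, disp_eq_of_odd hp, disp_eq_of_odd hp, smul_mul_smul_comm, weyl1_mul,
    smul_smul, smul_smul, ← AddChar.map_add_eq_mul, ← AddChar.map_add_eq_mul,
    ← AddChar.map_add_eq_mul]
  congr 2
  have := two_ne_zero_zmod hp
  simp only [symp, Prod.fst_add, Prod.snd_add]
  field_simp
  ring

theorem disp_pow_of_odd [Fact p.Prime] (hp : p ≠ 2) (u : ZMod p × ZMod p) (m : ℕ) :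
    disp u ^ m = disp ((m : ZMod p) • u) := by
  induction m with
  | zero => simp [displacement_eq, weyl1_zero]
  | succ m ih =>
    rw [pow_succ, ih, disp_mul_of_odd hp]
    have h1 : symp ((m : ZMod p) • u) u = 0 := by simp [symp]; ring
    rw [h1, mul_zero, AddChar.map_zero_eq_one, one_smul]
    congr 1
    push_cast
    rw [add_smul, one_smul]

theorem disp_pow_p [hp : Fact p.Prime] (u : ZMod p × ZMod p) : disp u ^ p = 1 := by
  by_cases h : p = 2
  · subst h
    obtain ⟨x, z⟩ := u
    simp only [disp, displacement_eq, tau_two, smul_pow, weyl1_pow]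
    rw [CharTwo.two_eq_zero (R := ZMod 2) |> fun h => (by exact_mod_cast h : ((2 : ℕ) : ZMod 2) = 0)]
    rw [zero_mul, zero_mul, weyl1_zero, smul_smul, ← omega_pow_val]
    rw [omega_two]
    have h0 : (0 : ZMod 2).val = 0 := rfl
    have h1 : (1 : ZMod 2).val = 1 := rfl
    rcases zmod_two_cases x with rfl | rfl <;> rcases zmod_two_cases z with rfl | rfl <;>
      simp [h0, h1]
  · rw [disp_pow_of_odd h]
    simp [displacement_eq, weyl1_zero]

end Displacement

/-! ### Projectors onto the invariants of finite abelian operator groups -/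

section ProjOf

variable {ι G H : Type*} [Fintype ι] [DecidableEq ι] [AddCommGroup G] [Fintype G]
  [AddCommGroup H] [Fintype H]

/-- The average of the operators of a representation `W` of a finite abelian group, that is, the
projector onto the vectors fixed by it. -/
def projOf (W : AddChar G (Matrix ι ι ℂ)) : Matrix ι ι ℂ :=
  (Fintype.card G : ℂ)⁻¹ • ∑ g, W g

theorem apply_mul_projOf (W : AddChar G (Matrix ι ι ℂ)) (g : G) : W g * projOf W = projOf W := by
  rw [projOf, mul_smul_comm, Finset.mul_sum]
  simp_rw [← AddChar.map_add_eq_mul]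
  rw [← Equiv.sum_comp (Equiv.addLeft g) (fun h => W h)]
  rfl

theorem projOf_mul_apply (W : AddChar G (Matrix ι ι ℂ)) (g : G) : projOf W * W g = projOf W := by
  rw [projOf, smul_mul_assoc, Finset.sum_mul]
  simp_rw [← AddChar.map_add_eq_mul]
  rw [← Equiv.sum_comp (Equiv.addRight g) (fun h => W h)]
  rfl

theorem projOf_mul_projOf_eq_zero (W : AddChar G (Matrix ι ι ℂ)) (V : AddChar H (Matrix ι ι ℂ))
    {g : G} {h : H} {c : ℂ} (hc : c ≠ 1) (hgh : W g = c • V h) : projOf W * projOf V = 0 := by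
  have h1 : projOf W * projOf V = c • (projOf W * projOf V) := by
    conv_lhs => rw [← projOf_mul_apply W g, hgh, mul_assoc, smul_mul_assoc, apply_mul_projOf,
      mul_smul_comm]
  have h2 : (1 - c) • (projOf W * projOf V) = 0 := by
    rw [sub_smul, one_smul, ← h1, sub_self]
  exact (smul_eq_zero.1 h2).resolve_left (sub_ne_zero.2 hc.symm)

theorem trace_projOf (W : AddChar G (Matrix ι ι ℂ)) (hW : ∀ g, g ≠ 0 → (W g).trace = 0) :
    (projOf W).trace = (Fintype.card G : ℂ)⁻¹ * Fintype.card ι := by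
  rw [projOf, Matrix.trace_smul, Matrix.trace_sum, Finset.sum_eq_single 0]
  · rw [AddChar.map_zero_eq_one, Matrix.trace_one, smul_eq_mul]
  · intro g _ hg
    exact hW g hg
  · intro h
    exact absurd (Finset.mem_univ _) h

theorem projOf_congr (W : AddChar G (Matrix ι ι ℂ)) (V : AddChar H (Matrix ι ι ℂ)) (e : H ≃ G)
    (h : ∀ g, V g = W (e g)) : projOf W = projOf V := by
  rw [projOf, projOf, Fintype.card_congr e, ← e.sum_comp]
  simp_rw [h]

/-- Two groups of Weyl operators such that some linear functional `Tr (· B)` takes the value one on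
all their elements have nonorthogonal projectors: whenever elements of the two groups are
proportional, they are equal, so that all the contributions to the overlap are nonnegative. -/
theorem trace_projOf_mul_projOf_ne_zero {p n : ℕ} [NeZero p] (W : AddChar G (Op p n))
    (V : AddChar H (Op p n)) (hW : ∀ g, IsWeyl (W g)) (hV : ∀ h, IsWeyl (V h)) (B : Op p n)
    (hWB : ∀ g, (W g * B).trace = 1) (hVB : ∀ h, (V h * B).trace = 1) :
    (projOf W * projOf V).trace ≠ 0 := by
  have key : ∀ g h, 0 ≤ (W g * V h).trace.re := by
    intro g h
    rcases ((hW g).mul (hV h)).scalar_or_trace_eq_zero with ⟨c, hc⟩ | h0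
    · have h1 : W g = c • V (-h) := by
        have : W g * V h * V (-h) = W g := by
          rw [mul_assoc, ← AddChar.map_add_eq_mul, add_neg_cancel, AddChar.map_zero_eq_one, mul_one]
        rw [← this, hc, smul_mul_assoc, one_mul]
      have h2 : c = 1 := by
        have := hWB g
        rw [h1, smul_mul_assoc, Matrix.trace_smul, hVB, smul_eq_mul, mul_one] at this
        exact this
      rw [hc, h2, one_smul, Matrix.trace_one, Complex.natCast_re]
      positivity
    · rw [h0]; simp
  have hpos : 0 < (∑ g, ∑ h, W g * V h).trace.re := by
    rw [Matrix.trace_sum, Complex.re_sum]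
    simp_rw [Matrix.trace_sum, Complex.re_sum]
    have h0 : 0 < (W 0 * V 0).trace.re := by
      rw [AddChar.map_zero_eq_one, AddChar.map_zero_eq_one, mul_one, Matrix.trace_one,
        Complex.natCast_re]
      exact Nat.cast_pos.2 Fintype.card_pos
    refine h0.trans_le ?_
    refine le_trans ?_ (Finset.single_le_sum (fun g _ => Finset.sum_nonneg fun h _ => key g h)
      (Finset.mem_univ (0 : G)))
    exact Finset.single_le_sum (f := fun h => (W 0 * V h).trace.re) (fun h _ => key 0 h)
      (Finset.mem_univ (0 : H))
  intro h
  rw [projOf, projOf, smul_mul_smul_comm, Matrix.trace_smul, Finset.sum_mul_sum] at h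
  rcases smul_eq_zero.1 h with h1 | h1
  · simp at h1
  · rw [h1] at hpos
    simp at hpos

end ProjOf

/-! ### Representations of `ℤ_p` and `ℤ_p ^ 2` -/

section PairChar

variable {p : ℕ} [NeZero p] {M : Type*} [Monoid M]

/-- The representation `a ↦ A ^ a` of `ℤ_p`. -/
def powChar (A : M) (hA : A ^ p = 1) : AddChar (ZMod p) M where
  toFun a := A ^ a.val
  map_zero_eq_one' := by rw [ZMod.val_zero, pow_zero]
  map_add_eq_mul' a b := by rw [ZMod.val_add, ← pow_add, ← pow_eq_pow_mod _ hA]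

/-- The representation `(a, b) ↦ A ^ a B ^ b` of `ℤ_p ^ 2`. -/
def pairChar (A B : M) (hA : A ^ p = 1) (hB : B ^ p = 1) (hAB : Commute A B) :
    AddChar (Fin 2 → ZMod p) M where
  toFun g := A ^ (g 0).val * B ^ (g 1).val
  map_zero_eq_one' := by simp
  map_add_eq_mul' g h := by
    have hA' := (powChar A hA).map_add_eq_mul (g 0) (h 0)
    have hB' := (powChar B hB).map_add_eq_mul (g 1) (h 1)
    change A ^ (g 0 + h 0).val = A ^ (g 0).val * A ^ (h 0).val at hA'
    change B ^ (g 1 + h 1).val = B ^ (g 1).val * B ^ (h 1).val at hB'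
    rw [Pi.add_apply, Pi.add_apply, hA', hB', mul_assoc, mul_assoc, ← mul_assoc (A ^ (h 0).val),
      (hAB.pow_pow (h 0).val (g 1).val).eq]
    simp only [mul_assoc]

theorem pairChar_apply (A B : M) (hA : A ^ p = 1) (hB : B ^ p = 1) (hAB : Commute A B)
    (g : Fin 2 → ZMod p) : pairChar A B hA hB hAB g = A ^ (g 0).val * B ^ (g 1).val := rfl

theorem map_smul_eq_pow {G : Type*} [AddCommGroup G] [Module (ZMod p) G] (W : AddChar G M)
    (a : ZMod p) (g : G) : W (a • g) = W g ^ a.val := by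
  rw [← AddChar.map_nsmul_eq_pow]
  congr 1
  rw [← Nat.cast_smul_eq_nsmul (ZMod p), ZMod.natCast_zmod_val]

theorem pairChar_fst [Fact (1 < p)] (A B : M) (hA : A ^ p = 1) (hB : B ^ p = 1)
    (hAB : Commute A B) : pairChar A B hA hB hAB ![1, 0] = A := by
  simp [pairChar_apply, ZMod.val_one]

theorem pairChar_snd [Fact (1 < p)] (A B : M) (hA : A ^ p = 1) (hB : B ^ p = 1)
    (hAB : Commute A B) : pairChar A B hA hB hAB ![0, 1] = B := by
  simp [pairChar_apply, ZMod.val_one]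

end PairChar

/-! ### Stabilizer projectors as averages of Weyl operators -/

section Stabilizer

variable {p n : ℕ} [NeZero p]

theorem single_eq_sum_weyl (k : Fin n → ZMod p) :
    (Matrix.single k k 1 : Op p n) =
      ((p : ℂ) ^ n)⁻¹ • ∑ z : Fin n → ZMod p, chi p (-(k ⬝ᵥ z)) • weyl 0 z := by
  ext i j
  rw [Matrix.smul_apply, Matrix.sum_apply]
  by_cases h : i = j
  · subst h
    have : ∀ z : Fin n → ZMod p, (chi p (-(k ⬝ᵥ z)) • weyl (0 : Fin n → ZMod p) z) i i =
        chi p ((i - k) ⬝ᵥ z) := by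
      intro z
      simp only [weyl, add_zero, Matrix.smul_apply, Matrix.of_apply, if_true, smul_eq_mul]
      rw [← AddChar.map_add_eq_mul, sub_dotProduct, dotProduct_comm z i]
      congr 1
      ring
    simp_rw [this]
    rw [sum_chi_dotProduct]
    by_cases hk : i = k
    · subst hk
      have := NeZero.ne p
      simp [this]
    · rw [if_neg (sub_ne_zero.2 hk), smul_zero, Matrix.single_apply_of_ne]
      tauto
  · rw [Matrix.single_apply_of_ne, Finset.sum_eq_zero, smul_zero]
    · intro z _
      simp [weyl, h]
    · rintro ⟨rfl, rfl⟩
      exact h rfl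

theorem posSemidef_of_mem_stabilizerProjectors {P : Op p n} (hP : P ∈ stabilizerProjectors p n) :
    P.PosSemidef := by
  obtain ⟨U, _, k, rfl⟩ := hP
  refine Matrix.PosSemidef.mul_mul_conjTranspose_same ?_ _
  rw [← Matrix.diagonal_single]
  refine Matrix.PosSemidef.diagonal ?_
  intro i
  by_cases h : i = k
  · subst h; simp
  · simp [h]

theorem trace_of_mem_stabilizerProjectors {P : Op p n} (hP : P ∈ stabilizerProjectors p n) :
    P.trace = 1 := by
  obtain ⟨U, _, k, rfl⟩ := hP
  have hU : (U : Op p n)ᴴ * (U : Op p n) = 1 := Matrix.mem_unitaryGroup_iff'.1 U.2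
  rw [Matrix.trace_mul_comm, ← mul_assoc, hU, one_mul, Matrix.trace_single_eq_same]

theorem mul_self_of_mem_stabilizerProjectors {P : Op p n} (hP : P ∈ stabilizerProjectors p n) :
    P * P = P := by
  obtain ⟨U, _, k, rfl⟩ := hP
  have hU : (U : Op p n)ᴴ * (U : Op p n) = 1 := Matrix.mem_unitaryGroup_iff'.1 U.2
  calc _ = (U : Op p n) * Matrix.single k k 1 * ((U : Op p n)ᴴ * (U : Op p n)) *
        Matrix.single k k 1 * (U : Op p n)ᴴ := by simp only [mul_assoc]
    _ = _ := by rw [hU, mul_one, mul_assoc (U : Op p n), Matrix.single_mul_single_same, one_mul]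

theorem isHermitian_of_mem_stabilizerProjectors {P : Op p n} (hP : P ∈ stabilizerProjectors p n) :
    Pᴴ = P := (posSemidef_of_mem_stabilizerProjectors hP).isHermitian

theorem isState_of_mem_stabilizerProjectors {P : Op p n} (hP : P ∈ stabilizerProjectors p n) :
    IsState P :=
  ⟨posSemidef_of_mem_stabilizerProjectors hP, trace_of_mem_stabilizerProjectors hP⟩

theorem mul_eq_zero_comm_of_mem_stabilizerProjectors {P Q : Op p n}
    (hP : P ∈ stabilizerProjectors p n) (hQ : Q ∈ stabilizerProjectors p n) (h : P * Q = 0) :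
    Q * P = 0 := by
  rw [← isHermitian_of_mem_stabilizerProjectors hP, ← isHermitian_of_mem_stabilizerProjectors hQ,
    ← Matrix.conjTranspose_mul, h, Matrix.conjTranspose_zero]

theorem exists_mem_weylGroup_displacement (x z : Fin n → ZMod p) :
    ∃ w ∈ weylGroup p n, (w : Op p n) = tensor fun i => displacement p (x i) (z i) := by
  have hp : 0 < 4 * p := Nat.mul_pos (by norm_num) (Nat.pos_of_ne_zero (NeZero.ne p))
  refine ⟨⟨_, (IsMonomial.tensor fun i => isMonomial_displacement p (x i) (z i)).mem_unitaryGroup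
    hp⟩, Subgroup.subset_closure ⟨x, z, rfl⟩, rfl⟩

theorem exists_mem_weylGroup_shift (x : Fin n → ZMod p) :
    ∃ w ∈ weylGroup p n, (w : Op p n) = weyl x 0 := by
  obtain ⟨w, hw, h⟩ := exists_mem_weylGroup_displacement x (0 : Fin n → ZMod p)
  refine ⟨w, hw, ?_⟩
  rw [h, ← tensor_weyl1]
  congr 1
  ext i : 1
  simp [displacement_eq]

theorem exists_mem_weylGroup_clock (z : Fin n → ZMod p) :
    ∃ w ∈ weylGroup p n, (w : Op p n) = weyl 0 z := by
  obtain ⟨w, hw, h⟩ := exists_mem_weylGroup_displacement (0 : Fin n → ZMod p) z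
  refine ⟨w, hw, ?_⟩
  rw [h, ← tensor_weyl1]
  congr 1
  ext i : 1
  simp [displacement_eq]

/-- A stabilizer projector is the projector onto the common fixed vectors of an abelian group of
multiples of Weyl operators, isomorphic to `ℤ_p ^ n`, in which only the identity has nonzero
trace. -/
theorem exists_char_of_mem_stabilizerProjectors {P : Op p n}
    (hP : P ∈ stabilizerProjectors p n) :
    ∃ W : AddChar (Fin n → ZMod p) (Op p n), (∀ g, IsWeyl (W g)) ∧
      (∀ g, g ≠ 0 → (W g).trace = 0) ∧ P = projOf W := by
  obtain ⟨U, hU, k, rfl⟩ := hP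
  have hUU : (U : Op p n)ᴴ * (U : Op p n) = 1 := Matrix.mem_unitaryGroup_iff'.1 U.2
  have hUU' : (U : Op p n) * (U : Op p n)ᴴ = 1 := Matrix.mem_unitaryGroup_iff.1 U.2
  let W : AddChar (Fin n → ZMod p) (Op p n) :=
    { toFun := fun z => chi p (-(k ⬝ᵥ z)) • ((U : Op p n) * weyl 0 z * (U : Op p n)ᴴ)
      map_zero_eq_one' := by
        rw [dotProduct_zero, neg_zero, AddChar.map_zero_eq_one, weyl_zero, mul_one, one_smul, hUU']
      map_add_eq_mul' := fun z z' => by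
        have h1 : weyl (0 : Fin n → ZMod p) (z + z') = weyl 0 z * weyl 0 z' := by
          rw [weyl_mul]; simp
        have h2 : (U : Op p n) * weyl 0 z * (U : Op p n)ᴴ * ((U : Op p n) * weyl 0 z' *
            (U : Op p n)ᴴ) = (U : Op p n) * weyl 0 z * ((U : Op p n)ᴴ * (U : Op p n)) * weyl 0 z' *
            (U : Op p n)ᴴ := by simp only [mul_assoc]
        rw [smul_mul_smul_comm, h2, hUU, mul_one, h1, ← AddChar.map_add_eq_mul, dotProduct_add,
          neg_add]
        simp only [mul_assoc] }
  have hWz : ∀ z, W z = chi p (-(k ⬝ᵥ z)) • ((U : Op p n) * weyl 0 z * (U : Op p n)ᴴ) :=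
    fun z => rfl
  refine ⟨W, fun z => ?_, fun z hz => ?_, ?_⟩
  · obtain ⟨w, hw, h⟩ := exists_mem_weylGroup_clock z
    have h1 := isWeyl_of_mem_weylGroup ((hU w).1 hw)
    have h2 : ((U * w * U⁻¹ : Matrix.unitaryGroup (Fin n → ZMod p) ℂ) : Op p n) =
        (U : Op p n) * weyl 0 z * (U : Op p n)ᴴ := by
      rw [← h]; rfl
    rw [h2] at h1
    exact h1.smul (chi_ne_zero _)
  · rw [hWz, Matrix.trace_smul, Matrix.trace_mul_comm, ← mul_assoc, hUU, one_mul, trace_weyl,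
      if_neg (fun h => hz h.2), smul_zero]
  · rw [projOf, single_eq_sum_weyl, mul_smul_comm, smul_mul_assoc, Finset.mul_sum, Finset.sum_mul]
    simp only [Fintype.card_pi, ZMod.card, Finset.prod_const, Finset.card_univ, Fintype.card_fin,
      Nat.cast_pow]
    congr 1
    refine Finset.sum_congr rfl fun z _ => ?_
    rw [hWz, mul_smul_comm, smul_mul_assoc]

end Stabilizer

/-! ### Construction of Clifford unitaries -/

section Clifford

variable {p n : ℕ} [Fact p.Prime]

theorem exists_dotProduct_ne_zero {x : Fin n → ZMod p} (hx : x ≠ 0) :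
    ∃ g : Fin n → ZMod p, g ⬝ᵥ x ≠ 0 := by
  obtain ⟨i, hi⟩ := Function.ne_iff.1 hx
  exact ⟨Pi.single i 1, by simpa using hi⟩

/-- Operators satisfying the relations of the clock operators and shift operators are simultaneously
unitarily equivalent to them: if `ψ` is a unit vector fixed by all `Z' z`, the unitary maps the
computational basis vector `x` to `X' x ψ`. -/
theorem exists_unitary_intertwining (Z' X' : AddChar (Fin n → ZMod p) (Op p n))
    (hZ : ∀ z, (Z' z)ᴴ * Z' z = 1) (hX : ∀ x, (X' x)ᴴ * X' x = 1)
    (hZX : ∀ z x, Z' z * X' x = chi p (z ⬝ᵥ x) • (X' x * Z' z)) :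
    ∃ U : Op p n, Uᴴ * U = 1 ∧ (∀ z, U * weyl 0 z = Z' z * U) ∧ ∀ x, U * weyl x 0 = X' x * U := by
  have htr : ∀ z, z ≠ 0 → (Z' z).trace = 0 := by
    intro z hz
    obtain ⟨x, hx⟩ := exists_dotProduct_ne_zero hz
    have h1 : (Z' z).trace = chi p (z ⬝ᵥ x) * (Z' z).trace := by
      calc (Z' z).trace = (Z' z * X' x * (X' x)ᴴ).trace := by
            rw [mul_assoc, mul_eq_one_comm.1 (hX x), mul_one]
        _ = chi p (z ⬝ᵥ x) * (Z' z).trace := by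
            rw [hZX, smul_mul_assoc, Matrix.trace_smul, Matrix.trace_mul_comm, ← mul_assoc, hX,
              one_mul, smul_eq_mul]
    have h2 : (1 - chi p (z ⬝ᵥ x)) * (Z' z).trace = 0 := by
      rw [sub_mul, one_mul, ← h1, sub_self]
    refine (mul_eq_zero.1 h2).resolve_left fun h3 => hx ?_
    rw [dotProduct_comm, ← chi_eq_one_iff, ← sub_eq_zero.1 h3]
  have hP : projOf Z' ≠ 0 := by
    intro h
    have h1 := trace_projOf Z' htr
    rw [h, Matrix.trace_zero, inv_mul_cancel₀ (Nat.cast_ne_zero.2 Fintype.card_ne_zero)] at h1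
    exact zero_ne_one h1
  obtain ⟨φ, hφ0, hφ⟩ : ∃ φ : (Fin n → ZMod p) → ℂ, φ ≠ 0 ∧ ∀ z, Z' z *ᵥ φ = φ := by
    by_contra hne
    push Not at hne
    refine hP (Matrix.ext_of_mulVec_single fun j => ?_)
    by_contra h0
    rw [Matrix.zero_mulVec] at h0
    obtain ⟨z, hz⟩ := hne _ h0
    rw [Matrix.mulVec_mulVec, apply_mul_projOf] at hz
    exact hz rfl
  obtain ⟨ψ, hψ1, hψ⟩ : ∃ ψ : (Fin n → ZMod p) → ℂ, star ψ ⬝ᵥ ψ = 1 ∧ ∀ z, Z' z *ᵥ ψ = ψ := by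
    have hpos : 0 < star φ ⬝ᵥ φ := Matrix.dotProduct_star_self_pos_iff.2 hφ0
    obtain ⟨r, hr⟩ : ∃ r : ℝ, star φ ⬝ᵥ φ = r :=
      ⟨_, (Complex.ext rfl (by simpa using (Complex.pos_iff.1 hpos).2.symm))⟩
    have hr0 : 0 < r := by rw [hr] at hpos; exact_mod_cast hpos
    refine ⟨((Real.sqrt r)⁻¹ : ℂ) • φ, ?_, fun z => by rw [Matrix.mulVec_smul, hφ]⟩
    rw [star_smul, smul_dotProduct, dotProduct_smul, hr]
    have h2 : (Real.sqrt r : ℂ) * Real.sqrt r = r := by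
      rw [← Complex.ofReal_mul, Real.mul_self_sqrt hr0.le]
    have h3 : (Real.sqrt r : ℂ) ≠ 0 := Complex.ofReal_ne_zero.2 (Real.sqrt_pos.2 hr0).ne'
    have h4 : star ((Real.sqrt r : ℂ)⁻¹) = (Real.sqrt r : ℂ)⁻¹ := by
      rw [star_inv₀]; simp
    rw [h4, smul_eq_mul, smul_eq_mul, ← h2]
    field_simp
  have heig : ∀ z x, Z' z *ᵥ (X' x *ᵥ ψ) = chi p (z ⬝ᵥ x) • (X' x *ᵥ ψ) := by
    intro z x
    rw [Matrix.mulVec_mulVec, hZX, Matrix.smul_mulVec, ← Matrix.mulVec_mulVec, hψ]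
  have hiso : ∀ (M : Op p n) (v w : (Fin n → ZMod p) → ℂ), Mᴴ * M = 1 →
      star (M *ᵥ v) ⬝ᵥ (M *ᵥ w) = star v ⬝ᵥ w := by
    intro M v w hM
    rw [Matrix.star_mulVec, Matrix.dotProduct_mulVec, Matrix.vecMul_vecMul, hM, Matrix.vecMul_one]
  have horth : ∀ x y, star (X' x *ᵥ ψ) ⬝ᵥ (X' y *ᵥ ψ) = if x = y then 1 else 0 := by
    intro x y
    split_ifs with hxy
    · subst hxy
      rw [hiso _ _ _ (hX x), hψ1]
    · obtain ⟨z, hz⟩ := exists_dotProduct_ne_zero (sub_ne_zero.2 (Ne.symm hxy))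
      have h1 := hiso (Z' z) (X' x *ᵥ ψ) (X' y *ᵥ ψ) (hZ z)
      rw [heig, heig, star_smul, smul_dotProduct, dotProduct_smul, star_chi, smul_smul, smul_eq_mul,
        ← AddChar.map_add_eq_mul, neg_add_eq_sub, ← dotProduct_sub] at h1
      by_contra h0
      exact hz ((chi_eq_one_iff _).1 (mul_right_cancel₀ h0 (h1.trans (one_mul _).symm)))
  refine ⟨Matrix.of fun k x => (X' x *ᵥ ψ) k, ?_, fun z => ?_, fun x => ?_⟩
  · ext x y
    rw [Matrix.one_apply, ← horth x y]
    rfl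
  · ext k x
    have h1 := congrFun (heig z x) k
    change _ = (Z' z *ᵥ (X' x *ᵥ ψ)) k
    rw [h1, Matrix.mul_apply]
    simp [weyl, mul_comm]
  · ext k y
    have h1 : X' x *ᵥ (X' y *ᵥ ψ) = X' (y + x) *ᵥ ψ := by
      rw [Matrix.mulVec_mulVec, ← AddChar.map_add_eq_mul, add_comm]
    change _ = (X' x *ᵥ (X' y *ᵥ ψ)) k
    rw [h1, Matrix.mul_apply]
    simp [weyl]

/-- The projectors onto the joint eigenvectors of clock operators `Z'` in the Weyl-Heisenberg group
which have companion shift operators `X'` in this group are stabilizer projectors. -/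
theorem projOf_mem_stabilizerProjectors
    (Z' X' : AddChar (Fin n → ZMod p) (Op p n))
    (hZ : ∀ z, ∃ w ∈ weylGroup p n, (w : Op p n) = Z' z)
    (hX : ∀ x, ∃ w ∈ weylGroup p n, (w : Op p n) = X' x)
    (hZX : ∀ z x, Z' z * X' x = chi p (z ⬝ᵥ x) • (X' x * Z' z))
    (k : Fin n → ZMod p) (W : AddChar (Fin n → ZMod p) (Op p n))
    (hW : ∀ z, W z = chi p (-(k ⬝ᵥ z)) • Z' z) : projOf W ∈ stabilizerProjectors p n := by
  obtain ⟨U, hU, hUZ, hUX⟩ := exists_unitary_intertwining Z' X'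
    (fun z => by obtain ⟨w, _, h⟩ := hZ z; rw [← h]; exact Matrix.mem_unitaryGroup_iff'.1 w.2)
    (fun x => by obtain ⟨w, _, h⟩ := hX x; rw [← h]; exact Matrix.mem_unitaryGroup_iff'.1 w.2) hZX
  let V : Matrix.unitaryGroup (Fin n → ZMod p) ℂ := ⟨U, Matrix.mem_unitaryGroup_iff'.2 hU⟩
  have hUU : U * Uᴴ = 1 := mul_eq_one_comm.1 hU
  -- conjugates of the generators
  have hconj : ∀ (w v : Matrix.unitaryGroup (Fin n → ZMod p) ℂ),
      U * (w : Op p n) = (v : Op p n) * U → V * w * V⁻¹ = v := by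
    intro w v h
    rw [mul_inv_eq_iff_eq_mul]
    exact Subtype.ext h
  refine ⟨V, ?_, k, ?_⟩
  · have := finite_weylGroup p n
    refine Subgroup.mem_normalizer_fintype
      (S := (weylGroup p n : Set (Matrix.unitaryGroup (Fin n → ZMod p) ℂ))) fun g hg => ?_
    change V * g * V⁻¹ ∈ weylGroup p n
    change g ∈ Subgroup.closure _ at hg
    induction hg using Subgroup.closure_induction with
    | mem d hd =>
      obtain ⟨x, z, hxz⟩ := hd
      have hdm : d ∈ weylGroup p n := Subgroup.subset_closure ⟨x, z, hxz⟩
      obtain ⟨a, ha, hax⟩ := exists_mem_weylGroup_shift x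
      obtain ⟨b, hb, hbz⟩ := exists_mem_weylGroup_clock z
      obtain ⟨a', ha', hax'⟩ := hX x
      obtain ⟨b', hb', hbz'⟩ := hZ z
      have h1 : V * a * V⁻¹ = a' := hconj a a' (by rw [hax, hax', hUX])
      have h2 : V * b * V⁻¹ = b' := hconj b b' (by rw [hbz, hbz', hUZ])
      -- `s` is the scalar by which the displacement operator differs from the product `X ^ x Z ^ z`
      set s := d * (a * b)⁻¹ with hs
      obtain ⟨c, hc⟩ : ∃ c : ℂ, (s : Op p n) = c • 1 := by
        refine ⟨∏ i, tau p ^ ((x i).val * (z i).val), ?_⟩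
        have h3 : (s : Op p n) * ((a * b : Matrix.unitaryGroup (Fin n → ZMod p) ℂ) : Op p n) = d := by
          rw [← Matrix.UnitaryGroup.mul_val, hs, inv_mul_cancel_right]
        have h4 : ((a * b : Matrix.unitaryGroup (Fin n → ZMod p) ℂ) : Op p n) = weyl x z := by
          rw [Matrix.UnitaryGroup.mul_val, hax, hbz, weyl_mul]
          simp
        have h5 : (d : Op p n) = (∏ i, tau p ^ ((x i).val * (z i).val)) • weyl x z := by
          rw [hxz, ← tensor_weyl1, ← tensor_smul]
          simp_rw [displacement_eq]
        have h6 : (s : Op p n) = (d : Op p n) *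
            (((a * b)⁻¹ : Matrix.unitaryGroup (Fin n → ZMod p) ℂ) : Op p n) := rfl
        rw [h6, h5, ← h4, smul_mul_assoc, ← Matrix.UnitaryGroup.mul_val, mul_inv_cancel]
        rfl
      have h7 : V * s * V⁻¹ = s := hconj s s (by rw [hc, mul_smul_comm, smul_mul_assoc, one_mul,
        mul_one])
      have h8 : V * d * V⁻¹ = s * (a' * b') := by
        rw [← h1, ← h2, ← h7, hs]
        group
      rw [h8]
      exact mul_mem (mul_mem hdm (inv_mem (mul_mem ha hb))) (mul_mem ha' hb')
    | one => simp
    | mul g h _ _ hg hh =>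
      have : V * (g * h) * V⁻¹ = (V * g * V⁻¹) * (V * h * V⁻¹) := by group
      rw [this]
      exact mul_mem hg hh
    | inv g _ hg =>
      have : V * g⁻¹ * V⁻¹ = (V * g * V⁻¹)⁻¹ := by group
      rw [this]
      exact inv_mem hg
  · change projOf W = U * Matrix.single k k 1 * Uᴴ
    rw [projOf, single_eq_sum_weyl, mul_smul_comm, smul_mul_assoc, Finset.mul_sum, Finset.sum_mul]
    simp only [Fintype.card_pi, ZMod.card, Finset.prod_const, Finset.card_univ, Fintype.card_fin,
      Nat.cast_pow]
    congr 1
    refine Finset.sum_congr rfl fun z _ => ?_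
    rw [hW, mul_smul_comm, smul_mul_assoc, hUZ, mul_assoc, hUU, mul_one]

end Clifford

/-! ### Two-qudit displacement operators and their joint eigenprojectors -/

section TwoQudits

variable {p : ℕ} [Fact p.Prime]

/-- The two-qudit displacement operator `D_{a.1} ⊗ D_{a.2}`. -/
abbrev disp2 (a : (ZMod p × ZMod p) × (ZMod p × ZMod p)) : Op p 2 :=
  tensorPair (disp a.1) (disp a.2)

/-- The symplectic form on the phase space of two qudits. -/
def symp2 (a b : (ZMod p × ZMod p) × (ZMod p × ZMod p)) : ZMod p :=
  symp a.1 b.1 + symp a.2 b.2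

theorem disp2_mul_comm (a b : (ZMod p × ZMod p) × (ZMod p × ZMod p)) :
    disp2 a * disp2 b = chi p (symp2 a b) • (disp2 b * disp2 a) := by
  rw [disp2, disp2, tensorPair_mul, tensorPair_mul, disp_mul_comm a.1, disp_mul_comm a.2,
    tensorPair_smul_left, tensorPair_smul_right, smul_smul, symp2, AddChar.map_add_eq_mul]

theorem disp2_pow_p (a : (ZMod p × ZMod p) × (ZMod p × ZMod p)) : disp2 a ^ p = 1 := by
  rw [disp2, tensorPair_pow, disp_pow_p, disp_pow_p, tensorPair_one]

theorem disp2_eq_tensor (a : (ZMod p × ZMod p) × (ZMod p × ZMod p)) :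
    disp2 a = tensor fun i => displacement p (![a.1.1, a.2.1] i) (![a.1.2, a.2.2] i) := by
  rw [disp2, tensorPair]
  congr 1
  ext i : 1
  fin_cases i <;> rfl

theorem exists_disp2_eq (a : (ZMod p × ZMod p) × (ZMod p × ZMod p)) :
    ∃ c : ℂ, c ≠ 0 ∧ disp2 a = c • weyl ![a.1.1, a.2.1] ![a.1.2, a.2.2] := by
  rw [disp2_eq_tensor]
  simp_rw [displacement_eq]
  rw [tensor_smul, tensor_weyl1]
  exact ⟨_, Finset.prod_ne_zero_iff.2 fun i _ => pow_ne_zero _ tau_ne_zero, rfl⟩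

theorem isWeyl_disp2 (a : (ZMod p × ZMod p) × (ZMod p × ZMod p)) : IsWeyl (disp2 a) := by
  rw [disp2_eq_tensor]
  exact isWeyl_tensor_displacement _ _

theorem IsWeyl.exists_disp2 {M : Op p 2} (hM : IsWeyl M) :
    ∃ c : ℂ, c ≠ 0 ∧ ∃ a, M = c • disp2 a := by
  obtain ⟨c, hc, x, z, rfl⟩ := hM
  obtain ⟨d, hd, h⟩ := exists_disp2_eq ((x 0, z 0), (x 1, z 1))
  refine ⟨c * d⁻¹, mul_ne_zero hc (inv_ne_zero hd), ((x 0, z 0), (x 1, z 1)), ?_⟩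
  rw [h, smul_smul, inv_mul_cancel_right₀ hd]
  congr 2
  · ext i; fin_cases i <;> rfl
  · ext i; fin_cases i <;> rfl

theorem disp2_label_unique {a b : (ZMod p × ZMod p) × (ZMod p × ZMod p)} {c d : ℂ} (hc : c ≠ 0)
    (h : c • disp2 a = d • disp2 b) : a = b := by
  obtain ⟨c', hc', h1⟩ := exists_disp2_eq a
  obtain ⟨d', hd', h2⟩ := exists_disp2_eq b
  rw [h1, h2, smul_smul, smul_smul] at h
  have h3 : weyl ![a.1.1, a.2.1] ![a.1.2, a.2.2] =
      ((c * c')⁻¹ * (d * d')) • weyl ![b.1.1, b.2.1] ![b.1.2, b.2.2] := by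
    rw [← smul_smul, ← h, smul_smul, inv_mul_cancel₀ (mul_ne_zero hc hc'), one_smul]
  obtain ⟨h4, h5⟩ := weyl_eq_smul_weyl_iff h3
  ext
  · exact congrFun h4 0
  · exact congrFun h5 0
  · exact congrFun h4 1
  · exact congrFun h5 1

theorem exists_disp2_mul (a b : (ZMod p × ZMod p) × (ZMod p × ZMod p)) :
    ∃ c : ℂ, c ≠ 0 ∧ disp2 a * disp2 b = c • disp2 (a + b) := by
  obtain ⟨c, hc, h1⟩ := exists_disp2_eq a
  obtain ⟨d, hd, h2⟩ := exists_disp2_eq b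
  obtain ⟨e, he, h3⟩ := exists_disp2_eq (a + b)
  refine ⟨c * d * chi p (![a.1.2, a.2.2] ⬝ᵥ ![b.1.1, b.2.1]) * e⁻¹, ?_, ?_⟩
  · exact mul_ne_zero (mul_ne_zero (mul_ne_zero hc hd) (chi_ne_zero _)) (inv_ne_zero he)
  · rw [h1, h2, h3, smul_mul_smul_comm, weyl_mul, smul_smul, smul_smul,
      inv_mul_cancel_right₀ he]
    simp

theorem smul_disp2_pow_p (k : ZMod p) (a : (ZMod p × ZMod p) × (ZMod p × ZMod p)) :
    (chi p k • disp2 a) ^ p = 1 := by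
  rw [smul_pow, chi_pow_p, disp2_pow_p, one_smul]

theorem smul_disp2_commute (k l : ZMod p) {a b : (ZMod p × ZMod p) × (ZMod p × ZMod p)}
    (h : symp2 a b = 0) : Commute (chi p k • disp2 a) (chi p l • disp2 b) := by
  refine Commute.smul_left (Commute.smul_right ?_ _) _
  have := disp2_mul_comm a b
  rwa [h, AddChar.map_zero_eq_one, one_smul] at this

/-- The representation of `ℤ_p ^ 2` generated by the commuting operators `ω ^ (s 0) D_a` and
`ω ^ (s 1) D_b`. -/
def stabChar (a b : (ZMod p × ZMod p) × (ZMod p × ZMod p)) (h : symp2 a b = 0)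
    (s : Fin 2 → ZMod p) : AddChar (Fin 2 → ZMod p) (Op p 2) :=
  pairChar (chi p (s 0) • disp2 a) (chi p (s 1) • disp2 b) (smul_disp2_pow_p _ _)
    (smul_disp2_pow_p _ _) (smul_disp2_commute _ _ h)

theorem stabChar_apply (a b : (ZMod p × ZMod p) × (ZMod p × ZMod p)) (h : symp2 a b = 0)
    (s g : Fin 2 → ZMod p) :
    stabChar a b h s g = chi p (s ⬝ᵥ g) • (disp2 a ^ (g 0).val * disp2 b ^ (g 1).val) := by
  rw [stabChar, pairChar_apply, smul_pow, smul_pow, smul_mul_smul_comm, chi_pow_val, chi_pow_val,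
    ← AddChar.map_add_eq_mul]
  congr 2
  simp [dotProduct, Fin.sum_univ_two, mul_comm]

theorem stabChar_fst (a b : (ZMod p × ZMod p) × (ZMod p × ZMod p)) (h : symp2 a b = 0)
    (s : Fin 2 → ZMod p) : stabChar a b h s ![1, 0] = chi p (s 0) • disp2 a := by
  have : Fact (1 < p) := ⟨(Fact.out : p.Prime).one_lt⟩
  exact pairChar_fst _ _ _ _ _

theorem stabChar_snd (a b : (ZMod p × ZMod p) × (ZMod p × ZMod p)) (h : symp2 a b = 0)
    (s : Fin 2 → ZMod p) : stabChar a b h s ![0, 1] = chi p (s 1) • disp2 b := by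
  have : Fact (1 < p) := ⟨(Fact.out : p.Prime).one_lt⟩
  exact pairChar_snd _ _ _ _ _

theorem isWeyl_stabChar (a b : (ZMod p × ZMod p) × (ZMod p × ZMod p)) (h : symp2 a b = 0)
    (s g : Fin 2 → ZMod p) : IsWeyl (stabChar a b h s g) := by
  rw [stabChar_apply]
  exact (((isWeyl_disp2 a).pow _).mul ((isWeyl_disp2 b).pow _)).smul (chi_ne_zero _)

theorem disp2_fst_mul_projOf (a b : (ZMod p × ZMod p) × (ZMod p × ZMod p)) (h : symp2 a b = 0)
    (s : Fin 2 → ZMod p) :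
    disp2 a * projOf (stabChar a b h s) = chi p (-s 0) • projOf (stabChar a b h s) := by
  have h1 := apply_mul_projOf (stabChar a b h s) ![1, 0]
  rw [stabChar_fst, smul_mul_assoc] at h1
  conv_rhs => rw [← h1, smul_smul, ← AddChar.map_add_eq_mul, neg_add_cancel,
    AddChar.map_zero_eq_one, one_smul]

theorem disp2_snd_mul_projOf (a b : (ZMod p × ZMod p) × (ZMod p × ZMod p)) (h : symp2 a b = 0)
    (s : Fin 2 → ZMod p) :
    disp2 b * projOf (stabChar a b h s) = chi p (-s 1) • projOf (stabChar a b h s) := by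
  have h1 := apply_mul_projOf (stabChar a b h s) ![0, 1]
  rw [stabChar_snd, smul_mul_assoc] at h1
  conv_rhs => rw [← h1, smul_smul, ← AddChar.map_add_eq_mul, neg_add_cancel,
    AddChar.map_zero_eq_one, one_smul]

theorem symp2_eq_zero_of_eigen {P : Op p 2} (hP : P ≠ 0)
    {a b : (ZMod p × ZMod p) × (ZMod p × ZMod p)} {k l : ZMod p} (ha : disp2 a * P = chi p k • P)
    (hb : disp2 b * P = chi p l • P) : symp2 a b = 0 := by
  have h1 : disp2 a * disp2 b * P = (chi p l * chi p k) • P := by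
    rw [mul_assoc, hb, mul_smul_comm, ha, smul_smul]
  have h2 : disp2 b * disp2 a * P = (chi p l * chi p k) • P := by
    rw [mul_assoc, ha, mul_smul_comm, hb, smul_smul, mul_comm]
  rw [disp2_mul_comm, smul_mul_assoc, h2, smul_smul] at h1
  have h3 := smul_left_injective ℂ hP h1
  exact (chi_eq_one_iff _).1
    (mul_right_cancel₀ (mul_ne_zero (chi_ne_zero l) (chi_ne_zero k)) (h3.trans (one_mul _).symm))

theorem eq_of_chi_smul_eq {P : Op p 2} (hP : P ≠ 0) {k l : ZMod p}
    (h : chi p k • P = chi p l • P) : k = l :=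
  ZMod.injective_stdAddChar (smul_left_injective ℂ hP h)

theorem mul_pow_eq_smul_of_mul_eq_smul {A X : Op p 2} {c : ℂ} (h : A * X = c • (X * A))
    (m k : ℕ) : A ^ m * X ^ k = c ^ (m * k) • (X ^ k * A ^ m) := by
  have h1 : ∀ k, A * X ^ k = c ^ k • (X ^ k * A) := by
    intro k
    induction k with
    | zero => simp
    | succ k ih =>
      rw [pow_succ, ← mul_assoc, ih, smul_mul_assoc, mul_assoc, h, mul_smul_comm, smul_smul,
        ← mul_assoc, pow_succ]
  induction m with
  | zero => simp
  | succ m ih =>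
    rw [pow_succ, mul_assoc, h1, mul_smul_comm, ← mul_assoc, ih, smul_mul_assoc, smul_smul,
      mul_assoc, ← pow_add]
    congr 2
    ring

theorem exists_mem_weylGroup_stabChar (a b : (ZMod p × ZMod p) × (ZMod p × ZMod p))
    (h : symp2 a b = 0) (g : Fin 2 → ZMod p) :
    ∃ w ∈ weylGroup p 2, (w : Op p 2) = stabChar a b h 0 g := by
  obtain ⟨v, hv, hv'⟩ := exists_mem_weylGroup_displacement ![a.1.1, a.2.1] ![a.1.2, a.2.2]
  obtain ⟨w, hw, hw'⟩ := exists_mem_weylGroup_displacement ![b.1.1, b.2.1] ![b.1.2, b.2.2]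
  refine ⟨v ^ (g 0).val * w ^ (g 1).val, mul_mem (pow_mem hv _) (pow_mem hw _), ?_⟩
  rw [stabChar_apply, zero_dotProduct, AddChar.map_zero_eq_one, one_smul, disp2_eq_tensor,
    disp2_eq_tensor, ← hv', ← hw']
  rfl

theorem stabChar_mul_stabChar {a b c d : (ZMod p × ZMod p) × (ZMod p × ZMod p)}
    (hab : symp2 a b = 0) (hcd : symp2 c d = 0) (hac : symp2 a c = 1) (had : symp2 a d = 0)
    (hbc : symp2 b c = 0) (hbd : symp2 b d = 1) (g x : Fin 2 → ZMod p) :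
    stabChar a b hab 0 g * stabChar c d hcd 0 x =
      chi p (g ⬝ᵥ x) • (stabChar c d hcd 0 x * stabChar a b hab 0 g) := by
  simp only [stabChar_apply, zero_dotProduct, AddChar.map_zero_eq_one, one_smul]
  have h1 := mul_pow_eq_smul_of_mul_eq_smul (disp2_mul_comm a c) (g 0).val (x 0).val
  have h2 := mul_pow_eq_smul_of_mul_eq_smul (disp2_mul_comm a d) (g 0).val (x 1).val
  have h3 := mul_pow_eq_smul_of_mul_eq_smul (disp2_mul_comm b c) (g 1).val (x 0).val
  have h4 := mul_pow_eq_smul_of_mul_eq_smul (disp2_mul_comm b d) (g 1).val (x 1).val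
  rw [hac] at h1
  rw [had, AddChar.map_zero_eq_one, one_pow, one_smul] at h2
  rw [hbc, AddChar.map_zero_eq_one, one_pow, one_smul] at h3
  rw [hbd] at h4
  set A := disp2 a ^ (g 0).val
  set B := disp2 b ^ (g 1).val
  set C := disp2 c ^ (x 0).val
  set D := disp2 d ^ (x 1).val
  have hc : chi p (g ⬝ᵥ x) =
      chi p 1 ^ ((g 1).val * (x 1).val) * chi p 1 ^ ((g 0).val * (x 0).val) := by
    rw [chi_pow, chi_pow, ← AddChar.map_add_eq_mul]
    congr 1
    simp [dotProduct, Fin.sum_univ_two, add_comm]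
  calc A * B * (C * D) = A * (B * C) * D := by simp only [mul_assoc]
    _ = (A * C) * (B * D) := by rw [h3]; simp only [mul_assoc]
    _ = _ := by
      rw [h1, h4, smul_mul_smul_comm, hc, mul_comm (chi p 1 ^ _)]
      congr 1
      calc C * A * (D * B) = C * (A * D) * B := by simp only [mul_assoc]
        _ = _ := by rw [h2]; simp only [mul_assoc]

/-- If `(a, b, c, d)` is a symplectic basis, the joint eigenprojectors of `D_a` and `D_b` are
stabilizer projectors, with `D_c` and `D_d` in the role of the shift operators. -/
theorem projOf_stabChar_mem {a b c d : (ZMod p × ZMod p) × (ZMod p × ZMod p)}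
    (hab : symp2 a b = 0) (hcd : symp2 c d = 0) (hac : symp2 a c = 1) (had : symp2 a d = 0)
    (hbc : symp2 b c = 0) (hbd : symp2 b d = 1) (s : Fin 2 → ZMod p) :
    projOf (stabChar a b hab s) ∈ stabilizerProjectors p 2 := by
  refine projOf_mem_stabilizerProjectors (stabChar a b hab 0) (stabChar c d hcd 0)
    (exists_mem_weylGroup_stabChar a b hab) (exists_mem_weylGroup_stabChar c d hcd)
    (stabChar_mul_stabChar hab hcd hac had hbc hbd) (-s) _ fun z => ?_
  rw [stabChar_apply, stabChar_apply, zero_dotProduct, AddChar.map_zero_eq_one, one_smul,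
    neg_dotProduct, neg_neg]

end TwoQudits

/-! ### Entangled stabilizer states -/

section Entangled

variable {p : ℕ} [Fact p.Prime]

/-- The linear maps `F` of determinant `-1` of the phase space `ℤ_p ^ 2`, given by the images
`(F (1, 0), F (0, 1))`. They label the bases of entangled stabilizer states: the basis belonging to
`F` diagonalizes the operators `D_u ⊗ D_{F u}`, which commute as `F` reverses the sign of the
symplectic form. -/
abbrev EntLabel (p : ℕ) :=
  {F : (ZMod p × ZMod p) × (ZMod p × ZMod p) // symp F.1 F.2 = 1}

theorem symp2_entLabel (F : EntLabel p) : symp2 ((1, 0), F.1.1) ((0, 1), F.1.2) = 0 := by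
  rw [symp2, F.2]
  simp [symp]

/-- The stabilizer group, with phases given by `s`, of an entangled stabilizer state. -/
abbrev entChar (F : EntLabel p) (s : Fin 2 → ZMod p) : AddChar (Fin 2 → ZMod p) (Op p 2) :=
  stabChar ((1, 0), F.1.1) ((0, 1), F.1.2) (symp2_entLabel F) s

theorem projOf_entChar_mem (F : EntLabel p) (s : Fin 2 → ZMod p) :
    projOf (entChar F s) ∈ stabilizerProjectors p 2 := by
  refine projOf_stabChar_mem (c := ((0, -1), 0)) (d := (0, -F.1.1)) (symp2_entLabel F) ?_ ?_ ?_ ?_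
    ?_ s
  · simp [symp2, symp]
  · simp [symp2, symp]
  · simp [symp2, symp]
  · simp [symp2, symp]
  · have := F.2
    simp only [symp] at this
    simp only [symp2, symp, Prod.fst_zero, Prod.snd_zero, Prod.fst_neg, Prod.snd_neg]
    linear_combination this

theorem ne_zero_of_mem_stabilizerProjectors {n : ℕ} {P : Op p n}
    (hP : P ∈ stabilizerProjectors p n) : P ≠ 0 := by
  rintro rfl
  have := trace_of_mem_stabilizerProjectors hP
  simp at this

theorem projOf_entChar_ne_tensor (F : EntLabel p) (s : Fin 2 → ZMod p) (M N : Op1 p) :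
    projOf (entChar F s) ≠ tensorPair M N := by
  intro h
  have htr := trace_of_mem_stabilizerProjectors (projOf_entChar_mem F s)
  have h1 := disp2_fst_mul_projOf _ _ (symp2_entLabel F) s
  have h2 : projOf (entChar F s) * (chi p (s 1) • disp2 ((0, 1), F.1.2)) =
      projOf (entChar F s) := by
    have := projOf_mul_apply (entChar F s) ![0, 1]
    rwa [stabChar_snd] at this
  have h3 := apply_mul_projOf (entChar F s) ![0, 1]
  rw [stabChar_snd] at h3
  -- the trace of `P` with `D_{1,0} ⊗ 1` vanishes, as this operator does not commute with the
  -- stabilizer group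
  have h4 : (disp2 (((1, 0), 0) : (ZMod p × ZMod p) × (ZMod p × ZMod p)) *
      projOf (entChar F s)).trace = 0 := by
    set P := projOf (entChar F s)
    set D := disp2 (((1, 0), 0) : (ZMod p × ZMod p) × (ZMod p × ZMod p))
    set B := chi p (s 1) • disp2 ((0, 1), F.1.2)
    have hc : D * B = chi p (-1) • (B * D) := by
      have : symp2 (((1, 0), 0) : (ZMod p × ZMod p) × (ZMod p × ZMod p)) ((0, 1), F.1.2) = -1 := by
        simp [symp2, symp]
      rw [mul_smul_comm, disp2_mul_comm, this, smul_mul_assoc, smul_comm]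
    have h5 : (D * P).trace = chi p (-1) * (D * P).trace := by
      calc (D * P).trace = (D * B * P).trace := by rw [mul_assoc, h3]
        _ = chi p (-1) * (D * (P * B)).trace := by
          rw [hc, smul_mul_assoc, Matrix.trace_smul, mul_assoc, Matrix.trace_mul_comm, mul_assoc,
            smul_eq_mul]
        _ = _ := by rw [h2]
    have h6 : (1 - chi p (-1)) * (D * P).trace = 0 := by rw [sub_mul, one_mul, ← h5, sub_self]
    refine (mul_eq_zero.1 h6).resolve_left fun h7 => ?_
    have := (chi_eq_one_iff (-1 : ZMod p)).1 (sub_eq_zero.1 h7).symm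
    exact one_ne_zero (neg_eq_zero.1 this)
  have h5 := congrArg Matrix.trace h1
  rw [Matrix.trace_smul, htr] at h5
  rw [show projOf (stabChar ((1, 0), F.1.1) ((0, 1), F.1.2) (symp2_entLabel F) s) =
    tensorPair M N from h, tensorPair_mul, trace_tensorPair] at h5
  rw [h, tensorPair_mul, trace_tensorPair, disp_zero, one_mul] at h4
  rw [h, trace_tensorPair] at htr
  have h6 : N.trace ≠ 0 := right_ne_zero_of_mul (htr.trans_ne one_ne_zero)
  rw [(mul_eq_zero.1 h4).resolve_right h6, zero_mul, smul_eq_mul, mul_one] at h5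
  exact chi_ne_zero _ h5.symm

theorem eq_of_symp_eq {f g u v : ZMod p × ZMod p} (h : symp f g = 1) (h1 : symp f u = symp f v)
    (h2 : symp g u = symp g v) : u = v := by
  simp only [symp] at h h1 h2
  ext
  · linear_combination (u.1 - v.1) * (-h) - f.1 * h2 + g.1 * h1
  · linear_combination (u.2 - v.2) * (-h) - f.2 * h2 + g.2 * h1

theorem projOf_entChar_injective {F F' : EntLabel p} {s s' : Fin 2 → ZMod p}
    (h : projOf (entChar F s) = projOf (entChar F' s')) : F = F' ∧ s = s' := by
  have hP := ne_zero_of_mem_stabilizerProjectors (projOf_entChar_mem F s)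
  have ha := disp2_fst_mul_projOf _ _ (symp2_entLabel F) s
  have hb := disp2_snd_mul_projOf _ _ (symp2_entLabel F) s
  have ha' := disp2_fst_mul_projOf _ _ (symp2_entLabel F') s'
  have hb' := disp2_snd_mul_projOf _ _ (symp2_entLabel F') s'
  change _ * projOf (entChar F' s') = _ • projOf (entChar F' s') at ha' hb'
  rw [← h] at ha' hb'
  have haa := symp2_eq_zero_of_eigen hP ha ha'
  have hba := symp2_eq_zero_of_eigen hP hb ha'
  have hab := symp2_eq_zero_of_eigen hP ha hb'
  have hbb := symp2_eq_zero_of_eigen hP hb hb'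
  obtain ⟨⟨f, g⟩, hF⟩ := F
  obtain ⟨⟨f', g'⟩, hF'⟩ := F'
  have hf : f = f' := by
    refine eq_of_symp_eq hF ?_ ?_
    · simp only [symp2, symp] at haa ⊢
      linear_combination -haa
    · simp only [symp2, symp] at hba hF ⊢
      linear_combination -hba - hF
  have hg : g = g' := by
    refine eq_of_symp_eq hF ?_ ?_
    · simp only [symp2, symp] at hab hF ⊢
      linear_combination -hab + hF
    · simp only [symp2, symp] at hbb ⊢
      linear_combination -hbb
  subst hf hg
  refine ⟨rfl, ?_⟩
  have h0 := eq_of_chi_smul_eq hP (ha.symm.trans ha')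
  have h1 := eq_of_chi_smul_eq hP (hb.symm.trans hb')
  ext i
  fin_cases i
  · exact neg_injective h0
  · exact neg_injective h1

theorem sum_projOf_stabChar (a b : (ZMod p × ZMod p) × (ZMod p × ZMod p)) (h : symp2 a b = 0) :
    ∑ s, projOf (stabChar a b h s) = 1 := by
  simp only [projOf]
  rw [← Finset.smul_sum, Finset.sum_comm]
  simp_rw [stabChar_apply, ← Finset.sum_smul]
  have h1 : ∀ g : Fin 2 → ZMod p, ∑ s : Fin 2 → ZMod p, chi p (s ⬝ᵥ g) =
      if g = 0 then (p : ℂ) ^ 2 else 0 := by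
    intro g
    simp_rw [dotProduct_comm _ g]
    exact sum_chi_dotProduct g
  simp_rw [h1, ite_smul, zero_smul, Finset.sum_ite_eq', Finset.mem_univ, if_true]
  have := (Fact.out : p.Prime).ne_zero
  simp [smul_smul, this]

theorem projOf_stabChar_mul_eq_zero (a b : (ZMod p × ZMod p) × (ZMod p × ZMod p))
    (h : symp2 a b = 0) {s s' : Fin 2 → ZMod p} (hs : s ≠ s') :
    projOf (stabChar a b h s) * projOf (stabChar a b h s') = 0 := by
  obtain ⟨g, hg⟩ := exists_dotProduct_ne_zero (sub_ne_zero.2 hs)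
  refine projOf_mul_projOf_eq_zero (stabChar a b h s) (stabChar a b h s') (g := g) (h := g)
    (c := chi p (g ⬝ᵥ (s - s'))) (fun h => hg ((chi_eq_one_iff _).1 h)) ?_
  rw [stabChar_apply, stabChar_apply, smul_smul, ← AddChar.map_add_eq_mul]
  congr 2
  rw [dotProduct_sub, dotProduct_comm g s, dotProduct_comm g s']
  ring

end Entangled

/-! ### Classification of the entangled stabilizer states -/

section Classification

variable {p : ℕ} [Fact p.Prime]

theorem exists_symp_ne_zero {v : ZMod p × ZMod p} (hv : v ≠ 0) : ∃ w, symp v w ≠ 0 := by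
  by_contra h
  push Not at h
  refine hv (Prod.ext ?_ ?_)
  · simpa [symp] using h (0, 1)
  · simpa [symp] using h (1, 0)

/-- The phase space labels of a stabilizer group form an isotropic subspace isomorphic to it. -/
theorem exists_label_map (W : AddChar (Fin 2 → ZMod p) (Op p 2)) (hW : ∀ g, IsWeyl (W g))
    (htr : ∀ g, g ≠ 0 → (W g).trace = 0) :
    ∃ L : (Fin 2 → ZMod p) →ₗ[ZMod p] (ZMod p × ZMod p) × (ZMod p × ZMod p),
      (∀ g, ∃ c : ℂ, c ≠ 0 ∧ W g = c • disp2 (L g)) ∧ (∀ g h, symp2 (L g) (L h) = 0) ∧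
        ∀ g, L g = 0 → g = 0 := by
  choose c hc φ hφ using fun g => (hW g).exists_disp2
  have hadd : ∀ g h, φ (g + h) = φ g + φ h := by
    intro g h
    obtain ⟨d, hd, hd'⟩ := exists_disp2_mul (φ g) (φ h)
    refine disp2_label_unique (hc (g + h)) (d := c g * c h * d) ?_
    rw [← hφ, AddChar.map_add_eq_mul, hφ g, hφ h, smul_mul_smul_comm, hd', smul_smul]
  let L : (Fin 2 → ZMod p) →+ (ZMod p × ZMod p) × (ZMod p × ZMod p) := AddMonoidHom.mk' φ hadd
  refine ⟨AddMonoidHom.toZModLinearMap p L, fun g => ⟨c g, hc g, hφ g⟩, fun g h => ?_, fun g hg => ?_⟩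
  · change symp2 (φ g) (φ h) = 0
    have h1 : W g * W h = W h * W g := by
      rw [← AddChar.map_add_eq_mul, add_comm, AddChar.map_add_eq_mul]
    rw [hφ g, hφ h, smul_mul_smul_comm, smul_mul_smul_comm, disp2_mul_comm, smul_smul] at h1
    obtain ⟨d, hd, hd'⟩ := exists_disp2_mul (φ h) (φ g)
    have h2 : disp2 (φ h) * disp2 (φ g) ≠ 0 := by
      rw [hd']
      refine smul_ne_zero hd fun h0 => ?_
      have := disp2_pow_p (φ h + φ g)
      rw [h0, zero_pow (Fact.out : p.Prime).ne_zero] at this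
      exact zero_ne_one this
    have h3 := smul_left_injective ℂ h2 h1
    rw [mul_comm (c h)] at h3
    exact (chi_eq_one_iff _).1
      (mul_left_cancel₀ (mul_ne_zero (hc g) (hc h)) (h3.trans (mul_one _).symm))
  · change φ g = 0 at hg
    by_contra h0
    have h1 := htr g h0
    rw [hφ g, hg, disp2, Prod.fst_zero, Prod.snd_zero, disp_zero, tensorPair_one,
      Matrix.trace_smul, Matrix.trace_one, smul_eq_mul] at h1
    exact mul_ne_zero (hc g) (Nat.cast_ne_zero.2 Fintype.card_ne_zero) h1

theorem bijective_smul_add_smul {u v : Fin 2 → ZMod p}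
    (h : ∀ a b : ZMod p, a • u + b • v = 0 → a = 0 ∧ b = 0) :
    Function.Bijective fun g : Fin 2 → ZMod p => g 0 • u + g 1 • v := by
  rw [← Finite.injective_iff_bijective]
  intro g g' hg
  have h1 := h (g 0 - g' 0) (g 1 - g' 1) (by
    have : g 0 • u + g 1 • v = g' 0 • u + g' 1 • v := hg
    rw [sub_smul, sub_smul, sub_add_sub_comm, this, sub_self])
  ext i
  fin_cases i
  · exact sub_eq_zero.1 h1.1
  · exact sub_eq_zero.1 h1.2

theorem sum_tensorPair_pow (M N : Op1 p) :
    ∑ g : Fin 2 → ZMod p, tensorPair (M ^ (g 0).val) (N ^ (g 1).val) =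
      tensorPair (∑ a : ZMod p, M ^ a.val) (∑ a : ZMod p, N ^ a.val) := by
  have h := tensor_sum (p := p) (n := 2) (fun i (a : ZMod p) => ![M ^ a.val, N ^ a.val] i)
  have h1 : (fun i : Fin 2 => ∑ a : ZMod p, ![M ^ a.val, N ^ a.val] i) =
      ![∑ a : ZMod p, M ^ a.val, ∑ a : ZMod p, N ^ a.val] := by
    funext i
    fin_cases i <;> rfl
  rw [h1] at h
  rw [tensorPair, h]
  refine Finset.sum_congr rfl fun g _ => ?_
  rw [tensorPair]
  congr 1
  ext i : 1
  fin_cases i <;> rfl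

/-- A two-qudit stabilizer projector is either a tensor product, or its stabilizer group consists of
multiples of the operators `D_u ⊗ D_{F u}` for some `F` of determinant `-1`. -/
theorem exists_entChar_of_mem_stabilizerProjectors {P : Op p 2} (hP : P ∈ stabilizerProjectors p 2)
    (hent : ¬ ∃ M N : Op1 p, P = tensorPair M N) :
    ∃ (F : EntLabel p) (s : Fin 2 → ZMod p), P = projOf (entChar F s) := by
  obtain ⟨W, hW, htr, rfl⟩ := exists_char_of_mem_stabilizerProjectors hP
  obtain ⟨L, hL, hiso, hinj⟩ := exists_label_map W hW htr
  by_cases hα : Function.Injective fun g => (L g).1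
  · -- the stabilizer group is a graph over the phase space of the first qudit
    have hsurj : Function.Surjective fun g => (L g).1 := by
      refine ((Fintype.bijective_iff_injective_and_card _).2 ⟨hα, ?_⟩).2
      simp [ZMod.card, sq]
    obtain ⟨u, hu⟩ := hsurj (1, 0)
    obtain ⟨v, hv⟩ := hsurj (0, 1)
    simp only at hu hv
    obtain ⟨c, hc, hWu⟩ := hL u
    obtain ⟨d, hd, hWv⟩ := hL v
    have hroot : ∀ {e : ℂ} {g : Fin 2 → ZMod p}, W g = e • disp2 (L g) → e ^ p = 1 := by
      intro e g hg
      have h1 : W g ^ p = 1 := by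
        rw [← AddChar.map_nsmul_eq_pow]
        have : p • g = 0 := by ext i; simp
        rw [this, AddChar.map_zero_eq_one]
      rw [hg, smul_pow, disp2_pow_p] at h1
      have h2 := congrFun (congrFun h1 0) 0
      simpa using h2
    obtain ⟨a, ha⟩ := exists_chi_of_pow_eq_one (hroot hWu)
    obtain ⟨b, hb⟩ := exists_chi_of_pow_eq_one (hroot hWv)
    have hF : symp (L u).2 (L v).2 = 1 := by
      have h1 := hiso u v
      rw [symp2, hu, hv] at h1
      simp only [symp] at h1 ⊢
      linear_combination h1
    refine ⟨⟨((L u).2, (L v).2), hF⟩, ![a, b], ?_⟩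
    have hbij : Function.Bijective fun g : Fin 2 → ZMod p => g 0 • u + g 1 • v := by
      refine bijective_smul_add_smul fun x y hxy => ?_
      have h1 := congrArg (fun g => (L g).1) hxy
      simp only [map_add, map_smul, map_zero, Prod.fst_add, Prod.smul_fst, hu, hv] at h1
      simpa [Prod.ext_iff] using h1
    refine projOf_congr W _ (Equiv.ofBijective _ hbij) fun g => ?_
    have h1 : L u = ((1, 0), (L u).2) := Prod.ext hu rfl
    have h2 : L v = ((0, 1), (L v).2) := Prod.ext hv rfl
    change pairChar _ _ _ _ _ g = W (g 0 • u + g 1 • v)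
    rw [AddChar.map_add_eq_mul, map_smul_eq_pow, map_smul_eq_pow, pairChar_apply, hWu, hWv, ha, hb,
      ← h1, ← h2]
    rfl
  · -- the stabilizer group contains an operator `1 ⊗ D_v`, and then also some `D_w ⊗ 1`
    exfalso
    have hker : ∀ q : (ZMod p × ZMod p) × (ZMod p × ZMod p) →ₗ[ZMod p] ZMod p × ZMod p,
        ¬ Function.Injective (fun g => q (L g)) → ∃ g, g ≠ 0 ∧ q (L g) = 0 := by
      intro q hq
      by_contra h
      push Not at h
      refine hq fun g g' hg => ?_
      by_contra hne
      refine h (g - g') (sub_ne_zero.2 hne) ?_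
      have hg' : q (L g) = q (L g') := hg
      rw [map_sub, map_sub, hg', sub_self]
    obtain ⟨u, hu0, hu⟩ := hker (LinearMap.fst _ _ _) hα
    have hu : (L u).1 = 0 := hu
    have hv0 : (L u).2 ≠ 0 := fun h => hu0 (hinj u (Prod.ext hu h))
    obtain ⟨v, hv0', hv⟩ := hker (LinearMap.snd _ _ _) (by
      intro hβ
      have hsurj : Function.Surjective fun g => (L g).2 := by
        refine ((Fintype.bijective_iff_injective_and_card _).2 ⟨hβ, ?_⟩).2
        simp [ZMod.card, sq]
      obtain ⟨w, hw⟩ := exists_symp_ne_zero hv0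
      obtain ⟨g, hg⟩ := hsurj w
      have h1 := hiso u g
      simp only at hg
      rw [symp2, hu, hg] at h1
      exact hw (by simpa [symp] using h1))
    have hv : (L v).2 = 0 := hv
    obtain ⟨c, hc, hWu⟩ := hL u
    obtain ⟨d, hd, hWv⟩ := hL v
    have hbij : Function.Bijective fun g : Fin 2 → ZMod p => g 0 • v + g 1 • u := by
      refine bijective_smul_add_smul fun x y hxy => ?_
      have h1 := congrArg (fun g => (L g).2) hxy
      simp only [map_add, map_smul, map_zero, Prod.snd_add, Prod.smul_snd, hv, smul_zero,
        zero_add, Prod.snd_zero] at h1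
      have hy := (smul_eq_zero.1 h1).resolve_right hv0
      rw [hy, zero_smul, add_zero] at hxy
      exact ⟨(smul_eq_zero.1 hxy).resolve_right hv0', hy⟩
    have hWv' : W v = tensorPair (d • disp (L v).1) 1 := by
      rw [hWv, disp2, hv, disp_zero, tensorPair_smul_left]
    have hWu' : W u = tensorPair 1 (c • disp (L u).2) := by
      rw [hWu, disp2, hu, disp_zero, tensorPair_smul_right]
    refine hent ⟨(Fintype.card (Fin 2 → ZMod p) : ℂ)⁻¹ •
      ∑ a : ZMod p, (d • disp (L v).1) ^ a.val, ∑ a : ZMod p, (c • disp (L u).2) ^ a.val, ?_⟩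
    rw [tensorPair_smul_left, ← sum_tensorPair_pow, projOf,
      ← (Equiv.ofBijective _ hbij).sum_comp]
    congr 1
    refine Finset.sum_congr rfl fun g _ => ?_
    change W (g 0 • v + g 1 • u) = _
    rw [AddChar.map_add_eq_mul, map_smul_eq_pow, map_smul_eq_pow, hWv', hWu', tensorPair_pow,
      tensorPair_pow, tensorPair_mul, one_pow, one_pow, one_mul, mul_one]

theorem entangledProjectors_eq :
    entangledProjectors p =
      Set.range fun q : EntLabel p × (Fin 2 → ZMod p) => projOf (entChar q.1 q.2) := by
  ext P
  constructor
  · rintro ⟨h1, h2⟩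
    obtain ⟨F, s, rfl⟩ := exists_entChar_of_mem_stabilizerProjectors h1 h2
    exact ⟨(F, s), rfl⟩
  · rintro ⟨⟨F, s⟩, rfl⟩
    exact ⟨projOf_entChar_mem F s, fun ⟨M, N, h⟩ => projOf_entChar_ne_tensor F s M N h⟩

/-- There are `p (p ^ 2 - 1)` linear maps of determinant `-1`. -/
theorem card_entLabel : Fintype.card (EntLabel p) = p ^ 3 - p := by
  have hp := (Fact.out : p.Prime).pos
  -- for `f ≠ 0`, the solutions `g` of `[f, g] = 1` form a line
  have h1 : ∀ f : ZMod p × ZMod p,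
      Fintype.card {g : ZMod p × ZMod p // symp f g = 1} = if f = 0 then 0 else p := by
    intro f
    split_ifs with hf
    · subst hf
      rw [Fintype.card_eq_zero_iff]
      refine ⟨fun g => ?_⟩
      have := g.2
      simp [symp] at this
    · obtain ⟨w, hw⟩ := exists_symp_ne_zero hf
      conv_rhs => rw [← ZMod.card p]
      refine Fintype.card_congr (Equiv.ofBijective
        (fun t : ZMod p => (⟨(symp f w)⁻¹ • w + t • f, ?_⟩ :
          {g : ZMod p × ZMod p // symp f g = 1})) ⟨?_, ?_⟩).symm
      · have h : symp f ((symp f w)⁻¹ • w + t • f) = (symp f w)⁻¹ * symp f w := by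
          simp [symp]; ring
        rw [h, inv_mul_cancel₀ hw]
      · intro t t' h
        have h' := add_left_cancel (Subtype.mk.inj h)
        exact smul_left_injective _ hf h'
      · rintro ⟨g, hg⟩
        refine ⟨symp g w * (symp f w)⁻¹, Subtype.ext ?_⟩
        change (symp f w)⁻¹ • w + (symp g w * (symp f w)⁻¹) • f = g
        refine (smul_right_injective _ hw) ?_
        ext
        · simp only [Prod.smul_fst, Prod.fst_add, smul_eq_mul]
          field_simp
          simp only [symp] at hg ⊢
          linear_combination -w.1 * hg
        · simp only [Prod.smul_snd, Prod.snd_add, smul_eq_mul]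
          field_simp
          simp only [symp] at hg ⊢
          linear_combination -w.2 * hg
  have h2 : Fintype.card (EntLabel p) =
      Fintype.card (Σ f : ZMod p × ZMod p, {g : ZMod p × ZMod p // symp f g = 1}) :=
    Fintype.card_congr
      { toFun := fun F => ⟨F.1.1, F.1.2, F.2⟩
        invFun := fun F => ⟨(F.1, F.2.1), F.2.2⟩
        left_inv := fun _ => rfl
        right_inv := fun _ => rfl }
  rw [h2, Fintype.card_sigma]
  simp_rw [h1]
  rw [Finset.sum_ite, Finset.sum_const_zero, zero_add, Finset.sum_const, smul_eq_mul]
  have h3 : (Finset.univ.filter fun f : ZMod p × ZMod p => ¬ f = 0).card = p ^ 2 - 1 := by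
    rw [Finset.filter_ne' Finset.univ (0 : ZMod p × ZMod p), Finset.card_erase_of_mem
      (Finset.mem_univ _), Finset.card_univ, Fintype.card_prod, ZMod.card, sq]
  rw [h3, Nat.sub_mul, one_mul]
  ring_nf

end Classification

/-! ### The projectors of the construction -/

section TestProjectors

variable {p : ℕ} [Fact p.Prime]

/-- The phase space label of the `j`-th operator of the list `D_{0,1}, D_{1,0}, …, D_{1,p-1}`. -/
def mubLabel (j : Option (ZMod p)) : ZMod p × ZMod p := j.elim (0, 1) fun k => (1, k)

theorem mubOperator_eq (j : Option (ZMod p)) : mubOperator p j = disp (mubLabel j) := by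
  cases j <;> rfl

theorem symp_mubLabel_eq_zero_iff (i j : Option (ZMod p)) :
    symp (mubLabel i) (mubLabel j) = 0 ↔ i = j := by
  cases i <;> cases j <;> simp [mubLabel, symp, sub_eq_zero]

theorem sum_range_eq_sum_val {M : Type*} [AddCommMonoid M] (f : ℕ → M) :
    ∑ m ∈ Finset.range p, f m = ∑ a : ZMod p, f a.val := by
  refine Finset.sum_nbij' (fun m => (m : ZMod p)) (fun a => a.val) ?_ ?_ ?_ ?_ ?_
  · simp
  · intro a _
    exact Finset.mem_range.2 (ZMod.val_lt a)
  · intro m hm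
    exact ZMod.val_cast_of_lt (Finset.mem_range.1 hm)
  · intro a _
    exact ZMod.natCast_zmod_val a
  · intro m hm
    rw [ZMod.val_cast_of_lt (Finset.mem_range.1 hm)]

theorem mubProjector_eq (j : Option (ZMod p)) (s : ZMod p) :
    mubProjector p j s =
      (p : ℂ)⁻¹ • ∑ a : ZMod p, (chi p (-s) • disp (mubLabel j)) ^ a.val := by
  rw [mubProjector, sum_range_eq_sum_val
    (fun m => (omega p ^ (s.val * m))⁻¹ • mubOperator p j ^ m), mubOperator_eq]
  congr 1
  refine Finset.sum_congr rfl fun a _ => ?_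
  rw [smul_pow, chi_pow_val, omega_pow_eq_chi, ← AddChar.map_neg_eq_inv]
  congr 2
  push_cast
  rw [ZMod.natCast_zmod_val, ZMod.natCast_zmod_val]
  ring

theorem disp_clock_pow (m : ZMod p) : disp ((0, 1) : ZMod p × ZMod p) ^ m.val = weyl1 0 m := by
  rw [disp, displacement_eq, ZMod.val_zero, zero_mul, pow_zero, one_smul, weyl1_pow]
  simp

theorem single_eq_sum_clock (k : ZMod p) :
    (Matrix.single k k 1 : Op1 p) =
      (p : ℂ)⁻¹ • ∑ a : ZMod p, (chi p (-k) • disp ((0, 1) : ZMod p × ZMod p)) ^ a.val := by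
  have hp : (p : ℂ) ≠ 0 := Nat.cast_ne_zero.2 (NeZero.ne p)
  simp_rw [smul_pow, disp_clock_pow, chi_pow_val]
  ext i j
  rw [Matrix.smul_apply, Matrix.sum_apply]
  by_cases h : i = j
  · subst h
    have h1 : ∀ a : ZMod p, (chi p (a * -k) • weyl1 (0 : ZMod p) a) i i = chi p ((i - k) * a) := by
      intro a
      simp only [weyl1, add_zero, Matrix.smul_apply, Matrix.of_apply, if_true, smul_eq_mul]
      rw [← AddChar.map_add_eq_mul]
      congr 1
      ring
    simp_rw [h1]
    rw [sum_chi_mul]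
    by_cases hk : i = k
    · subst hk
      simp [hp]
    · rw [if_neg (sub_ne_zero.2 hk), smul_zero, Matrix.single_apply_of_ne]
      tauto
  · rw [Matrix.single_apply_of_ne, Finset.sum_eq_zero, smul_zero]
    · intro z _
      simp [weyl1, h]
    · rintro ⟨rfl, rfl⟩
      exact h rfl

/-- The labels of the joint eigenbases occurring in the construction: the bases
`Π_j ^ s ⊗ |k⟩⟨k|`, and the bases of entangled stabilizer states. -/
abbrev TestClass (p : ℕ) := Option (ZMod p) ⊕ EntLabel p

/-- The first generator (up to a phase) of the stabilizer groups of the states in a basis. -/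
def classFst : TestClass p → (ZMod p × ZMod p) × (ZMod p × ZMod p)
  | .inl j => (mubLabel j, 0)
  | .inr F => ((1, 0), F.1.1)

/-- The second generator (up to a phase) of the stabilizer groups of the states in a basis. -/
def classSnd : TestClass p → (ZMod p × ZMod p) × (ZMod p × ZMod p)
  | .inl _ => (0, (0, 1))
  | .inr F => ((0, 1), F.1.2)

theorem symp2_class (c : TestClass p) : symp2 (classFst c) (classSnd c) = 0 := by
  cases c with
  | inl j => simp [classFst, classSnd, symp2, symp]
  | inr F => exact symp2_entLabel F

/-- The stabilizer group of the projector `testProj c s`. -/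
abbrev testChar (c : TestClass p) (s : Fin 2 → ZMod p) : AddChar (Fin 2 → ZMod p) (Op p 2) :=
  stabChar (classFst c) (classSnd c) (symp2_class c) s

/-- The elements of the joint eigenbasis labelled by `c`. -/
def testProj (c : TestClass p) (s : Fin 2 → ZMod p) : Op p 2 := projOf (testChar c s)

theorem testProj_inl (j : Option (ZMod p)) (s : Fin 2 → ZMod p) :
    testProj (.inl j) s = tensorPair (mubProjector p j (-s 0)) (Matrix.single (-s 1) (-s 1) 1) := by
  have h : ∀ g : Fin 2 → ZMod p, testChar (.inl j) s g =
      tensorPair ((chi p (s 0) • disp (mubLabel j)) ^ (g 0).val)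
        ((chi p (s 1) • disp ((0, 1) : ZMod p × ZMod p)) ^ (g 1).val) := by
    intro g
    rw [testChar, stabChar, pairChar_apply, classFst, classSnd, disp2, disp2, disp_zero,
      ← tensorPair_smul_left, ← tensorPair_smul_right, tensorPair_pow, tensorPair_pow,
      tensorPair_mul, one_pow, one_pow, one_mul, mul_one]
  rw [testProj, projOf]
  simp_rw [h]
  rw [sum_tensorPair_pow, mubProjector_eq, single_eq_sum_clock, tensorPair_smul_left,
    tensorPair_smul_right, smul_smul, neg_neg, neg_neg]
  congr 1
  simp [sq]

theorem testProj_mem (c : TestClass p) (s : Fin 2 → ZMod p) :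
    testProj c s ∈ stabilizerProjectors p 2 := by
  cases c with
  | inl j =>
    cases j with
    | none =>
      refine projOf_stabChar_mem (c := ((1, 0), 0)) (d := (0, (1, 0))) (symp2_class _)
        ?_ ?_ ?_ ?_ ?_ s <;> simp [symp2, symp, classFst, classSnd, mubLabel]
    | some k =>
      refine projOf_stabChar_mem (c := ((0, -1), 0)) (d := (0, (1, 0))) (symp2_class _)
        ?_ ?_ ?_ ?_ ?_ s <;> simp [symp2, symp, classFst, classSnd, mubLabel]
  | inr F => exact projOf_entChar_mem F s

theorem testProj_ne_zero (c : TestClass p) (s : Fin 2 → ZMod p) : testProj c s ≠ 0 :=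
  ne_zero_of_mem_stabilizerProjectors (testProj_mem c s)

theorem testProj_mul_eq_zero (c : TestClass p) {s s' : Fin 2 → ZMod p} (h : s ≠ s') :
    testProj c s * testProj c s' = 0 :=
  projOf_stabChar_mul_eq_zero _ _ _ h

theorem sum_testProj (c : TestClass p) : ∑ s, testProj c s = 1 := sum_projOf_stabChar _ _ _

theorem testProj_injective {c c' : TestClass p} {s s' : Fin 2 → ZMod p}
    (h : testProj c s = testProj c' s') : c = c' ∧ s = s' := by
  have hcc : c = c' := by
    cases c with
    | inl j =>
      cases c' with
      | inl j' =>
        have h1 := disp2_fst_mul_projOf _ _ (symp2_class (.inl j)) s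
        have h2 := disp2_fst_mul_projOf _ _ (symp2_class (.inl j')) s'
        change _ * testProj _ _ = _ • testProj _ _ at h1 h2
        rw [← h] at h2
        have h3 := symp2_eq_zero_of_eigen (testProj_ne_zero _ _) h1 h2
        rw [(symp_mubLabel_eq_zero_iff j j').1 (by simpa [symp2, classFst, symp] using h3)]
      | inr F =>
        rw [testProj_inl] at h
        exact absurd h.symm (projOf_entChar_ne_tensor F s' _ _)
    | inr F =>
      cases c' with
      | inl j =>
        rw [testProj_inl] at h
        exact absurd h (projOf_entChar_ne_tensor F s _ _)
      | inr F' => rw [(projOf_entChar_injective h).1]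
  subst hcc
  refine ⟨rfl, ?_⟩
  by_contra hs
  have h1 := testProj_mul_eq_zero c hs
  rw [← h, mul_self_of_mem_stabilizerProjectors (testProj_mem c s)] at h1
  exact testProj_ne_zero c s h1

theorem card_testClass : Fintype.card (TestClass p) = p ^ 3 + 1 := by
  rw [Fintype.card_sum, Fintype.card_option, ZMod.card, card_entLabel]
  have : p ≤ p ^ 3 := Nat.le_self_pow (by norm_num) p
  omega

/-- The labels of the elements of `testSet p r`. In the separable bases the elements with
`s = r j` are left out; note that `testProj` labels eigenvectors by the phases which make the
generators of their stabilizer groups, whence the sign. -/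
abbrev TestLabel (r : Option (ZMod p) → ZMod p) :=
  {q : TestClass p × (Fin 2 → ZMod p) // ∀ j, q.1 = .inl j → q.2 0 ≠ -r j}

theorem mem_testSet_iff (r : Option (ZMod p) → ZMod p) (P : Op p 2) :
    P ∈ testSet p r ↔ ∃ q : TestLabel r, testProj q.1.1 q.1.2 = P := by
  rw [testSet, Set.Finite.mem_toFinset, Set.mem_union, entangledProjectors_eq]
  constructor
  · rintro (⟨j, s, k, hs, rfl⟩ | ⟨⟨F, s⟩, rfl⟩)
    · refine ⟨⟨(.inl j, ![-s, -k]), ?_⟩, ?_⟩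
      · intro j' hj'
        obtain rfl := Sum.inl.inj hj'
        simpa using hs
      · rw [testProj_inl]
        simp
    · exact ⟨⟨(.inr F, s), fun j hj => by simp at hj⟩, rfl⟩
  · rintro ⟨⟨⟨c | F, s⟩, hq⟩, rfl⟩
    · left
      refine ⟨c, -s 0, -s 1, ?_, testProj_inl c s⟩
      have := hq c rfl
      exact fun h => this (by rw [← h, neg_neg])
    · exact Or.inr ⟨(F, s), rfl⟩

/-- The bijection between labels and elements of the set of projectors. -/
def testEquiv (r : Option (ZMod p) → ZMod p) : TestLabel r ≃ {P // P ∈ testSet p r} :=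
  Equiv.ofBijective
    (fun q => ⟨testProj q.1.1 q.1.2, (mem_testSet_iff r _).2 ⟨q, rfl⟩⟩)
    ⟨fun q q' h => by
      have h1 := testProj_injective (Subtype.mk.inj h)
      exact Subtype.ext (Prod.ext h1.1 h1.2),
    fun P => by
      obtain ⟨q, hq⟩ := (mem_testSet_iff r P.1).1 P.2
      exact ⟨q, Subtype.ext hq⟩⟩

theorem testEquiv_apply (r : Option (ZMod p) → ZMod p) (q : TestLabel r) :
    (testEquiv r q : Op p 2) = testProj q.1.1 q.1.2 := rfl

theorem testSet_subset (r : Option (ZMod p) → ZMod p) :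
    (testSet p r : Set (Op p 2)) ⊆ stabilizerProjectors p 2 := by
  intro P hP
  obtain ⟨q, rfl⟩ := (mem_testSet_iff r P).1 hP
  exact testProj_mem _ _

theorem sum_testProj_inl_fst (j : Option (ZMod p)) (t : ZMod p) :
    ∑ s : Fin 2 → ZMod p, (if s 0 = -t then testProj (.inl j) s else 0) =
      tensorPair (mubProjector p j t) 1 := by
  have h1 : (1 : Op1 p) = ∑ k : ZMod p, Matrix.single k k 1 := by
    ext a b
    rw [Matrix.sum_apply, Matrix.one_apply]
    simp only [Matrix.single_apply, ite_and, Finset.sum_ite_eq', Finset.mem_univ, if_true]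
  rw [h1, tensorPair_sum_right, ← Finset.sum_filter]
  refine Finset.sum_nbij' (fun s => -s 1) (fun k => ![-t, -k]) ?_ ?_ ?_ ?_ ?_
  · simp
  · simp
  · intro s hs
    have := (Finset.mem_filter.1 hs).2
    ext i
    fin_cases i
    · exact this.symm
    · simp
  · simp
  · intro s hs
    rw [testProj_inl, (Finset.mem_filter.1 hs).2, neg_neg]

/-- The entangled projectors form `p ^ 3 - p` orthonormal bases, and the separable ones are those
complementary to the projectors `Π_j ^ (r_j) ⊗ 1`. -/
theorem witness_eq (r : Option (ZMod p) → ZMod p) :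
    witness p r = tensorPair ((p : ℂ) ^ 3 • 1 - facetOperator p r) 1 := by
  have h1 : witness p r = ∑ q : TestLabel r, testProj q.1.1 q.1.2 := by
    rw [witness, ← Finset.sum_coe_sort]
    exact ((testEquiv r).sum_comp (fun P => (P : Op p 2))).symm
  have h2 : ∑ q : TestLabel r, testProj q.1.1 q.1.2 =
      ∑ q : TestClass p × (Fin 2 → ZMod p),
        if ∀ j, q.1 = .inl j → q.2 0 ≠ -r j then testProj q.1 q.2 else 0 := by
    rw [← Finset.sum_filter]
    exact (Finset.sum_subtype
      (Finset.univ.filter fun q : TestClass p × (Fin 2 → ZMod p) =>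
        ∀ j, q.1 = .inl j → q.2 0 ≠ -r j)
      (fun q => by rw [Finset.mem_filter, and_iff_right (Finset.mem_univ q)])
      (fun q => testProj q.1 q.2)).symm
  have hl : ∀ j : Option (ZMod p), (∑ s : Fin 2 → ZMod p,
      if ∀ j', (Sum.inl j : TestClass p) = .inl j' → s 0 ≠ -r j' then testProj (.inl j) s else 0) =
        1 - tensorPair (mubProjector p j (r j)) 1 := by
    intro j
    rw [← sum_testProj (.inl j), ← sum_testProj_inl_fst, ← Finset.sum_sub_distrib]
    refine Finset.sum_congr rfl fun s _ => ?_
    by_cases hs : s 0 = -r j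
    · rw [if_neg (fun h => h j rfl hs), if_pos hs, sub_self]
    · rw [if_pos, if_neg hs, sub_zero]
      intro j' hj'
      obtain rfl := Sum.inl.inj hj'
      exact hs
  have hr : ∀ F : EntLabel p, (∑ s : Fin 2 → ZMod p,
      if ∀ j', (Sum.inr F : TestClass p) = .inl j' → s 0 ≠ -r j' then testProj (.inr F) s else 0) =
        1 := by
    intro F
    rw [← sum_testProj (.inr F)]
    refine Finset.sum_congr rfl fun s _ => if_pos ?_
    intro j hj
    simp at hj
  have hp : p ≤ p ^ 3 := Nat.le_self_pow (by norm_num) p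
  rw [h1, h2, Fintype.sum_prod_type, Fintype.sum_sum_type]
  simp only [hl, hr]
  rw [Finset.sum_sub_distrib, ← tensorPair_sum_left, Finset.sum_const, Finset.sum_const,
    Finset.card_univ, Finset.card_univ, card_entLabel, Fintype.card_option, ZMod.card,
    facetOperator, sub_add_eq_sub_sub, tensorPair_sub_left, tensorPair_sub_left,
    tensorPair_smul_left]
  have h3 : tensorPair (-1 : Op1 p) 1 = -1 := by
    rw [← neg_one_smul ℂ (1 : Op1 p), tensorPair_smul_left, tensorPair_one, neg_one_smul]
  rw [h3, tensorPair_one, ← Nat.cast_smul_eq_nsmul ℂ, ← Nat.cast_smul_eq_nsmul ℂ]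
  push_cast [Nat.cast_sub hp]
  module

end TestProjectors

/-! ### Phase-point operators of one qudit -/

section PhasePoint

variable {p : ℕ} [Fact p.Prime]

theorem mubProjector_none (k : ZMod p) : mubProjector p none k = Matrix.single k k 1 := by
  rw [mubProjector_eq, single_eq_sum_clock]
  rfl

theorem mubProjector_some_apply (hp : p ≠ 2) (k s i l : ZMod p) :
    mubProjector p (some k) s i l =
      (p : ℂ)⁻¹ * chi p (-s * (i - l) + k * ((i - l) * (2⁻¹ * (i + l)))) := by
  have h2 := two_ne_zero_zmod hp
  rw [mubProjector_eq, Matrix.smul_apply, Matrix.sum_apply, Finset.sum_eq_single (i - l)]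
  · rw [smul_eq_mul]
    congr 1
    rw [smul_pow, chi_pow_val, disp_pow_of_odd hp, ZMod.natCast_zmod_val, disp_eq_of_odd hp]
    simp only [mubLabel, Option.elim_some, Prod.smul_mk, smul_eq_mul, mul_one, Matrix.smul_apply,
      weyl1, Matrix.of_apply, add_sub_cancel, if_true, ← AddChar.map_add_eq_mul]
    congr 1
    field_simp
    ring
  · intro a _ ha
    rw [smul_pow, disp_pow_of_odd hp, ZMod.natCast_zmod_val, disp_eq_of_odd hp]
    simp only [mubLabel, Option.elim_some, Prod.smul_mk, smul_eq_mul, mul_one, Matrix.smul_apply,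
      weyl1, Matrix.of_apply]
    rw [if_neg, mul_zero, mul_zero]
    rintro rfl
    exact ha (by ring)
  · intro h
    exact absurd (Finset.mem_univ _) h

/-- The phase-point operators are displaced parity operators. -/
theorem facetOperator_phaseVector_apply (hp : p ≠ 2) (x z i l : ZMod p) :
    facetOperator p (phaseVector x z) i l = if i + l = 2 * x then chi p (z * (i - l)) else 0 := by
  have h2 := two_ne_zero_zmod hp
  have hp0 : (p : ℂ) ≠ 0 := Nat.cast_ne_zero.2 (NeZero.ne p)
  rw [facetOperator, Matrix.add_apply, Matrix.sum_apply, Fintype.sum_option, mubProjector_none]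
  simp_rw [mubProjector_some_apply hp]
  rw [← Finset.mul_sum]
  have h3 : ∀ k : ZMod p, chi p (-(phaseVector x z (some k)) * (i - l) +
      k * ((i - l) * (2⁻¹ * (i + l)))) =
      chi p (z * (i - l)) * chi p (((i - l) * (2⁻¹ * (i + l) - x)) * k) := by
    intro k
    rw [← AddChar.map_add_eq_mul]
    congr 1
    simp only [phaseVector]
    ring
  simp_rw [h3]
  rw [← Finset.mul_sum, sum_chi_mul, Matrix.neg_apply, Matrix.one_apply,
    show phaseVector x z none = x from rfl, Matrix.single_apply]
  by_cases hil : i = l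
  · subst hil
    have h4 : i + i = 2 * x ↔ x = i := by
      rw [← two_mul, mul_right_inj' h2, eq_comm]
    simp [h4, hp0]
  · have h4 : (i - l) * (2⁻¹ * (i + l) - x) = 0 ↔ i + l = 2 * x := by
      rw [mul_eq_zero, or_iff_right (sub_ne_zero.2 hil), sub_eq_zero, inv_mul_eq_iff_eq_mul₀ h2]
    have h5 : ¬ (x = i ∧ x = l) := fun h => hil (h.1.symm.trans h.2)
    simp only [h4, if_neg hil, if_neg h5, neg_zero, zero_add]
    split_ifs with h6
    · rw [mul_comm (chi p _), inv_mul_cancel_left₀ hp0]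
    · simp

theorem trace_disp_mul_facetOperator (hp : p ≠ 2) (x z : ZMod p) (u : ZMod p × ZMod p) :
    (disp u * facetOperator p (phaseVector x z)).trace = chi p (x * u.2 - z * u.1) := by
  have h2 := two_ne_zero_zmod hp
  rw [disp_eq_of_odd hp, Matrix.trace, Finset.sum_eq_single (x + 2⁻¹ * u.1)]
  · rw [Matrix.diag_apply, Matrix.mul_apply, Finset.sum_eq_single (x - 2⁻¹ * u.1)]
    · rw [facetOperator_phaseVector_apply hp, Matrix.smul_apply, weyl1, Matrix.of_apply, if_pos,
        if_pos, smul_eq_mul, ← AddChar.map_add_eq_mul, ← AddChar.map_add_eq_mul]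
      · congr 1
        field_simp
        ring
      · ring
      · field_simp; ring
    · intro b _ hb
      rw [Matrix.smul_apply, weyl1, Matrix.of_apply, if_neg, smul_zero, zero_mul]
      intro h
      refine hb ?_
      have h3 : b = x + 2⁻¹ * u.1 - u.1 := by rw [h]; ring
      rw [h3]
      field_simp
      ring
    · intro h
      exact absurd (Finset.mem_univ _) h
  · intro b _ hb
    rw [Matrix.diag_apply, Matrix.mul_apply]
    refine Finset.sum_eq_zero fun c _ => ?_
    rw [facetOperator_phaseVector_apply hp, Matrix.smul_apply, weyl1, Matrix.of_apply]
    by_cases h3 : b = c + u.1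
    · rw [if_neg (c := c + b = 2 * x), mul_zero]
      intro h4
      refine hb ?_
      have h5 : c = b - u.1 := by rw [h3]; ring
      rw [h5] at h4
      field_simp
      linear_combination h4
    · rw [if_neg h3, smul_zero, zero_mul]
  · intro h
    exact absurd (Finset.mem_univ _) h

end PhasePoint

/-! ### Bounds for graph parameters from covers by cliques -/

section Graph

theorem injOn_of_isIndepSet {V K : Type*} {G : SimpleGraph V} {κ : V → K}
    (hκ : ∀ v w, v ≠ w → κ v = κ w → G.Adj v w) {s : Finset V}
    (hs : G.IsIndepSet (s : Set V)) : Set.InjOn κ s := by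
  intro v hv w hw h
  by_contra hne
  exact hs hv hw hne (hκ v w hne h)

variable {V K : Type*} [Fintype V] [Fintype K] {G : SimpleGraph V} {κ : V → K}

theorem sum_le_card_of_cliqueCover [DecidableEq K] (hκ : ∀ v w, v ≠ w → κ v = κ w → G.Adj v w)
    {w : V → ℝ} (hw : ∀ C : Finset V, G.IsClique (C : Set V) → ∑ i ∈ C, w i ≤ 1) :
    ∑ i, w i ≤ Fintype.card K := by
  rw [← Finset.sum_fiberwise Finset.univ κ w]
  refine (Finset.sum_le_sum (g := fun _ => (1 : ℝ)) fun k _ => hw _ ?_).trans ?_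
  · intro v hv v' hv' hne
    have h1 := (Finset.mem_filter.1 (Finset.mem_coe.1 hv)).2
    have h2 := (Finset.mem_filter.1 (Finset.mem_coe.1 hv')).2
    exact hκ v v' hne (h1.trans h2.symm)
  · simp

/-- In a Gram representation of `B`, the vectors belonging to a clique are orthogonal. -/
theorem sum_sum_le_card_of_cliqueCover [DecidableEq K]
    (hκ : ∀ v w, v ≠ w → κ v = κ w → G.Adj v w) {B : Matrix V V ℝ} (hB : B.PosSemidef)
    (htr : B.trace = 1) (hadj : ∀ i j, G.Adj i j → B i j = 0) :
    ∑ i, ∑ j, B i j ≤ Fintype.card K := by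
  classical
  obtain ⟨m, C, hBC⟩ := Matrix.posSemidef_iff_eq_sum_vecMulVec.1 hB
  have hC : ∀ i j, B i j = ∑ a, C a i * C a j := by
    intro i j
    simp [hBC, Matrix.sum_apply, Matrix.vecMulVec_apply]
  have hsq : ∀ s : Finset V, ∑ i ∈ s, ∑ j ∈ s, B i j = ∑ a, (∑ i ∈ s, C a i) ^ 2 := by
    intro s
    simp_rw [hC, sq, Finset.sum_mul_sum]
    rw [Finset.sum_comm]
    conv_rhs => rw [Finset.sum_comm]
    rw [Finset.sum_comm]
    refine Finset.sum_congr rfl fun i _ => ?_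
    rw [Finset.sum_comm]
  have hfib : ∀ k, ∑ i ∈ Finset.univ.filter (κ · = k), ∑ j ∈ Finset.univ.filter (κ · = k),
      B i j = ∑ i ∈ Finset.univ.filter (κ · = k), B i i := by
    intro k
    refine Finset.sum_congr rfl fun i hi => Finset.sum_eq_single i ?_ (fun h => absurd hi h)
    intro j hj hji
    have h1 := (Finset.mem_filter.1 hi).2
    have h2 := (Finset.mem_filter.1 hj).2
    exact hadj i j (hκ i j hji.symm (h1.trans h2.symm))
  calc ∑ i, ∑ j, B i j = ∑ a, (∑ i, C a i) ^ 2 := hsq Finset.univ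
    _ = ∑ a, (∑ k, ∑ i ∈ Finset.univ.filter (κ · = k), C a i) ^ 2 := by
      refine Finset.sum_congr rfl fun a _ => ?_
      rw [Finset.sum_fiberwise]
    _ ≤ ∑ a, Fintype.card K * ∑ k, (∑ i ∈ Finset.univ.filter (κ · = k), C a i) ^ 2 :=
      Finset.sum_le_sum fun a _ => sq_sum_le_card_mul_sum_sq
    _ = Fintype.card K * ∑ k, ∑ a, (∑ i ∈ Finset.univ.filter (κ · = k), C a i) ^ 2 := by
      rw [← Finset.mul_sum, Finset.sum_comm]
    _ = Fintype.card K * B.trace := by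
      congr 1
      simp_rw [← hsq, hfib]
      rw [Finset.sum_fiberwise]
      rfl
    _ = Fintype.card K := by rw [htr, mul_one]

end Graph

/-! ### The independence number: upper bound -/

section UpperBound

variable {p : ℕ} [Fact p.Prime]

theorem phase_eq_zero_of_mul_ne_zero {c c' : TestClass p} {s s' : Fin 2 → ZMod p}
    (h : testProj c s * testProj c' s' ≠ 0) {g g' : Fin 2 → ZMod p} {k : ZMod p}
    (hk : testChar c s g = chi p k • testChar c' s' g') : k = 0 := by
  by_contra h0
  exact h (projOf_mul_projOf_eq_zero _ _ (fun h1 => h0 ((chi_eq_one_iff k).1 h1)) hk)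

theorem testChar_of_odd (hp : p ≠ 2) (c : TestClass p) (s g : Fin 2 → ZMod p) :
    testChar c s g = chi p (s ⬝ᵥ g) • disp2 (g 0 • classFst c + g 1 • classSnd c) := by
  have h1 : ∀ a b : (ZMod p × ZMod p) × (ZMod p × ZMod p), disp2 a * disp2 b =
      chi p (2⁻¹ * symp2 a b) • disp2 (a + b) := by
    intro a b
    rw [disp2, disp2, tensorPair_mul, disp_mul_of_odd hp, disp_mul_of_odd hp, tensorPair_smul_left,
      tensorPair_smul_right, smul_smul, ← AddChar.map_add_eq_mul, symp2, mul_add]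
    rfl
  have h2 : ∀ (a : (ZMod p × ZMod p) × (ZMod p × ZMod p)) (m : ZMod p),
      disp2 a ^ m.val = disp2 (m • a) := by
    intro a m
    rw [disp2, tensorPair_pow, disp_pow_of_odd hp, disp_pow_of_odd hp, ZMod.natCast_zmod_val]
    rfl
  have h3 : symp2 (g 0 • classFst c) (g 1 • classSnd c) = 0 := by
    have := symp2_class c
    simp only [symp2, symp, Prod.smul_fst, Prod.smul_snd, smul_eq_mul] at this ⊢
    linear_combination g 0 * g 1 * this
  rw [testChar, stabChar_apply, h2, h2, h1, h3, mul_zero, AddChar.map_zero_eq_one, one_smul]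

theorem dotProduct_eq_of_mul_ne_zero (hp : p ≠ 2) {c c' : TestClass p} {s s' : Fin 2 → ZMod p}
    (h : testProj c s * testProj c' s' ≠ 0) (g g' : Fin 2 → ZMod p)
    (hg : g 0 • classFst c + g 1 • classSnd c = g' 0 • classFst c' + g' 1 • classSnd c') :
    s ⬝ᵥ g = s' ⬝ᵥ g' := by
  have h1 : testChar c s g = chi p (s ⬝ᵥ g - s' ⬝ᵥ g') • testChar c' s' g' := by
    rw [testChar_of_odd hp, testChar_of_odd hp, smul_smul, ← AddChar.map_add_eq_mul,
      sub_add_cancel, hg]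
  exact sub_eq_zero.1 (phase_eq_zero_of_mul_ne_zero h h1)

/-- Mermin's square: for two qubits, one cannot choose a state in each of the six entangled bases
such that no two of them are orthogonal. The phases of `D_{1,0} ⊗ D_f` and `D_{0,1} ⊗ D_g` would be
functions of `f` and `g`, and comparing the bases for `(f, g)` and `(g, f)`, where `D_f` and `D_g`
anticommute, would show that the difference of these functions takes three distinct values in `ℤ_2`. -/
theorem not_forall_mul_ne_zero_two (s : TestClass 2 → Fin 2 → ZMod 2)
    (hs : ∀ c c', c ≠ c' → testProj c (s c) * testProj c' (s c') ≠ 0) : False := by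
  have hfst : ∀ F F' : EntLabel 2, F ≠ F' → F.1.1 = F'.1.1 → s (.inr F) 0 = s (.inr F') 0 := by
    intro F F' hne hF
    have h1 : testChar (.inr F) (s (.inr F)) ![1, 0] =
        chi 2 (s (.inr F) 0 - s (.inr F') 0) • testChar (.inr F') (s (.inr F')) ![1, 0] := by
      rw [stabChar_fst, stabChar_fst, smul_smul, ← AddChar.map_add_eq_mul, sub_add_cancel,
        classFst, classFst, hF]
    exact sub_eq_zero.1 (phase_eq_zero_of_mul_ne_zero (hs _ _ (by simpa using hne)) h1)
  have hsnd : ∀ F F' : EntLabel 2, F ≠ F' → F.1.2 = F'.1.2 → s (.inr F) 1 = s (.inr F') 1 := by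
    intro F F' hne hF
    have h1 : testChar (.inr F) (s (.inr F)) ![0, 1] =
        chi 2 (s (.inr F) 1 - s (.inr F') 1) • testChar (.inr F') (s (.inr F')) ![0, 1] := by
      rw [stabChar_snd, stabChar_snd, smul_smul, ← AddChar.map_add_eq_mul, sub_add_cancel,
        classSnd, classSnd, hF]
    exact sub_eq_zero.1 (phase_eq_zero_of_mul_ne_zero (hs _ _ (by simpa using hne)) h1)
  have hswap : ∀ F F' : EntLabel 2, F ≠ F' → F.1.1 = F'.1.2 → F.1.2 = F'.1.1 →
      s (.inr F) 0 + s (.inr F) 1 + 1 = s (.inr F') 0 + s (.inr F') 1 := by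
    intro F F' hne hF hF'
    have h1 : testChar (.inr F) (s (.inr F)) ![1, 1] =
        chi 2 (s (.inr F) 0 + s (.inr F) 1 + 1 - (s (.inr F') 0 + s (.inr F') 1)) •
          testChar (.inr F') (s (.inr F')) ![1, 1] := by
      rw [testChar, testChar, stabChar_apply, stabChar_apply]
      simp only [classFst, classSnd, disp2, Matrix.cons_val_zero, Matrix.cons_val_one,
        ZMod.val_one, pow_one, tensorPair_mul]
      rw [disp_mul_comm F.1.1 F.1.2, F.2, tensorPair_smul_right, smul_smul, smul_smul,
        ← AddChar.map_add_eq_mul, ← AddChar.map_add_eq_mul, hF, hF']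
      congr 2
      simp only [dotProduct, Fin.sum_univ_two, Matrix.cons_val_zero, Matrix.cons_val_one]
      ring
    exact sub_eq_zero.1 (phase_eq_zero_of_mul_ne_zero (hs _ _ (by simpa using hne)) h1)
  let XZ : EntLabel 2 := ⟨((1, 0), (0, 1)), by decide⟩
  let XY : EntLabel 2 := ⟨((1, 0), (1, 1)), by decide⟩
  let ZX : EntLabel 2 := ⟨((0, 1), (1, 0)), by decide⟩
  let ZY : EntLabel 2 := ⟨((0, 1), (1, 1)), by decide⟩
  let YX : EntLabel 2 := ⟨((1, 1), (1, 0)), by decide⟩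
  let YZ : EntLabel 2 := ⟨((1, 1), (0, 1)), by decide⟩
  have e1 := hfst XZ XY (by decide) rfl
  have e2 := hfst ZX ZY (by decide) rfl
  have e3 := hfst YX YZ (by decide) rfl
  have e4 := hsnd XZ YZ (by decide) rfl
  have e5 := hsnd XY ZY (by decide) rfl
  have e6 := hsnd ZX YX (by decide) rfl
  have e7 := hswap XZ ZX (by decide) rfl rfl
  have e8 := hswap XY YX (by decide) rfl rfl
  have e9 := hswap ZY YZ (by decide) rfl rfl
  have : (1 : ZMod 2) = 0 := by
    linear_combination e7 - e8 + e9 - e1 + e2 - e3 - e4 + e5 + e6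
  exact one_ne_zero this

/-- For odd `p`, if mutually nonorthogonal states are chosen in all the bases of the construction,
then the phases chosen for the separable ones depend linearly on the point of the phase space. The
four entangled bases used here map the successive steps of a path from `(0, -k / 2)` to `(1, k / 2)`
in phase space, with the steps `(1 / 2, 0)`, `(0, k)`, `(1 / 2, 0)`, and the direct step
`(1, k)`, to multiples of `(0, 1)`. Bases for adjacent steps share the operators labelled by their
common vertex, and each basis shares those labelled by its step with a separable one. -/
theorem phase_linear_of_odd (hp : p ≠ 2) (s : TestClass p → Fin 2 → ZMod p)
    (hs : ∀ c c', c ≠ c' → testProj c (s c) * testProj c' (s c') ≠ 0) (k : ZMod p) :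
    s (.inl (some k)) 0 = s (.inl (some 0)) 0 + k * s (.inl none) 0 := by
  have h2 := two_ne_zero_zmod hp
  by_cases hk : k = 0
  · subst hk; ring
  have hk1 : ∀ i j : Option (ZMod p), s (.inl i) 1 = s (.inl j) 1 := by
    intro i j
    by_cases hij : i = j
    · rw [hij]
    have := dotProduct_eq_of_mul_ne_zero hp (hs (.inl i) (.inl j) (by simpa using hij)) ![0, 1]
      ![0, 1] (by simp [classSnd])
    simpa [dotProduct, Fin.sum_univ_two] using this
  have key : ∀ (c c' : TestClass p) (g g' : Fin 2 → ZMod p), c ≠ c' →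
      g 0 • classFst c + g 1 • classSnd c = g' 0 • classFst c' + g' 1 • classSnd c' →
      s c 0 * g 0 + s c 1 * g 1 = s c' 0 * g' 0 + s c' 1 * g' 1 := by
    intro c c' g g' hne hg
    have := dotProduct_eq_of_mul_ne_zero hp (hs c c' hne) g g' hg
    simpa only [dotProduct, Fin.sum_univ_two] using this
  have key' : ∀ (F F' : EntLabel p) (a b : ZMod p),
      a • F.1.1 + b • F.1.2 = a • F'.1.1 + b • F'.1.2 →
      s (.inr F) 0 * a + s (.inr F) 1 * b = s (.inr F') 0 * a + s (.inr F') 1 * b := by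
    intro F F' a b hab
    by_cases hF : F = F'
    · rw [hF]
    refine key (.inr F) (.inr F') ![a, b] ![a, b] (by simpa using hF) ?_
    exact Prod.ext rfl hab
  let F₁ : EntLabel p := ⟨((0, -k / 2), (-2 / k, 0)), by simp only [symp]; field_simp; simp⟩
  let F₂ : EntLabel p := ⟨((2, -k), (0, -1 / 2)), by simp only [symp]; field_simp; simp⟩
  let F₃ : EntLabel p := ⟨((0, k / 2), (2 / k, -2)), by simp only [symp]; field_simp; simp⟩
  let F₄ : EntLabel p := ⟨((2, -k / 2), (-2 / k, 0)), by simp only [symp]; field_simp; simp⟩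
  have e14 := key' F₁ F₄ 0 1 (by simp [F₁, F₄])
  have e12 := key' F₁ F₂ 1 (-k) (by
    ext <;> simp [F₁, F₂] <;> field_simp <;> ring)
  have e23 := key' F₂ F₃ 1 k (by
    ext <;> simp [F₂, F₃] <;> field_simp <;> ring)
  have e34 := key' F₃ F₄ 2 k (by
    ext <;> simp [F₃, F₄] <;> field_simp <;> ring)
  have e1 := key (.inr F₁) (.inl (some 0)) ![1, 0] ![1, -k / 2] (by simp) (by
    ext <;> simp [F₁, classFst, classSnd, mubLabel])
  have e2 := key (.inr F₂) (.inl none) ![0, 1] ![1, -1 / 2] (by simp) (by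
    ext <;> simp [F₂, classFst, classSnd, mubLabel])
  have e3 := key (.inr F₃) (.inl (some 0)) ![1, 0] ![1, k / 2] (by simp) (by
    ext <;> simp [F₃, classFst, classSnd, mubLabel])
  have e4 := key (.inr F₄) (.inl (some k)) ![1, k] ![1, -k / 2] (by simp) (by
    ext <;> simp [F₄, classFst, classSnd, mubLabel] <;> field_simp <;> ring)
  rw [hk1 none (some 0)] at e2
  rw [hk1 (some k) (some 0)] at e4
  simp only [Matrix.cons_val_zero, Matrix.cons_val_one] at e1 e2 e3 e4
  field_simp at e1 e2 e3 e4
  refine mul_left_cancel₀ (mul_ne_zero h2 h2) ?_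
  linear_combination e1 + 2 * k * e2 + e3 - 2 * e4 - 2 * k * e14 - 2 * e12 - 2 * e23 - 2 * e34

theorem not_forall_mul_ne_zero {r : Option (ZMod p) → ZMod p} (hr : r ∈ facets p)
    (s : TestClass p → Fin 2 → ZMod p)
    (hs : ∀ c c', c ≠ c' → testProj c (s c) * testProj c' (s c') ≠ 0)
    (hsr : ∀ j, s (.inl j) 0 ≠ -r j) : False := by
  by_cases hp : p = 2
  · subst hp
    exact not_forall_mul_ne_zero_two s hs
  · obtain ⟨x, z, rfl⟩ := hr hp
    have h1 : s (.inl none) 0 + x ≠ 0 := fun h => hsr none (eq_neg_of_add_eq_zero_left h)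
    refine hsr (some ((z - s (.inl (some 0)) 0) / (s (.inl none) 0 + x))) ?_
    rw [phase_linear_of_odd hp s hs, phaseVector]
    field_simp
    ring

end UpperBound

/-! ### The independence number: lower bound -/

section LowerBound

/-- The exponent `m` in `D_u D_v = i ^ m D_{u + v}`, for one qubit. The factor `3` inverts the phase in
the definition of `D_{u + v}`. -/
def qubitExponent (u v : ZMod 2 × ZMod 2) : ℕ :=
  u.1.val * u.2.val + v.1.val * v.2.val + 2 * (u.2 * v.1).val +
    3 * ((u + v).1.val * (u + v).2.val)

/-- Signs assigned to the Pauli operators of two qubits, for a given label `r` of a facet: product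
signs which are altered for `X ⊗ X` and `Y ⊗ Y`. -/
def pauliSign (r : Option (ZMod 2) → ZMod 2) (a : (ZMod 2 × ZMod 2) × (ZMod 2 × ZMod 2)) : ZMod 2 :=
  (if a.1 = 0 then 0 else if a.1 = (0, 1) then r none + 1 else r (some a.1.2) + 1) +
  (if a.2 = (1, 0) then r none + r (some 0) + r (some 1) else 0) +
  (if a.1 = a.2 ∧ a.1.1 = 1 then 1 else 0)

/-- The signs `pauliSign r` are multiplicative on the stabilizer groups belonging to `c`: the product
of the two generators and of the inverse of the operator labelled by the sum is a power of `i`, which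
is equal to the product of the three signs. -/
def IsConsistent (r : Option (ZMod 2) → ZMod 2) (c : TestClass 2) : Prop :=
  (2 * (pauliSign r (classFst c) + pauliSign r (classSnd c) +
    pauliSign r (classFst c + classSnd c)).val +
    (qubitExponent (classFst c).1 (classSnd c).1 + qubitExponent (classFst c).2 (classSnd c).2)) % 4
    = 0

instance (r : Option (ZMod 2) → ZMod 2) : DecidablePred (IsConsistent r) := fun _ =>
  inferInstanceAs (Decidable (_ = _))

set_option maxRecDepth 100000 in
theorem card_isConsistent_elim : ∀ a b c : ZMod 2,
    8 ≤ (Finset.univ.filter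
      (IsConsistent fun o => o.elim a fun k => if k = 0 then b else c)).card := by
  decide

/-- The signs are multiplicative on at least eight of the nine bases. -/
theorem card_isConsistent (r : Option (ZMod 2) → ZMod 2) :
    8 ≤ (Finset.univ.filter (IsConsistent r)).card := by
  have h : r = fun o => o.elim (r none) fun k => if k = 0 then r (some 0) else r (some 1) := by
    funext o
    cases o with
    | none => rfl
    | some k => rcases zmod_two_cases k with rfl | rfl <;> rfl
  rw [h]
  exact card_isConsistent_elim _ _ _

theorem pauliSign_zero (r : Option (ZMod 2) → ZMod 2) : pauliSign r 0 = 0 := by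
  have h : (0 : ZMod 2 × ZMod 2) ≠ (1, 0) := by decide
  simp [pauliSign, h]

theorem pauliSign_mubLabel_ne (r : Option (ZMod 2) → ZMod 2) (j : Option (ZMod 2)) :
    pauliSign r (mubLabel j, 0) ≠ -r j := by
  have h : (0 : ZMod 2 × ZMod 2) ≠ (1, 0) := by decide
  have h1 : ∀ y : ZMod 2, y + 1 ≠ -y := by decide
  cases j with
  | none =>
    refine ne_of_eq_of_ne ?_ (h1 (r none))
    simp [pauliSign, mubLabel, h]
  | some k =>
    refine ne_of_eq_of_ne ?_ (h1 (r (some k)))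
    simp [pauliSign, mubLabel, h]

theorem chi_two (y : ZMod 2) : chi 2 y = Complex.I ^ (2 * y.val) := by
  rw [← omega_pow_val, omega_two, pow_mul, Complex.I_sq]

theorem disp_mul_two (u v : ZMod 2 × ZMod 2) :
    disp u * disp v = Complex.I ^ qubitExponent u v • disp (u + v) := by
  rw [disp, disp, disp, displacement_eq, displacement_eq, displacement_eq, smul_mul_smul_comm,
    weyl1_mul, smul_smul, smul_smul, tau_two, chi_two, qubitExponent]
  congr 1
  have h : (Complex.I ^ (3 * ((u + v).1.val * (u + v).2.val)) *
      Complex.I ^ ((u + v).1.val * (u + v).2.val) : ℂ) = 1 := by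
    rw [← pow_add, ← Nat.succ_mul, pow_mul, Complex.I_pow_four, one_pow]
  rw [pow_add, pow_add, pow_add, mul_assoc _ (Complex.I ^ (3 * _)), h, mul_one]

theorem trace_disp2_mul_two (a b : (ZMod 2 × ZMod 2) × (ZMod 2 × ZMod 2)) :
    (disp2 a * disp2 b).trace = if a = b then 4 else 0 := by
  split_ifs with h
  · subst h
    have := disp2_pow_p a
    rw [sq] at this
    rw [this, Matrix.trace_one]
    simp [ZMod.card]
  · obtain ⟨c, hc, h1⟩ := exists_disp2_mul a b
    obtain ⟨d, hd, h2⟩ := exists_disp2_eq (a + b)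
    rw [h1, h2, smul_smul, Matrix.trace_smul, trace_weyl, if_neg, smul_zero]
    rintro ⟨h3, h4⟩
    refine h ?_
    have h5 : a + b = 0 := by
      ext
      · exact congrFun h3 0
      · exact congrFun h4 0
      · exact congrFun h3 1
      · exact congrFun h4 1
    have h6 : ∀ u : ZMod 2 × ZMod 2, u + u = 0 := by decide
    have h7 : b + b = 0 := Prod.ext (h6 b.1) (h6 b.2)
    exact add_right_cancel (h5.trans h7.symm)

/-- The operator whose overlaps with the two-qubit Pauli operators are the signs `pauliSign r`. -/
def pauliSignOperator (r : Option (ZMod 2) → ZMod 2) : Op 2 2 :=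
  (4 : ℂ)⁻¹ • ∑ a, chi 2 (pauliSign r a) • disp2 a

theorem trace_disp2_mul_pauliSignOperator (r : Option (ZMod 2) → ZMod 2)
    (a : (ZMod 2 × ZMod 2) × (ZMod 2 × ZMod 2)) :
    (disp2 a * pauliSignOperator r).trace = chi 2 (pauliSign r a) := by
  rw [pauliSignOperator, mul_smul_comm, Finset.mul_sum, Matrix.trace_smul, Matrix.trace_sum]
  simp_rw [mul_smul_comm, Matrix.trace_smul, trace_disp2_mul_two]
  simp [mul_comm]

theorem trace_testChar_mul_pauliSignOperator (r : Option (ZMod 2) → ZMod 2) (c : TestClass 2)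
    (hc : IsConsistent r c) (g : Fin 2 → ZMod 2) :
    (testChar c ![pauliSign r (classFst c), pauliSign r (classSnd c)] g *
      pauliSignOperator r).trace = 1 := by
  have hself : ∀ a : (ZMod 2 × ZMod 2) × (ZMod 2 × ZMod 2),
      ((chi 2 (pauliSign r a) • disp2 a) * pauliSignOperator r).trace = 1 := by
    intro a
    rw [smul_mul_assoc, Matrix.trace_smul, trace_disp2_mul_pauliSignOperator, smul_eq_mul,
      ← AddChar.map_add_eq_mul, CharTwo.add_self_eq_zero, AddChar.map_zero_eq_one]
  have hv0 : (0 : ZMod 2).val = 0 := rfl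
  have hv1 : (1 : ZMod 2).val = 1 := rfl
  rw [testChar, stabChar, pairChar_apply]
  simp only [Matrix.cons_val_zero, Matrix.cons_val_one]
  rcases zmod_two_cases (g 0) with h0 | h0 <;> rcases zmod_two_cases (g 1) with h1 | h1 <;>
    rw [h0, h1] <;> simp only [hv0, hv1, pow_zero, pow_one, one_mul, mul_one]
  · have h2 : disp2 (0 : (ZMod 2 × ZMod 2) × (ZMod 2 × ZMod 2)) = 1 := by
      rw [disp2, Prod.fst_zero, Prod.snd_zero, disp_zero, tensorPair_one]
    have := trace_disp2_mul_pauliSignOperator r 0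
    rwa [h2, one_mul, pauliSign_zero, AddChar.map_zero_eq_one] at this
  · exact hself _
  · exact hself _
  · rw [smul_mul_smul_comm, disp2, disp2, tensorPair_mul, disp_mul_two, disp_mul_two,
      tensorPair_smul_left, tensorPair_smul_right, smul_smul, smul_smul, smul_mul_assoc,
      Matrix.trace_smul, ← Prod.fst_add, ← Prod.snd_add]
    have := trace_disp2_mul_pauliSignOperator r (classFst c + classSnd c)
    rw [disp2] at this
    rw [this, smul_eq_mul]
    have h3 : ∀ x y z : ZMod 2, ∀ m n : ℕ, (2 * (x + y + z).val + (m + n)) % 4 = 0 →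
        chi 2 x * chi 2 y * Complex.I ^ m * Complex.I ^ n * chi 2 z = 1 := by
      intro x y z m n h
      have h4 : chi 2 x * chi 2 y * Complex.I ^ m * Complex.I ^ n * chi 2 z =
          Complex.I ^ (2 * (x + y + z).val + (m + n)) := by
        rw [pow_add, pow_add, ← chi_two, AddChar.map_add_eq_mul, AddChar.map_add_eq_mul]
        ring
      obtain ⟨q, hq⟩ := Nat.dvd_of_mod_eq_zero h
      rw [h4, hq, pow_mul, Complex.I_pow_four, one_pow]
    exact h3 _ _ _ _ _ hc

variable {p : ℕ} [Fact p.Prime]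

theorem exclusivityGraph_adj_iff {n : ℕ} {S : Finset (Op p n)}
    (hS : (S : Set (Op p n)) ⊆ stabilizerProjectors p n) (P Q : S) :
    (exclusivityGraph S).Adj P Q ↔ P ≠ Q ∧ (P : Op p n) * Q = 0 :=
  ⟨fun h => ⟨h.1, h.2.1⟩, fun h => ⟨h.1, h.2,
    mul_eq_zero_comm_of_mem_stabilizerProjectors (hS P.2) (hS Q.2) h.2⟩⟩

/-- The basis to which an element of the set of projectors belongs. -/
def testClassOf (r : Option (ZMod p) → ZMod p) (P : {P // P ∈ testSet p r}) : TestClass p :=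
  ((testEquiv r).symm P).1.1

theorem adj_of_testClassOf_eq (r : Option (ZMod p) → ZMod p) (P Q : {P // P ∈ testSet p r})
    (hPQ : P ≠ Q) (h : testClassOf r P = testClassOf r Q) :
    (exclusivityGraph (testSet p r)).Adj P Q := by
  obtain ⟨⟨⟨c, s⟩, hq⟩, rfl⟩ := (testEquiv r).surjective P
  obtain ⟨⟨⟨c', s'⟩, hq'⟩, rfl⟩ := (testEquiv r).surjective Q
  simp only [testClassOf, Equiv.symm_apply_apply] at h
  subst h
  refine (exclusivityGraph_adj_iff (testSet_subset r) _ _).2 ⟨hPQ, ?_⟩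
  rw [testEquiv_apply, testEquiv_apply]
  refine testProj_mul_eq_zero c fun hs => hPQ ?_
  simp only at hs
  subst hs
  rfl

theorem indepNum_le {r : Option (ZMod p) → ZMod p} (hr : r ∈ facets p) :
    (exclusivityGraph (testSet p r)).indepNum ≤ p ^ 3 := by
  obtain ⟨I, hI⟩ := (exclusivityGraph (testSet p r)).exists_isNIndepSet_indepNum
  rw [← hI.card_eq]
  by_contra hcard
  push Not at hcard
  have hinj := injOn_of_isIndepSet (adj_of_testClassOf_eq r) hI.isIndepSet
  have himg : I.image (testClassOf r) = Finset.univ := by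
    refine Finset.eq_univ_of_card _ (le_antisymm (Finset.card_le_univ _) ?_)
    rw [Finset.card_image_of_injOn hinj, card_testClass]
    exact hcard
  have hsel : ∀ c : TestClass p, ∃ P ∈ I, testClassOf r P = c := fun c =>
    Finset.mem_image.1 (himg ▸ Finset.mem_univ c)
  choose P hPI hPc using hsel
  have hcs : ∀ c, ∃ s, (P c : Op p 2) = testProj c s ∧ ∀ j, c = .inl j → s 0 ≠ -r j := by
    intro c
    have h1 := testEquiv_apply r ((testEquiv r).symm (P c))
    have h2 := ((testEquiv r).symm (P c)).2
    have h3 : ((testEquiv r).symm (P c)).1.1 = c := hPc c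
    rw [Equiv.apply_symm_apply, h3] at h1
    rw [h3] at h2
    exact ⟨_, h1, h2⟩
  choose s hs hsr using hcs
  refine not_forall_mul_ne_zero hr s (fun c c' hne h0 => ?_) fun j => hsr _ j rfl
  have hne' : P c ≠ P c' := fun h => hne (by rw [← hPc c, ← hPc c', h])
  refine hI.isIndepSet (hPI c) (hPI c') hne'
    ((exclusivityGraph_adj_iff (testSet_subset r) _ _).2 ⟨hne', ?_⟩)
  rw [hs c, hs c', h0]

/-- If the states `testProj c (s c)` with `c ∈ C` belong to stabilizer groups on which some linear
functional `Tr (· B)` is constantly one, they form an independent set. -/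
theorem card_le_indepNum (r : Option (ZMod p) → ZMod p) (C : Finset (TestClass p))
    (s : TestClass p → Fin 2 → ZMod p) (hs : ∀ c ∈ C, ∀ j, c = .inl j → s c 0 ≠ -r j)
    (B : Op p 2) (hB : ∀ c ∈ C, ∀ g, (testChar c (s c) g * B).trace = 1) :
    C.card ≤ (exclusivityGraph (testSet p r)).indepNum := by
  classical
  let f : {c // c ∈ C} → {P // P ∈ testSet p r} := fun c =>
    testEquiv r ⟨(c.1, s c.1), hs c.1 c.2⟩
  have hf : Function.Injective f := by
    intro c c' h
    have h1 := (testEquiv r).injective h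
    exact Subtype.ext (congrArg (fun q => q.1.1) h1)
  have hI : (exclusivityGraph (testSet p r)).IsIndepSet
      ((Finset.univ.map ⟨f, hf⟩ : Finset _) : Set {P // P ∈ testSet p r}) := by
    intro P hP Q hQ hne hadj
    obtain ⟨c, _, rfl⟩ := Finset.mem_map.1 (Finset.mem_coe.1 hP)
    obtain ⟨c', _, rfl⟩ := Finset.mem_map.1 (Finset.mem_coe.1 hQ)
    have h0 := ((exclusivityGraph_adj_iff (testSet_subset r) _ _).1 hadj).2
    have h1 := trace_projOf_mul_projOf_ne_zero (testChar c.1 (s c.1)) (testChar c'.1 (s c'.1))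
      (isWeyl_stabChar _ _ _ _) (isWeyl_stabChar _ _ _ _) B (hB _ c.2) (hB _ c'.2)
    change testProj _ _ * testProj _ _ = 0 at h0
    change Matrix.trace (testProj _ _ * testProj _ _) ≠ 0 at h1
    rw [h0] at h1
    simp at h1
  have := hI.card_le_indepNum
  rwa [Finset.card_map, Finset.card_univ, Fintype.card_coe] at this

theorem le_indepNum {r : Option (ZMod p) → ZMod p} (hr : r ∈ facets p) :
    p ^ 3 ≤ (exclusivityGraph (testSet p r)).indepNum := by
  by_cases hp : p = 2
  · subst hp
    refine (card_isConsistent r).trans (card_le_indepNum r _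
      (fun c => ![pauliSign r (classFst c), pauliSign r (classSnd c)]) ?_ (pauliSignOperator r) ?_)
    · rintro c _ j rfl
      exact pauliSign_mubLabel_ne r j
    · intro c hc g
      exact trace_testChar_mul_pauliSignOperator r c (Finset.mem_filter.1 hc).2 g
  · -- the facet labels `r` and `q = r + b` agree only in the first component
    obtain ⟨x, z, rfl⟩ := hr hp
    have hcard : (Finset.univ.erase (Sum.inl none : TestClass p)).card = p ^ 3 := by
      rw [Finset.card_erase_of_mem (Finset.mem_univ _), Finset.card_univ, card_testClass,
        Nat.add_sub_cancel]
    rw [← hcard]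
    refine card_le_indepNum _ _
      (fun c => c.elim (fun j => ![-phaseVector x (z + 1) j, 0]) fun _ => ![z + 1, -x]) ?_
      (tensorPair (facetOperator p (phaseVector x (z + 1)))
        (facetOperator p (phaseVector 0 0))) ?_
    · rintro c hc j rfl
      cases j with
      | none => exact absurd rfl (Finset.mem_erase.1 hc).1
      | some k => simp [phaseVector]
    · intro c _ g
      rw [testChar_of_odd hp, smul_mul_assoc, disp2, tensorPair_mul, Matrix.trace_smul,
        trace_tensorPair, trace_disp_mul_facetOperator hp, trace_disp_mul_facetOperator hp,
        smul_eq_mul, ← AddChar.map_add_eq_mul, ← AddChar.map_add_eq_mul, chi_eq_one_iff]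
      rcases c with (_ | k) | F <;>
        simp [dotProduct, Fin.sum_univ_two, classFst, classSnd, mubLabel, phaseVector] <;> ring

theorem indepNum_eq {r : Option (ZMod p) → ZMod p} (hr : r ∈ facets p) :
    (exclusivityGraph (testSet p r)).indepNum = p ^ 3 :=
  le_antisymm (indepNum_le hr) (le_indepNum hr)

end LowerBound

/-! ### Noncontextual hidden variable models -/

section NCHV

variable {p n : ℕ} [Fact p.Prime]

/-- The projectors with value one form an independent set. -/
theorem sum_le_indepNum {S : Finset (Op p n)}
    {v : Op p n → ℝ} (hv : IsValueAssignment (S : Set (Op p n)) v) :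
    ∑ P ∈ S, v P ≤ (exclusivityGraph S).indepNum := by
  classical
  have h1 : ∑ P ∈ S, v P = (Finset.univ.filter fun P : S => v P = 1).card := by
    rw [← Finset.sum_coe_sort, Finset.card_filter, Nat.cast_sum]
    refine Finset.sum_congr rfl fun P _ => ?_
    rcases hv.1 P P.2 with h | h <;> simp [h]
  rw [h1, Nat.cast_le]
  refine SimpleGraph.IsIndepSet.card_le_indepNum ?_
  intro P hP Q hQ hne hadj
  have hP' := (Finset.mem_filter.1 (Finset.mem_coe.1 hP)).2
  have hQ' := (Finset.mem_filter.1 (Finset.mem_coe.1 hQ)).2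
  exact hv.2 P P.2 Q Q.2 (fun h => hne (Subtype.ext h)) hadj.2.1 ⟨hP', hQ'⟩

theorem isGreatest_nchvValues {S : Finset (Op p n)}
    (hS : (S : Set (Op p n)) ⊆ stabilizerProjectors p n) :
    IsGreatest (nchvValues S) ((exclusivityGraph S).indepNum : ℝ) := by
  classical
  constructor
  · obtain ⟨I, hI⟩ := (exclusivityGraph S).exists_isNIndepSet_indepNum
    refine subset_convexHull ℝ _ ⟨fun P => if ∃ h : P ∈ S, (⟨P, h⟩ : S) ∈ I then 1 else 0,
      ⟨fun P _ => ?_, fun P hP Q hQ hne h0 => ?_⟩, ?_⟩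
    · beta_reduce
      split_ifs
      · exact Or.inr rfl
      · exact Or.inl rfl
    · rintro ⟨h1, h2⟩
      have h1' : ∃ h : P ∈ S, (⟨P, h⟩ : S) ∈ I := by
        by_contra h
        exact zero_ne_one ((if_neg h).symm.trans h1)
      have h2' : ∃ h : Q ∈ S, (⟨Q, h⟩ : S) ∈ I := by
        by_contra h
        exact zero_ne_one ((if_neg h).symm.trans h2)
      obtain ⟨hP', hPI⟩ := h1'
      obtain ⟨hQ', hQI⟩ := h2'
      have hne' : (⟨P, hP'⟩ : S) ≠ ⟨Q, hQ'⟩ := fun h => hne (Subtype.mk.inj h)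
      exact hI.isIndepSet hPI hQI hne' ((exclusivityGraph_adj_iff hS _ _).2 ⟨hne', h0⟩)
    · rw [← Finset.sum_coe_sort, ← hI.card_eq, Finset.card_eq_sum_ones, Nat.cast_sum,
        ← Finset.sum_filter_add_sum_filter_not Finset.univ (· ∈ I)]
      have h1 : ∑ P ∈ Finset.univ.filter (· ∉ I),
          (if ∃ h : (P : Op p n) ∈ S, (⟨P, h⟩ : S) ∈ I then (1 : ℝ) else 0) = 0 := by
        refine Finset.sum_eq_zero fun P hP => if_neg ?_
        rintro ⟨h, hPI⟩
        exact (Finset.mem_filter.1 hP).2 hPI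
      rw [h1, add_zero]
      have h2 : Finset.univ.filter (· ∈ I) = I := by ext; simp
      rw [h2]
      refine Finset.sum_congr rfl fun P hP => ?_
      rw [if_pos ⟨P.2, hP⟩, Nat.cast_one]
  · have h1 : nchvValues S ⊆ Set.Iic ((exclusivityGraph S).indepNum : ℝ) := by
      refine convexHull_min ?_ (convex_Iic _)
      rintro x ⟨v, hv, rfl⟩
      exact sum_le_indepNum hv
    exact fun x hx => h1 hx

end NCHV

/-! ### Expectation values -/

section Expval

variable {ι : Type*} [Fintype ι]

theorem expval_sub (A B ρ : Matrix ι ι ℂ) : expval (A - B) ρ = expval A ρ - expval B ρ := by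
  rw [expval, sub_mul, Matrix.trace_sub, Complex.sub_re]; rfl

theorem expval_sum {κ : Type*} (s : Finset κ) (A : κ → Matrix ι ι ℂ) (ρ : Matrix ι ι ℂ) :
    expval (∑ i ∈ s, A i) ρ = ∑ i ∈ s, expval (A i) ρ := by
  rw [expval, Finset.sum_mul, Matrix.trace_sum, Complex.re_sum]; rfl

theorem expval_one [DecidableEq ι] {ρ : Matrix ι ι ℂ} (hρ : IsState ρ) : expval 1 ρ = 1 := by
  rw [expval, one_mul, hρ.2, Complex.one_re]

theorem expval_smul (t : ℝ) (A ρ : Matrix ι ι ℂ) : expval ((t : ℂ) • A) ρ = t * expval A ρ := by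
  rw [expval, smul_mul_assoc, Matrix.trace_smul, smul_eq_mul, Complex.re_ofReal_mul]; rfl

theorem trace_re_mul_mul_nonneg {τ : Matrix ι ι ℂ} (hτ : τ.PosSemidef) {Y : Matrix ι ι ℂ}
    (hY : Yᴴ = Y) : 0 ≤ (Y * τ * Y).trace.re := by
  have h := (hτ.mul_mul_conjTranspose_same Y).trace_nonneg
  rw [hY] at h
  exact (Complex.nonneg_iff.1 h).1

theorem expval_nonneg_of_projector {τ : Matrix ι ι ℂ} (hτ : τ.PosSemidef) {E : Matrix ι ι ℂ}
    (hE : Eᴴ = E) (hEE : E * E = E) : 0 ≤ expval E τ := by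
  have h := trace_re_mul_mul_nonneg hτ hE
  rwa [Matrix.trace_mul_comm, ← mul_assoc, hEE] at h

/-- A Hermitian involution has expectation values in `[-1, ∞)`. -/
theorem neg_one_le_expval_of_involution [DecidableEq ι] {τ : Matrix ι ι ℂ} (hτ : IsState τ)
    {A : Matrix ι ι ℂ} (hA : Aᴴ = A) (hAA : A * A = 1) : -1 ≤ expval A τ := by
  have h := trace_re_mul_mul_nonneg hτ.1 (Y := 1 + A) (by
    rw [Matrix.conjTranspose_add, Matrix.conjTranspose_one, hA])
  have h1 : (1 + A) * (1 + A) = (1 + A) + (1 + A) := by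
    rw [add_mul, mul_add, mul_add, one_mul, one_mul, mul_one, hAA, add_comm A 1]
  rw [Matrix.trace_mul_comm, ← mul_assoc, h1, add_mul, Matrix.trace_add, add_mul, one_mul,
    Matrix.trace_add, hτ.2] at h
  simp only [Complex.add_re, Complex.one_re] at h
  rw [expval]
  linarith

theorem trace_im_eq_zero {A ρ : Matrix ι ι ℂ} (hA : Aᴴ = A) (hρ : ρᴴ = ρ) :
    (A * ρ).trace.im = 0 := by
  have h : star (A * ρ).trace = (A * ρ).trace := by
    rw [← Matrix.trace_conjTranspose, Matrix.conjTranspose_mul, hA, hρ, Matrix.trace_mul_comm]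
  exact Complex.conj_eq_iff_im.1 h

theorem tensorPair_eq_adjoinAncilla {p : ℕ} (M N : Op1 p) :
    tensorPair M N = adjoinAncilla M (tensor ![N]) := tensor_succ _

variable {p n : ℕ} [NeZero p]

theorem trace_adjoinAncilla_mul (A ρ : Op1 p) (B σ : Op p n) :
    (adjoinAncilla A B * adjoinAncilla ρ σ).trace = (A * ρ).trace * (B * σ).trace := by
  rw [adjoinAncilla_mul, trace_adjoinAncilla]

theorem expval_adjoinAncilla {A ρ : Op1 p} (hA : Aᴴ = A) (hρ : ρᴴ = ρ) (B σ : Op p n) :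
    expval (adjoinAncilla A B) (adjoinAncilla ρ σ) = expval A ρ * expval B σ := by
  rw [expval, trace_adjoinAncilla_mul, Complex.mul_re, trace_im_eq_zero hA hρ, zero_mul, sub_zero]
  rfl

theorem tensor_one_eq : tensor ![(1 : Op1 p)] = 1 := by
  rw [← tensor_one]
  congr 1
  ext i : 1
  fin_cases i
  rfl

theorem isState_tensor_singleton {σ : Op1 p} (hσ : IsState σ) : IsState (tensor ![σ]) := by
  have h : tensor ![σ] = σ.submatrix (fun k : Fin 1 → ZMod p => k 0) (fun k => k 0) := by
    ext k l
    simp [tensor]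
  refine ⟨?_, ?_⟩
  · rw [h]
    exact hσ.1.submatrix _
  · rw [trace_tensor]
    simpa using hσ.2

theorem IsState.tensorPair {ρ σ : Op1 p} (hρ : IsState ρ) (hσ : IsState σ) :
    IsState (tensorPair ρ σ) := by
  rw [tensorPair_eq_adjoinAncilla]
  exact hρ.adjoinAncilla (isState_tensor_singleton hσ)

end Expval

/-! ### Quantum values of the witness -/

section Witness

variable {p : ℕ} [Fact p.Prime]

theorem conjTranspose_mubProjector (j : Option (ZMod p)) (s : ZMod p) :
    (mubProjector p j s)ᴴ = mubProjector p j s := by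
  rw [mubProjector_eq, Matrix.conjTranspose_smul, Matrix.conjTranspose_sum]
  have h1 : ∀ a : ZMod p, ((chi p (-s) • disp (mubLabel j)) ^ a.val)ᴴ =
      (chi p (-s) • disp (mubLabel j)) ^ (-a).val := by
    intro a
    have hA : (chi p (-s) • disp (mubLabel j)) ^ p = 1 := by
      rw [smul_pow, chi_pow_p, disp_pow_p, one_smul]
    have hu : (chi p (-s) • disp (mubLabel j))ᴴ * (chi p (-s) • disp (mubLabel j)) = 1 := by
      rw [Matrix.conjTranspose_smul, smul_mul_smul_comm, conjTranspose_disp_mul, star_chi,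
        ← AddChar.map_add_eq_mul, neg_add_cancel, AddChar.map_zero_eq_one, one_smul]
    set A := chi p (-s) • disp (mubLabel j)
    have h2 : A ^ a.val * A ^ (-a).val = 1 := by
      have := (powChar A hA).map_add_eq_mul a (-a)
      rw [add_neg_cancel, AddChar.map_zero_eq_one] at this
      exact this.symm
    have h3 : (A ^ a.val)ᴴ * A ^ a.val = 1 := by
      rw [Matrix.conjTranspose_pow]
      have hc : Commute Aᴴ A := by
        rw [Commute, SemiconjBy, hu, mul_eq_one_comm.1 hu]
      rw [← hc.mul_pow, hu, one_pow]
    calc (A ^ a.val)ᴴ = (A ^ a.val)ᴴ * (A ^ a.val * A ^ (-a).val) := by rw [h2, mul_one]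
      _ = _ := by rw [← mul_assoc, h3, one_mul]
  simp_rw [h1]
  rw [← Equiv.sum_comp (Equiv.neg (ZMod p)) (fun a => (chi p (-s) • disp (mubLabel j)) ^ a.val)]
  simp

theorem conjTranspose_facetOperator (r : Option (ZMod p) → ZMod p) :
    (facetOperator p r)ᴴ = facetOperator p r := by
  rw [facetOperator, Matrix.conjTranspose_add, Matrix.conjTranspose_neg, Matrix.conjTranspose_one,
    Matrix.conjTranspose_sum]
  simp_rw [conjTranspose_mubProjector]

theorem expval_witness_adjoinAncilla (r : Option (ZMod p) → ZMod p) {ρ : Op1 p} {σ : Op p 1}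
    (hρ : IsState ρ) (hσ : IsState σ) :
    expval (witness p r) (adjoinAncilla ρ σ) = (p : ℝ) ^ 3 - expval (facetOperator p r) ρ := by
  rw [witness_eq, tensorPair_eq_adjoinAncilla, tensor_one_eq, expval_adjoinAncilla _ hρ.1.isHermitian,
    expval_one hσ, mul_one, expval_sub]
  · have h : ((p : ℂ) ^ 3 • 1 : Op1 p) = (((p : ℝ) ^ 3 : ℝ) : ℂ) • 1 := by push_cast; rfl
    rw [h, expval_smul, expval_one hρ, mul_one]
  · rw [Matrix.conjTranspose_sub, conjTranspose_facetOperator, Matrix.conjTranspose_smul,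
      Matrix.conjTranspose_one]
    simp

theorem expval_witness_tensor (r : Option (ZMod p) → ZMod p) {ρ σ : Op1 p}
    (hρ : IsState ρ) (hσ : IsState σ) :
    expval (witness p r) (tensor ![ρ, σ]) = (p : ℝ) ^ 3 - expval (facetOperator p r) ρ := by
  change expval (witness p r) (tensorPair ρ σ) = _
  rw [tensorPair_eq_adjoinAncilla,
    expval_witness_adjoinAncilla r hρ (isState_tensor_singleton hσ)]

theorem lt_expval_witness_iff (r : Option (ZMod p) → ZMod p) {ρ σ : Op1 p}
    (hρ : IsState ρ) (hσ : IsState σ) :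
    (p : ℝ) ^ 3 < expval (witness p r) (tensor ![ρ, σ]) ↔ expval (facetOperator p r) ρ < 0 := by
  rw [expval_witness_tensor r hρ hσ]
  constructor <;> intro h <;> linarith

theorem not_mem_simPolytope_iff {ρ : Op1 p} (hρ : IsState ρ) :
    ρ ∉ simPolytope p ↔ ∃ r ∈ facets p, expval (facetOperator p r) ρ < 0 := by
  constructor
  · intro h
    by_contra hne
    push Not at hne
    exact h ⟨hρ.1.isHermitian, hρ.2, hne⟩
  · rintro ⟨r, hr, h⟩ hs
    exact absurd (hs.2.2 r hr) (not_le.2 h)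

theorem facetOperator_mul_self (hp : p ≠ 2) {r : Option (ZMod p) → ZMod p} (hr : r ∈ facets p) :
    facetOperator p r * facetOperator p r = 1 := by
  obtain ⟨x, z, rfl⟩ := hr hp
  ext i l
  rw [Matrix.mul_apply, Finset.sum_eq_single (2 * x - i)]
  · simp only [facetOperator_phaseVector_apply hp]
    rw [if_pos (by ring), Matrix.one_apply]
    by_cases h : i = l
    · subst h
      rw [if_pos (by ring), if_pos rfl, ← AddChar.map_add_eq_mul, chi_eq_one_iff]
      ring
    · rw [if_neg, if_neg h, mul_zero]
      intro h1
      exact h (by linear_combination -h1)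
  · intro b _ hb
    rw [facetOperator_phaseVector_apply hp, if_neg, zero_mul]
    intro h
    exact hb (by linear_combination h)
  · intro h
    exact absurd (Finset.mem_univ _) h

theorem trace_facetOperator (hp : p ≠ 2) {r : Option (ZMod p) → ZMod p} (hr : r ∈ facets p) :
    (facetOperator p r).trace = 1 := by
  obtain ⟨x, z, rfl⟩ := hr hp
  have := trace_disp_mul_facetOperator hp x z 0
  rw [disp_zero, one_mul] at this
  rw [this]
  simp

/-- The normalized projector onto the eigenspace of `A ^ r` with eigenvalue `-1`. -/
theorem exists_state_facetOperator_mul (hp : p ≠ 2) {r : Option (ZMod p) → ZMod p}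
    (hr : r ∈ facets p) : ∃ ρ : Op1 p, IsState ρ ∧ facetOperator p r * ρ = -ρ := by
  set A := facetOperator p r with hA
  have hAA : A * A = 1 := facetOperator_mul_self hp hr
  have hAH : Aᴴ = A := conjTranspose_facetOperator r
  have hp1 : 1 < p := (Fact.out : p.Prime).one_lt
  have hpos : (0 : ℝ) < (p : ℝ) - 1 := sub_pos.2 (by exact_mod_cast hp1)
  have hne : ((p : ℂ) - 1) ≠ 0 := by
    intro h
    have : (((p : ℝ) - 1 : ℝ) : ℂ) = 0 := by push_cast; exact h
    exact hpos.ne' (Complex.ofReal_eq_zero.1 this)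
  refine ⟨((p : ℂ) - 1)⁻¹ • (1 - A), ⟨?_, ?_⟩, ?_⟩
  · have h1 : (1 - A) * (1 - A)ᴴ = (2 : ℂ) • (1 - A) := by
      rw [Matrix.conjTranspose_sub, Matrix.conjTranspose_one, hAH, sub_mul, mul_sub, mul_sub,
        one_mul, one_mul, mul_one, hAA]
      module
    have h2 : ((p : ℂ) - 1)⁻¹ • (1 - A) =
        (((((p : ℝ) - 1)⁻¹ / 2 : ℝ)) : ℂ) • ((1 - A) * (1 - A)ᴴ) := by
      rw [h1, smul_smul]
      congr 1
      push_cast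
      ring
    rw [h2]
    refine (Matrix.posSemidef_self_mul_conjTranspose (1 - A)).smul ?_
    rw [Complex.zero_le_real]
    positivity
  · rw [Matrix.trace_smul, Matrix.trace_sub, Matrix.trace_one, ZMod.card, hA,
      trace_facetOperator hp hr, smul_eq_mul, inv_mul_cancel₀ hne]
  · rw [mul_smul_comm, mul_sub, mul_one, hAA, ← smul_neg, neg_sub]

theorem expval_witness_eigenstate {r : Option (ZMod p) → ZMod p} {ρ σ : Op1 p} (hρ : IsState ρ)
    (hσ : IsState σ) (hAρ : facetOperator p r * ρ = -ρ) :
    expval (witness p r) (tensor ![ρ, σ]) = (p : ℝ) ^ 3 + 1 := by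
  rw [expval_witness_tensor r hρ hσ, expval, hAρ, Matrix.trace_neg, hρ.2]
  simp

theorem expval_witness_le (hp : p ≠ 2) {r : Option (ZMod p) → ZMod p} (hr : r ∈ facets p)
    {τ : Op p 2} (hτ : IsState τ) : expval (witness p r) τ ≤ (p : ℝ) ^ 3 + 1 := by
  have h1 : witness p r = (((p : ℝ) ^ 3 : ℝ) : ℂ) • 1 - tensorPair (facetOperator p r) 1 := by
    rw [witness_eq, tensorPair_sub_left, tensorPair_smul_left, tensorPair_one]
    push_cast
    rfl
  have h2 := neg_one_le_expval_of_involution hτ (A := tensorPair (facetOperator p r) 1)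
    (by rw [tensorPair_conjTranspose, conjTranspose_facetOperator, Matrix.conjTranspose_one])
    (by rw [tensorPair_mul, facetOperator_mul_self hp hr, one_mul, tensorPair_one])
  rw [h1, expval_sub, expval_smul, expval_one hτ]
  linarith

end Witness

/-! ### Lovász number and fractional packing number -/

section GraphParameters

variable {p n : ℕ} [Fact p.Prime]

/-- The Gram matrix of the operators `P τ ^ (1/2)` is a feasible point of the semidefinite program
of the Lovász number; if `τ` is an eigenstate of the sum of the projectors, the value is the
eigenvalue. -/
theorem exists_posSemidef_of_eigenstate {S : Finset (Op p n)}
    (hS : (S : Set (Op p n)) ⊆ stabilizerProjectors p n) {τ : Op p n} (hτ : IsState τ) {t : ℝ}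
    (ht : 0 < t) (hSτ : (∑ P ∈ S, P) * τ = (t : ℂ) • τ) :
    ∃ B : Matrix S S ℝ, B.PosSemidef ∧ B.trace = 1 ∧
      (∀ i j, (exclusivityGraph S).Adj i j → B i j = 0) ∧ t = ∑ i, ∑ j, B i j := by
  have hH : ∀ P : S, (P : Op p n)ᴴ = P := fun P => isHermitian_of_mem_stabilizerProjectors (hS P.2)
  have hsum : ∑ P : S, (P : Op p n) = ∑ P ∈ S, P := Finset.sum_coe_sort S fun P => P
  refine ⟨Matrix.of fun P Q => t⁻¹ * ((P : Op p n) * τ * Q).trace.re,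
    Matrix.PosSemidef.of_dotProduct_mulVec_nonneg ?_ ?_, ?_, ?_, ?_⟩
  · ext P Q
    simp only [Matrix.conjTranspose_apply, Matrix.of_apply, star_trivial]
    have h1 : ((Q : Op p n) * τ * P).trace = star ((P : Op p n) * τ * Q).trace := by
      rw [← Matrix.trace_conjTranspose, Matrix.conjTranspose_mul, Matrix.conjTranspose_mul, hH, hH,
        hτ.1.isHermitian, mul_assoc]
    rw [h1]
    simp
  · intro x
    have hY : (∑ P : S, (x P : ℂ) • (P : Op p n))ᴴ = ∑ P : S, (x P : ℂ) • (P : Op p n) := by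
      rw [Matrix.conjTranspose_sum]
      refine Finset.sum_congr rfl fun P _ => ?_
      rw [Matrix.conjTranspose_smul, hH]
      simp
    have h1 := trace_re_mul_mul_nonneg hτ.1 hY
    have h2 : star x ⬝ᵥ ((Matrix.of fun P Q : S => t⁻¹ * ((P : Op p n) * τ * Q).trace.re) *ᵥ x) =
        t⁻¹ * ((∑ P : S, (x P : ℂ) • (P : Op p n)) * τ *
          (∑ P : S, (x P : ℂ) • (P : Op p n))).trace.re := by
      rw [Finset.sum_mul, Finset.sum_mul, Matrix.trace_sum, Complex.re_sum, Finset.mul_sum,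
        dotProduct]
      refine Finset.sum_congr rfl fun P _ => ?_
      rw [Finset.mul_sum, Matrix.trace_sum, Complex.re_sum, Finset.mul_sum, Matrix.mulVec,
        dotProduct, Finset.mul_sum]
      refine Finset.sum_congr rfl fun Q _ => ?_
      rw [smul_mul_assoc, smul_mul_assoc, mul_smul_comm, Matrix.trace_smul, Matrix.trace_smul,
        smul_eq_mul, smul_eq_mul, Complex.re_ofReal_mul, Complex.re_ofReal_mul]
      simp only [Pi.star_apply, star_trivial, Matrix.of_apply]
      ring
    rw [h2]
    exact mul_nonneg (inv_nonneg.2 ht.le) h1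
  · rw [Matrix.trace]
    simp only [Matrix.diag_apply, Matrix.of_apply]
    have h1 : ∀ P : S, ((P : Op p n) * τ * P).trace = ((P : Op p n) * τ).trace := by
      intro P
      rw [Matrix.trace_mul_comm, ← mul_assoc, mul_self_of_mem_stabilizerProjectors (hS P.2)]
    simp_rw [h1]
    rw [← Finset.mul_sum, ← Complex.re_sum, ← Matrix.trace_sum, ← Finset.sum_mul, hsum, hSτ,
      Matrix.trace_smul, hτ.2]
    simp [ht.ne']
  · intro P Q hPQ
    rw [Matrix.of_apply, Matrix.trace_mul_comm, ← mul_assoc, hPQ.2.2]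
    simp
  · simp only [Matrix.of_apply]
    simp_rw [← Finset.mul_sum, ← Complex.re_sum, ← Matrix.trace_sum, ← Finset.mul_sum]
    rw [← Finset.sum_mul, ← Finset.sum_mul, hsum, hSτ, Matrix.trace_mul_comm, mul_smul_comm, hSτ,
      smul_smul, Matrix.trace_smul, hτ.2]
    simp
    field_simp

/-- Quantum probabilities are a feasible point of the linear program of the fractional packing
number. -/
theorem sum_expval_le_one_of_isClique {S : Finset (Op p n)}
    (hS : (S : Set (Op p n)) ⊆ stabilizerProjectors p n) {τ : Op p n} (hτ : IsState τ)
    {C : Finset S} (hC : (exclusivityGraph S).IsClique (C : Set S)) :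
    ∑ P ∈ C, expval (P : Op p n) τ ≤ 1 := by
  classical
  rw [← expval_sum]
  set E : Op p n := ∑ P ∈ C, (P : Op p n) with hEdef
  have hE : Eᴴ = E := by
    rw [hEdef, Matrix.conjTranspose_sum]
    exact Finset.sum_congr rfl fun P _ => isHermitian_of_mem_stabilizerProjectors (hS P.2)
  have hEE : E * E = E := by
    rw [hEdef, Finset.sum_mul_sum]
    refine Finset.sum_congr rfl fun P hP => ?_
    rw [Finset.sum_eq_single P]
    · exact mul_self_of_mem_stabilizerProjectors (hS P.2)
    · intro Q hQ hne
      exact (hC hP hQ hne.symm).2.1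
    · intro h
      exact absurd hP h
  have h := expval_nonneg_of_projector hτ.1 (E := 1 - E)
    (by rw [Matrix.conjTranspose_sub, Matrix.conjTranspose_one, hE])
    (by rw [sub_mul, mul_sub, mul_sub, hEE, one_mul, one_mul, mul_one, sub_self, sub_zero])
  rw [expval_sub, expval_one hτ] at h
  linarith

theorem witness_mul_tensorPair {r : Option (ZMod p) → ZMod p} {ρ σ : Op1 p}
    (hAρ : facetOperator p r * ρ = -ρ) :
    (∑ P ∈ testSet p r, P) * tensorPair ρ σ = (((p : ℝ) ^ 3 + 1 : ℝ) : ℂ) • tensorPair ρ σ := by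
  change witness p r * _ = _
  rw [witness_eq, tensorPair_mul, one_mul, sub_mul, hAρ, smul_mul_assoc, one_mul, sub_neg_eq_add,
    tensorPair_add_left, tensorPair_smul_left]
  push_cast
  module

theorem lovaszTheta_eq (hp : p ≠ 2) {r : Option (ZMod p) → ZMod p} (hr : r ∈ facets p) :
    lovaszTheta (exclusivityGraph (testSet p r)) = (p : ℝ) ^ 3 + 1 := by
  obtain ⟨ρ, hρ, hAρ⟩ := exists_state_facetOperator_mul hp hr
  refine IsGreatest.csSup_eq ⟨?_, ?_⟩
  · exact exists_posSemidef_of_eigenstate (testSet_subset r) (hρ.tensorPair hρ) (by positivity)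
      (witness_mul_tensorPair hAρ)
  · rintro t ⟨B, hB, htr, hadj, rfl⟩
    refine (sum_sum_le_card_of_cliqueCover (adj_of_testClassOf_eq r) hB htr hadj).trans ?_
    rw [card_testClass]
    push_cast
    exact le_rfl

theorem fractionalPackingNumber_eq (hp : p ≠ 2) {r : Option (ZMod p) → ZMod p}
    (hr : r ∈ facets p) :
    fractionalPackingNumber (exclusivityGraph (testSet p r)) = (p : ℝ) ^ 3 + 1 := by
  obtain ⟨ρ, hρ, hAρ⟩ := exists_state_facetOperator_mul hp hr
  refine IsGreatest.csSup_eq ⟨?_, ?_⟩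
  · refine ⟨fun P => expval (P : Op p 2) (tensorPair ρ ρ), fun P => ?_, fun C hC => ?_, ?_⟩
    · have hP := testSet_subset r P.2
      exact expval_nonneg_of_projector (hρ.tensorPair hρ).1
        (isHermitian_of_mem_stabilizerProjectors hP) (mul_self_of_mem_stabilizerProjectors hP)
    · exact sum_expval_le_one_of_isClique (testSet_subset r) (hρ.tensorPair hρ) hC
    · rw [← expval_witness_eigenstate hρ hρ hAρ, witness, expval_sum,
        ← Finset.sum_coe_sort]
  · rintro t ⟨w, _, hw, rfl⟩
    refine (sum_le_card_of_cliqueCover (adj_of_testClassOf_eq r) hw).trans ?_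
    rw [card_testClass]
    push_cast
    exact le_rfl

end GraphParameters

/-! ### Phase-point operators as value assignments -/

section ValueAssignment

variable {p n : ℕ} [Fact p.Prime]

theorem IsWeyl.exists_tensor_disp {M : Op p n} (hM : IsWeyl M) :
    ∃ c : ℂ, ∃ u : Fin n → ZMod p × ZMod p, M = c • tensor fun i => disp (u i) := by
  obtain ⟨c, hc, x, z, rfl⟩ := hM
  refine ⟨c * (∏ i, tau p ^ ((x i).val * (z i).val))⁻¹, fun i => (x i, z i), ?_⟩
  have h : (tensor fun i => disp (x i, z i)) =
      (∏ i, tau p ^ ((x i).val * (z i).val)) • weyl x z := by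
    rw [← tensor_weyl1, ← tensor_smul]
    simp_rw [← displacement_eq]
  rw [h, smul_smul, inv_mul_cancel_right₀]
  exact Finset.prod_ne_zero_iff.2 fun i _ => pow_ne_zero _ tau_ne_zero

theorem tensor_disp_ne_zero (u : Fin n → ZMod p × ZMod p) : (tensor fun i => disp (u i)) ≠ 0 := by
  intro h
  have h1 : (tensor fun i => disp (u i))ᴴ * (tensor fun i => disp (u i)) = 1 := by
    rw [tensor_conjTranspose, tensor_mul]
    simp_rw [conjTranspose_disp_mul]
    exact tensor_one
  rw [h, mul_zero] at h1
  exact zero_ne_one h1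

theorem trace_tensor_disp_mul_phasePointOperator (hp : p ≠ 2) (u l : Fin n → ZMod p × ZMod p) :
    ((tensor fun i => disp (u i)) * phasePointOperator p n l).trace =
      chi p (∑ i, ((l i).1 * (u i).2 - (l i).2 * (u i).1)) := by
  rw [phasePointOperator, tensor_mul, trace_tensor, chi_sum]
  simp_rw [trace_disp_mul_facetOperator hp]

/-- For odd `p`, the overlaps with a phase-point operator are multiplicative on commuting Weyl
operators: the phases `ω ^ ([u, v] / 2)` in the products of displacement operators vanish. -/
theorem trace_mul_phasePointOperator_of_commute (hp : p ≠ 2) {M N : Op p n} (hM : IsWeyl M)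
    (hN : IsWeyl N) (hMN : M * N = N * M) (l : Fin n → ZMod p × ZMod p) :
    (M * N * phasePointOperator p n l).trace =
      (M * phasePointOperator p n l).trace * (N * phasePointOperator p n l).trace := by
  obtain ⟨c, u, rfl⟩ := hM.exists_tensor_disp
  obtain ⟨d, v, rfl⟩ := hN.exists_tensor_disp
  have h1 : ∀ u v : Fin n → ZMod p × ZMod p, (tensor fun i => disp (u i)) *
      (tensor fun i => disp (v i)) =
      chi p (2⁻¹ * ∑ i, symp (u i) (v i)) • tensor fun i => disp ((u + v) i) := by
    intro u v
    rw [tensor_mul, Finset.mul_sum, chi_sum, ← tensor_smul]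
    simp_rw [disp_mul_of_odd hp]
    rfl
  by_cases hcd : c * d = 0
  · rcases mul_eq_zero.1 hcd with rfl | rfl <;> simp
  have h2 : ∑ i, symp (u i) (v i) = 0 := by
    rw [smul_mul_smul_comm, smul_mul_smul_comm, h1, h1, smul_smul, smul_smul, add_comm v,
      mul_comm d] at hMN
    have h3 := mul_left_cancel₀ hcd (smul_left_injective ℂ (tensor_disp_ne_zero _) hMN)
    have h4 := ZMod.injective_stdAddChar h3
    have h5 : ∑ i, symp (v i) (u i) = -∑ i, symp (u i) (v i) := by
      rw [← Finset.sum_neg_distrib]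
      exact Finset.sum_congr rfl fun i _ => by simp only [symp]; ring
    have h6 := two_ne_zero_zmod hp
    rw [h5] at h4
    field_simp at h4
    have h7 : 2 * ∑ i, symp (u i) (v i) = 0 := by linear_combination h4
    exact (mul_eq_zero.1 h7).resolve_left h6
  rw [smul_mul_smul_comm, h1, h2, mul_zero, AddChar.map_zero_eq_one, one_smul, smul_mul_assoc,
    smul_mul_assoc, smul_mul_assoc, Matrix.trace_smul, Matrix.trace_smul, Matrix.trace_smul,
    trace_tensor_disp_mul_phasePointOperator hp, trace_tensor_disp_mul_phasePointOperator hp,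
    trace_tensor_disp_mul_phasePointOperator hp]
  have h3 : ∑ i, ((l i).1 * ((u + v) i).2 - (l i).2 * ((u + v) i).1) =
      ∑ i, ((l i).1 * (u i).2 - (l i).2 * (u i).1) +
        ∑ i, ((l i).1 * (v i).2 - (l i).2 * (v i).1) := by
    rw [← Finset.sum_add_distrib]
    refine Finset.sum_congr rfl fun i _ => ?_
    simp only [Pi.add_apply, Prod.fst_add, Prod.snd_add]
    ring
  rw [h3, AddChar.map_add_eq_mul]
  simp only [smul_eq_mul]
  ring

theorem trace_phasePointOperator (hp : p ≠ 2) (l : Fin n → ZMod p × ZMod p) :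
    (phasePointOperator p n l).trace = 1 := by
  rw [phasePointOperator, trace_tensor]
  exact Finset.prod_eq_one fun i _ => trace_facetOperator hp fun _ => ⟨_, _, rfl⟩

/-- The overlap of a stabilizer projector with a phase-point operator is the average of a character
of its stabilizer group. -/
theorem exists_char_trace_mul_phasePointOperator (hp : p ≠ 2) {P : Op p n}
    (hP : P ∈ stabilizerProjectors p n) (l : Fin n → ZMod p × ZMod p) :
    (P * phasePointOperator p n l).trace = 0 ∨ (P * phasePointOperator p n l).trace = 1 ∧
      ∃ W : AddChar (Fin n → ZMod p) (Op p n), (∀ g, IsWeyl (W g)) ∧ P = projOf W ∧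
        ∀ g, (W g * phasePointOperator p n l).trace = 1 := by
  classical
  obtain ⟨W, hW, _, rfl⟩ := exists_char_of_mem_stabilizerProjectors hP
  let e : AddChar (Fin n → ZMod p) ℂ :=
    { toFun := fun g => (W g * phasePointOperator p n l).trace
      map_zero_eq_one' := by
        rw [AddChar.map_zero_eq_one, one_mul, trace_phasePointOperator hp]
      map_add_eq_mul' := fun g h => by
        rw [AddChar.map_add_eq_mul]
        refine trace_mul_phasePointOperator_of_commute hp (hW g) (hW h) ?_ l
        rw [← AddChar.map_add_eq_mul, add_comm, AddChar.map_add_eq_mul] }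
  have h1 : (projOf W * phasePointOperator p n l).trace =
      (Fintype.card (Fin n → ZMod p) : ℂ)⁻¹ * ∑ g, e g := by
    rw [projOf, smul_mul_assoc, Matrix.trace_smul, Finset.sum_mul, Matrix.trace_sum, smul_eq_mul]
    rfl
  rw [h1, AddChar.sum_eq_ite]
  split_ifs with he
  · right
    refine ⟨inv_mul_cancel₀ (Nat.cast_ne_zero.2 Fintype.card_ne_zero), W, hW, rfl, fun g => ?_⟩
    change e g = 1
    rw [he, AddChar.zero_apply]
  · left
    rw [mul_zero]

theorem expval_eq_zero_or_one (hp : p ≠ 2) {P : Op p n} (hP : P ∈ stabilizerProjectors p n)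
    (l : Fin n → ZMod p × ZMod p) :
    expval P (phasePointOperator p n l) = 0 ∨ expval P (phasePointOperator p n l) = 1 := by
  rcases exists_char_trace_mul_phasePointOperator hp hP l with h | ⟨h, _⟩
  · left; rw [expval, h, Complex.zero_re]
  · right; rw [expval, h, Complex.one_re]

theorem trace_eq_expval (hp : p ≠ 2) {P : Op p n} (hP : P ∈ stabilizerProjectors p n)
    (l : Fin n → ZMod p × ZMod p) :
    (P * phasePointOperator p n l).trace = (expval P (phasePointOperator p n l) : ℂ) := by
  rw [expval]
  rcases exists_char_trace_mul_phasePointOperator hp hP l with h | ⟨h, _⟩ <;> rw [h] <;> simp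

theorem isValueAssignment_phasePointOperator (hp : p ≠ 2) (l : Fin n → ZMod p × ZMod p) :
    IsValueAssignment (stabilizerProjectors p n)
      (fun P => expval P (phasePointOperator p n l)) := by
  refine ⟨fun P hP => expval_eq_zero_or_one hp hP l, fun P hP Q hQ _ hPQ => ?_⟩
  rintro ⟨h1, h2⟩
  have key : ∀ R : Op p n, expval R (phasePointOperator p n l) = 1 →
      (R * phasePointOperator p n l).trace ≠ 0 := by
    intro R h h0
    rw [expval, h0, Complex.zero_re] at h
    exact zero_ne_one h
  obtain ⟨_, W, hW, rfl, hW1⟩ :=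
    (exists_char_trace_mul_phasePointOperator hp hP l).resolve_left (key P h1)
  obtain ⟨_, V, hV, rfl, hV1⟩ :=
    (exists_char_trace_mul_phasePointOperator hp hQ l).resolve_left (key Q h2)
  refine trace_projOf_mul_projOf_ne_zero W V hW hV _ hW1 hV1 ?_
  rw [hPQ, Matrix.trace_zero]

theorem existsUnique_expval_eq_one (hp : p ≠ 2) (l : Fin n → ZMod p × ZMod p)
    {B : Finset (Op p n)} (hB : (B : Set (Op p n)) ⊆ stabilizerProjectors p n)
    (horth : ∀ P ∈ B, ∀ Q ∈ B, P ≠ Q → P * Q = 0) (hsum : ∑ P ∈ B, P = 1) :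
    ∃! P, P ∈ B ∧ expval P (phasePointOperator p n l) = 1 := by
  have h1 : ∑ P ∈ B, expval P (phasePointOperator p n l) = 1 := by
    rw [← expval_sum, hsum, expval, one_mul, trace_phasePointOperator hp, Complex.one_re]
  obtain ⟨P, hP, hP0⟩ := Finset.exists_ne_zero_of_sum_ne_zero (h1.trans_ne one_ne_zero)
  have hP1 := (expval_eq_zero_or_one hp (hB hP) l).resolve_left hP0
  refine ⟨P, ⟨hP, hP1⟩, ?_⟩
  rintro Q ⟨hQ, hQ1⟩
  by_contra hne
  exact (isValueAssignment_phasePointOperator hp l).2 P (hB hP) Q (hB hQ) (Ne.symm hne)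
    (horth P hP Q hQ (Ne.symm hne)) ⟨hP1, hQ1⟩

end ValueAssignment

/-! ### The discrete Wigner function -/

section Wigner

variable {p n : ℕ} [Fact p.Prime]

theorem sum_facetOperator_mul (hp : p ≠ 2) (i j k m : ZMod p) :
    ∑ l : ZMod p × ZMod p, facetOperator p (phaseVector l.1 l.2) i j *
      facetOperator p (phaseVector l.1 l.2) k m = if i = m ∧ j = k then (p : ℂ) else 0 := by
  have h2 := two_ne_zero_zmod hp
  simp_rw [facetOperator_phaseVector_apply hp]
  rw [Fintype.sum_prod_type, Finset.sum_eq_single (2⁻¹ * (i + j))]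
  · have h3 : i + j = 2 * (2⁻¹ * (i + j)) := by field_simp
    have h4 : k + m = 2 * (2⁻¹ * (i + j)) ↔ k + m = i + j := by rw [← h3]
    simp only [← h3, if_true]
    by_cases hkm : k + m = i + j
    · simp only [hkm, if_true, ← AddChar.map_add_eq_mul]
      have h5 : ∀ z : ZMod p, z * (i - j) + z * (k - m) = (i - j + (k - m)) * z := fun z => by ring
      simp_rw [h5]
      rw [sum_chi_mul]
      have h6 : i - j + (k - m) = 0 ↔ i = m ∧ j = k := by
        constructor
        · intro h
          have h7 : i = m := mul_left_cancel₀ h2 (by linear_combination h - hkm)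
          exact ⟨h7, by linear_combination -hkm - h7⟩
        · rintro ⟨rfl, rfl⟩
          ring
      simp only [h6]
    · have h6 : ¬ (i = m ∧ j = k) := by
        rintro ⟨rfl, rfl⟩
        exact hkm (add_comm _ _)
      simp [hkm, h6]
  · intro x _ hx
    refine Finset.sum_eq_zero fun z _ => ?_
    rw [if_neg, zero_mul]
    intro h
    exact hx (by rw [h]; field_simp)
  · intro h
    exact absurd (Finset.mem_univ _) h

theorem sum_phasePointOperator_mul (hp : p ≠ 2) (i j k m : Fin n → ZMod p) :
    ∑ l, phasePointOperator p n l i j * phasePointOperator p n l k m =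
      if i = m ∧ j = k then (p : ℂ) ^ n else 0 := by
  simp only [phasePointOperator, tensor, Matrix.of_apply, ← Finset.prod_mul_distrib]
  rw [← Fintype.piFinset_univ, ← Finset.prod_univ_sum (fun _ => Finset.univ)
    (fun t (l : ZMod p × ZMod p) => facetOperator p (phaseVector l.1 l.2) (i t) (j t) *
      facetOperator p (phaseVector l.1 l.2) (k t) (m t))]
  simp_rw [sum_facetOperator_mul hp]
  rw [Finset.prod_ite_zero]
  simp [funext_iff, forall_and]

/-- The phase-point operators are an orthogonal basis for the trace inner product. -/
theorem trace_mul_eq_sum_phasePointOperator (hp : p ≠ 2) (P τ : Op p n) :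
    (p : ℂ) ^ n * (P * τ).trace =
      ∑ l, (P * phasePointOperator p n l).trace * (phasePointOperator p n l * τ).trace := by
  have h1 : ∀ l, (P * phasePointOperator p n l).trace * (phasePointOperator p n l * τ).trace =
      ∑ a, ∑ b, ∑ c, ∑ d, P a b * τ d c *
        (phasePointOperator p n l b a * phasePointOperator p n l c d) := by
    intro l
    simp only [Matrix.trace, Matrix.diag_apply, Matrix.mul_apply]
    rw [Finset.sum_mul]
    refine Finset.sum_congr rfl fun a _ => ?_
    rw [Finset.sum_mul]
    refine Finset.sum_congr rfl fun b _ => ?_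
    rw [Finset.mul_sum]
    refine Finset.sum_congr rfl fun c _ => ?_
    rw [Finset.mul_sum]
    exact Finset.sum_congr rfl fun d _ => by ring
  simp_rw [h1]
  rw [Finset.sum_comm]
  simp only [Matrix.trace, Matrix.diag_apply, Matrix.mul_apply]
  rw [Finset.mul_sum]
  refine Finset.sum_congr rfl fun a _ => ?_
  rw [Finset.sum_comm, Finset.mul_sum]
  refine Finset.sum_congr rfl fun b _ => ?_
  rw [Finset.sum_comm, Finset.sum_eq_single a]
  · rw [Finset.sum_comm, Finset.sum_eq_single b]
    · rw [← Finset.mul_sum, sum_phasePointOperator_mul hp, if_pos ⟨rfl, rfl⟩]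
      ring
    · intro d _ hd
      rw [← Finset.mul_sum, sum_phasePointOperator_mul hp, if_neg (fun h => hd h.1.symm), mul_zero]
    · intro h
      exact absurd (Finset.mem_univ _) h
  · intro c _ hc
    rw [Finset.sum_comm]
    refine Finset.sum_eq_zero fun d _ => ?_
    rw [← Finset.mul_sum, sum_phasePointOperator_mul hp, if_neg (fun h => hc h.2.symm), mul_zero]
  · intro h
    exact absurd (Finset.mem_univ _) h

theorem expval_comm {ι : Type*} [Fintype ι] (A B : Matrix ι ι ℂ) : expval A B = expval B A := by
  rw [expval, Matrix.trace_mul_comm, expval]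

theorem expval_eq_sum_wigner (hp : p ≠ 2) {P : Op p n}
    (hP : ∀ l, (P * phasePointOperator p n l).trace = (expval P (phasePointOperator p n l) : ℂ))
    (τ : Op p n) :
    expval P τ = ∑ l, wigner τ l * expval P (phasePointOperator p n l) := by
  have hpn : (p : ℝ) ^ n ≠ 0 := pow_ne_zero _ (Nat.cast_ne_zero.2 (NeZero.ne p))
  have h1 := congrArg Complex.re (trace_mul_eq_sum_phasePointOperator hp P τ)
  have h2 : (p : ℂ) ^ n = (((p : ℝ) ^ n : ℝ) : ℂ) := by push_cast; rfl
  rw [h2, Complex.re_ofReal_mul, Complex.re_sum] at h1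
  refine mul_left_cancel₀ hpn (h1.trans ?_)
  rw [Finset.mul_sum]
  refine Finset.sum_congr rfl fun l _ => ?_
  rw [hP, Complex.re_ofReal_mul, wigner]
  change expval P _ * expval _ τ = _
  field_simp

theorem sum_wigner (hp : p ≠ 2) {τ : Op p n} (hτ : IsState τ) : ∑ l, wigner τ l = 1 := by
  have h1 : ∀ l, expval (1 : Op p n) (phasePointOperator p n l) = 1 := by
    intro l
    rw [expval, one_mul, trace_phasePointOperator hp, Complex.one_re]
  have h2 := expval_eq_sum_wigner hp (P := 1) (fun l => by
    rw [h1, one_mul, trace_phasePointOperator hp, Complex.ofReal_one]) τ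
  rw [expval_one hτ] at h2
  simp_rw [h1, mul_one] at h2
  exact h2.symm

theorem isNCHVModel_wigner (hp : p ≠ 2) {τ : Op p n} (hτ : τ ∈ wignerPositive p n) :
    IsNCHVModel τ (wigner τ) (fun l P => expval P (phasePointOperator p n l)) :=
  ⟨hτ.2, sum_wigner hp hτ.1, isValueAssignment_phasePointOperator hp,
    fun l _ hB horth hsum => existsUnique_expval_eq_one hp l hB horth hsum,
    fun _ hP => expval_eq_sum_wigner hp (trace_eq_expval hp hP) τ⟩

/-- Averages over a hidden variable model satisfy all noncontextuality inequalities. -/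
theorem IsNCHVModel.sum_le {τ : Op p n} {Λ : Type*} [Fintype Λ] {μ : Λ → ℝ} {v : Λ → Op p n → ℝ}
    (h : IsNCHVModel τ μ v) {S : Finset (Op p n)}
    (hS : (S : Set (Op p n)) ⊆ stabilizerProjectors p n) {c : Op p n → ℝ} {β : ℝ}
    (hc : IsNoncontextualityInequality S c β) : ∑ P ∈ S, c P * expval P τ ≤ β := by
  obtain ⟨hμ, hμ1, hv, _, hτ⟩ := h
  have h1 : ∑ P ∈ S, c P * expval P τ = ∑ l, μ l * ∑ P ∈ S, c P * v l P := by
    simp_rw [Finset.mul_sum]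
    rw [Finset.sum_comm]
    refine Finset.sum_congr rfl fun P hP => ?_
    rw [hτ P (hS hP), Finset.mul_sum]
    exact Finset.sum_congr rfl fun l _ => by ring
  rw [h1]
  calc ∑ l, μ l * ∑ P ∈ S, c P * v l P ≤ ∑ l, μ l * β := by
        refine Finset.sum_le_sum fun l _ => mul_le_mul_of_nonneg_left (hc (v l) ?_) (hμ l)
        exact ⟨fun P hP => (hv l).1 P (hS hP), fun P hP Q hQ => (hv l).2 P (hS hP) Q (hS hQ)⟩
    _ = β := by rw [← Finset.sum_mul, hμ1, one_mul]

theorem expval_sum_le_indepNum (hp : p ≠ 2) {τ : Op p n} (hτ : τ ∈ wignerPositive p n)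
    {S : Finset (Op p n)} (hS : (S : Set (Op p n)) ⊆ stabilizerProjectors p n) :
    expval (∑ P ∈ S, P) τ ≤ (exclusivityGraph S).indepNum := by
  have h := (isNCHVModel_wigner hp hτ).sum_le hS (c := fun _ => 1)
    (β := (exclusivityGraph S).indepNum) (fun v hv => by
      simp only [one_mul]
      exact sum_le_indepNum hv)
  simp only [one_mul] at h
  rwa [expval_sum]

theorem expval_smul_add_smul {ι : Type*} [Fintype ι] (A ρ σ : Matrix ι ι ℂ) (a b : ℝ) :
    expval A (a • ρ + b • σ) = a * expval A ρ + b * expval A σ := by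
  simp only [expval, mul_add, mul_smul_comm, Matrix.trace_add, Matrix.trace_smul, Complex.add_re,
    Complex.smul_re, smul_eq_mul]

theorem convex_wignerPositive : Convex ℝ (wignerPositive p n) := by
  intro ρ hρ σ hσ a b ha hb hab
  refine ⟨⟨(hρ.1.1.smul ha).add (hσ.1.1.smul hb), ?_⟩, fun l => ?_⟩
  · rw [Matrix.trace_add, Matrix.trace_smul, Matrix.trace_smul, hρ.1.2, hσ.1.2, ← add_smul, hab,
      one_smul]
  · have h1 : wigner (a • ρ + b • σ) l = a * wigner ρ l + b * wigner σ l := by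
      simp only [wigner, expval_smul_add_smul]
      ring
    rw [h1]
    exact add_nonneg (mul_nonneg ha (hρ.2 l)) (mul_nonneg hb (hσ.2 l))

theorem convexHull_stabilizerProjectors_subset (hp : p ≠ 2) :
    convexHull ℝ (stabilizerProjectors p n) ⊆ wignerPositive p n := by
  refine convexHull_min (fun P hP => ⟨isState_of_mem_stabilizerProjectors hP, fun l => ?_⟩)
    convex_wignerPositive
  rw [wigner, expval_comm]
  rcases expval_eq_zero_or_one hp hP l with h | h <;> rw [h]
  · rw [zero_div]
  · positivity

theorem adjoinAncilla_mem_wignerPositive {ρ : Op1 p} {σ : Op p n} (hρ : IsState ρ)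
    (hρs : ρ ∈ simPolytope p) (hσ : σ ∈ wignerPositive p n) :
    adjoinAncilla ρ σ ∈ wignerPositive p (n + 1) := by
  refine ⟨hρ.adjoinAncilla hσ.1, fun l => ?_⟩
  have h1 : phasePointOperator p (n + 1) l =
      adjoinAncilla (facetOperator p (phaseVector (l 0).1 (l 0).2))
        (phasePointOperator p n (Fin.tail l)) := tensor_succ _
  have h2 : wigner (adjoinAncilla ρ σ) l =
      expval (facetOperator p (phaseVector (l 0).1 (l 0).2)) ρ / p * wigner σ (Fin.tail l) := by
    rw [wigner, h1, expval_adjoinAncilla (conjTranspose_facetOperator _) hρ.1.isHermitian, wigner,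
      pow_succ, div_mul_div_comm, mul_comm ((p : ℝ) ^ n)]
  rw [h2]
  exact mul_nonneg (div_nonneg (hρs.2.2 _ fun _ => ⟨_, _, rfl⟩) (Nat.cast_nonneg p)) (hσ.2 _)

theorem single_mem_stabilizerProjectors (k : Fin n → ZMod p) :
    (Matrix.single k k 1 : Op p n) ∈ stabilizerProjectors p n :=
  ⟨1, one_mem _, k, by simp⟩

theorem exhibitsContextuality_iff (hp : p ≠ 2) {ρ : Op1 p} (hρ : IsState ρ) :
    ExhibitsContextuality p ρ ↔ ρ ∉ simPolytope p := by
  constructor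
  · rintro ⟨n, σ, hσ, S, hS, c, β, hc, hlt⟩ hρs
    have h := adjoinAncilla_mem_wignerPositive hρ hρs (convexHull_stabilizerProjectors_subset hp hσ)
    exact absurd ((isNCHVModel_wigner hp h).sum_le hS hc) (not_le.2 hlt)
  · intro h
    obtain ⟨r, hr, hneg⟩ := (not_mem_simPolytope_iff hρ).1 h
    have hσ := single_mem_stabilizerProjectors (0 : Fin 1 → ZMod p)
    refine ⟨1, Matrix.single 0 0 1, subset_convexHull ℝ _ hσ, testSet p r, testSet_subset r,
      fun _ => 1, (p : ℝ) ^ 3, fun v hv => ?_, ?_⟩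
    · simp only [one_mul]
      have h1 := sum_le_indepNum hv
      rw [indepNum_eq hr] at h1
      exact_mod_cast h1
    · simp only [one_mul]
      rw [← expval_sum]
      change _ < expval (witness p r) _
      rw [expval_witness_adjoinAncilla r hρ (isState_of_mem_stabilizerProjectors hσ)]
      linarith

end Wigner

end QuditContextuality

end

theorem theorem1 (p : ℕ) [Fact p.Prime] :
    -- every prime `p`: independence numbers and noncontextuality inequalities
    (∀ r ∈ facets p,
      (exclusivityGraph (testSet p r)).indepNum = p ^ 3 ∧
      IsGreatest (nchvValues (testSet p r)) ((p : ℝ) ^ 3) ∧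
      ∀ ρ σ : Op1 p, IsState ρ → IsState σ →
        ((p : ℝ) ^ 3 < expval (witness p r) (tensor ![ρ, σ]) ↔
          expval (facetOperator p r) ρ < 0)) ∧
    (∀ ρ σ : Op1 p, IsState ρ → IsState σ →
      ((∃ r ∈ facets p, (p : ℝ) ^ 3 < expval (witness p r) (tensor ![ρ, σ])) ↔
        ρ ∉ simPolytope p)) ∧
    -- odd primes
    (p ≠ 2 →
      -- maximal contextuality
      (∀ r ∈ facets p,
        IsGreatest {x : ℝ | ∃ τ : Op p 2, IsState τ ∧ x = expval (witness p r) τ}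
          ((p : ℝ) ^ 3 + 1) ∧
        (∃ ρ : Op1 p, IsState ρ ∧ ∀ σ : Op1 p, IsState σ →
          expval (witness p r) (tensor ![ρ, σ]) = (p : ℝ) ^ 3 + 1) ∧
        lovaszTheta (exclusivityGraph (testSet p r)) = (p : ℝ) ^ 3 + 1 ∧
        fractionalPackingNumber (exclusivityGraph (testSet p r)) = (p : ℝ) ^ 3 + 1) ∧
      -- a state is contextual exactly if it violates one of the above inequalities
      (∀ ρ : Op1 p, IsState ρ →
        (ExhibitsContextuality p ρ ↔ ρ ∉ simPolytope p) ∧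
        ∀ σ : Op1 p, IsState σ → (ExhibitsContextuality p ρ ↔
          ∃ r ∈ facets p, (p : ℝ) ^ 3 < expval (witness p r) (tensor ![ρ, σ]))) ∧
      -- the discrete Wigner function is a noncontextual model
      (∀ n : ℕ,
        convexHull ℝ (stabilizerProjectors p n) ⊆ wignerPositive p n ∧
        (∀ (ρ : Op1 p) (σ : Op p n), IsState ρ → ρ ∈ simPolytope p → σ ∈ wignerPositive p n →
          adjoinAncilla ρ σ ∈ wignerPositive p (n + 1)) ∧
        ∀ τ ∈ wignerPositive p n,
          IsNCHVModel τ (wigner τ) (fun l P => expval P (phasePointOperator p n l)) ∧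
          ∀ S : Finset (Op p n), (S : Set (Op p n)) ⊆ stabilizerProjectors p n →
            expval (∑ P ∈ S, P) τ ≤ (exclusivityGraph S).indepNum ∧
            ∀ (c : Op p n → ℝ) (β : ℝ), IsNoncontextualityInequality S c β →
              ∑ P ∈ S, c P * expval P τ ≤ β)) := by
  have hviol : ∀ ρ σ : Op1 p, IsState ρ → IsState σ →
      ((∃ r ∈ facets p, (p : ℝ) ^ 3 < expval (witness p r) (tensor ![ρ, σ])) ↔
        ρ ∉ simPolytope p) := by
    intro ρ σ hρ hσ
    rw [not_mem_simPolytope_iff hρ]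
    simp only [lt_expval_witness_iff _ hρ hσ]
  have hnchv : ∀ r ∈ facets p, IsGreatest (nchvValues (testSet p r)) ((p : ℝ) ^ 3) := by
    intro r hr
    have h := isGreatest_nchvValues (testSet_subset (p := p) r)
    rwa [indepNum_eq hr, Nat.cast_pow] at h
  refine ⟨fun r hr => ⟨indepNum_eq hr, hnchv r hr, fun ρ σ hρ hσ =>
    lt_expval_witness_iff r hρ hσ⟩, hviol, fun hp => ⟨fun r hr => ?_, fun ρ hρ =>
    ⟨exhibitsContextuality_iff hp hρ, fun σ hσ =>
      (exhibitsContextuality_iff hp hρ).trans (hviol ρ σ hρ hσ).symm⟩, fun n =>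
    ⟨convexHull_stabilizerProjectors_subset hp, fun ρ σ hρ hρs hσ =>
      adjoinAncilla_mem_wignerPositive hρ hρs hσ, fun τ hτ =>
      ⟨isNCHVModel_wigner hp hτ, fun S hS => ⟨expval_sum_le_indepNum hp hτ hS, fun c β hc =>
        (isNCHVModel_wigner hp hτ).sum_le hS hc⟩⟩⟩⟩⟩
  obtain ⟨ρ, hρ, hAρ⟩ := exists_state_facetOperator_mul hp hr
  refine ⟨⟨⟨tensor ![ρ, ρ], ?_, (expval_witness_eigenstate hρ hρ hAρ).symm⟩, ?_⟩,
    ⟨ρ, hρ, fun σ hσ => expval_witness_eigenstate hρ hσ hAρ⟩, lovaszTheta_eq hp hr,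
    fractionalPackingNumber_eq hp hr⟩
  · exact hρ.tensorPair hρ
  · rintro _ ⟨τ, hτ, rfl⟩
    exact expval_witness_le hp hr hτ
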